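/- Let $N\cong\mathbb Z^n$, $M=\mathrm{Hom}(N,\mathbb Z)$, and let $\Sigma$ be a complete regular fan in $N_{\mathbb R}=N\otimes\mathbb R$ whose toric manifold $X=X_\Sigma$ is Fano, i.e. $c_1(X)$ is represented by a Kähler form. Let $T\subset \mathrm{Aut}(X)$ be the maximal torus, $U\subset X$ its open orbit, $\mathcal K(T)\cong(S^1)^n$ the maximal compact subgroup of $T$, $\mathcal N(T)$ the normalizer of $T$ in $\mathrm{Aut}(X)$, and $\mathcal W(X)=\mathcal N(T)/T$, which acts linearly on $N_{\mathbb R}=T/\mathcal K(T)$ by conjugation. Fix $x_0\in U$, let $\mathcal W(X,x_0)$ be the stabilizer of $x_0$ in $\mathcal N(T)$ (the image of the splitting $\mathcal W(X)\hookrightarrow\mathcal N(T)$ given by the identification $T\cong U$, $t\mapsto t x_0$), and let $G$ be the compact group generated by $\mathcal K(T)$ and $\mathcal W(X,x_0)$. Tian's invariant. Let $g=\{g_{i\bar j}\}$ be a smooth $G$-invariant Kähler metric on $X$ whose form $\omega_g=\frac{\sqrt{-1}}{2\pi}\sum g_{i\bar j}\,dz_i\wedge d\bar z_j$ represents $c_1(X)$,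 i.e. $R_{i\bar j}-g_{i\bar j}=\partial_i\partial_{\bar j}\Phi$ for some smooth real function $\Phi$ on $X$, where $R_{i\bar j}=-\partial_i\partial_{\bar j}\log\det(g_{k\bar l})$; put $dV_g=\omega_g^n/n!$. Let $P_G(X,g)$ be the set of $C^2$ $G$-invariant functions $\phi:X\to\mathbb R$ with $\sup_X\phi=0$ and $\omega_g+\frac{\sqrt{-1}}{2\pi}\partial\bar\partial\phi\ge 0$. Then $\alpha_G(X)\in[0,\infty]$ is the supremum of all $\lambda>0$ for which there is a finite constant $C(\lambda)$ with $$\int_X e^{-\lambda\phi}\,dV_g\le C(\lambda)\qquad\text{for all }\phi\in P_G(X,g).$$ The real invariant. Let $\Delta=\{v\in M_{\mathbb R}:\langle v,e\rangle\le 1\text{ for all primitive generators } e \text{ of the rays of }\Sigma\}$ and $$\tilde u(y)=\log\sum_{v\in M\cap\Delta}e^{\langle v,y\rangle},\qquad y\in N_{\mathbb R}.$$ Let $dy$ be the Haar measure on $N_{\mathbb R}$ normalized by $N$, and let $P_G(N_{\mathbb R},\tilde u)$ be the set of $C^2$ $\mathcal W(X)$-invariant functions $\tilde\phi:N_{\mathbb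 R}\to\mathbb R$ such that $\tilde u+\tilde\phi$ is convex, $\sup_{N_{\mathbb R}}\tilde\phi=0$, and $|\tilde\phi|$ is bounded on $N_{\mathbb R}$. Then $\tilde\alpha_G(X)\in[0,\infty]$ is the supremum of all $\lambda>0$ for which there is a finite constant $\tilde C(\lambda)$ with $$\int_{N_{\mathbb R}}e^{-\lambda\tilde\phi-\tilde u}\,dy\le\tilde C(\lambda)\qquad\text{for all }\tilde\phi\in P_G(N_{\mathbb R},\tilde u).$$ Then, for every such metric $g$, $$\tilde\alpha_G(X)\le\alpha_G(X).$$ -/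

import Mathlib

open Filter Topology MeasureTheory
open scoped ContDiff ENNReal NNReal ComplexOrder

noncomputable section

/-! ## Complete regular fans -/

/-- The real cone generated by a finite set of lattice vectors. -/
def latticeCone {n : ℕ} (s : Finset (Fin n → ℤ)) : Set (Fin n → ℝ) :=
  {y | ∃ c : (Fin n → ℤ) → ℝ, (∀ e, 0 ≤ c e) ∧ ∀ i, y i = ∑ e ∈ s, c e * (e i : ℝ)}

/-- A complete regular fan in `N_ℝ = ℝⁿ`, `N = ℤⁿ`, given by its maximal cones; a maximal cone is
recorded by the set of primitive generators of its rays, which is a basis of the lattice.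
The cones of the fan are the cones generated by the subsets of these sets. -/
structure RegularFan (n : ℕ) where
  maxCones : Finset (Finset (Fin n → ℤ))
  linearIndependent : ∀ s ∈ maxCones, LinearIndependent ℤ (fun e : s => (e : Fin n → ℤ))
  span_eq_top : ∀ s ∈ maxCones, Submodule.span ℤ (s : Set (Fin n → ℤ)) = ⊤
  inter_eq : ∀ s ∈ maxCones, ∀ t ∈ maxCones,
    latticeCone s ∩ latticeCone t = latticeCone (s ∩ t)
  complete : ∀ y : Fin n → ℝ, ∃ s ∈ maxCones, y ∈ latticeCone s

namespace RegularFan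

variable {n : ℕ} (F : RegularFan n)

/-- The primitive generators of the one-dimensional cones of the fan. -/
def rays : Finset (Fin n → ℤ) := F.maxCones.biUnion id

/-! ## The toric manifold, as the homogeneous coordinate quotient -/

/-- The open set of homogeneous coordinates `z = (z_ρ)` such that the rays `ρ` with `z_ρ = 0`
lie in a common cone of the fan. -/
def CoxDomain : Type :=
  {z : F.rays → ℂ // ∃ s ∈ F.maxCones, ∀ ρ, z ρ = 0 → (ρ : Fin n → ℤ) ∈ s}

/-- The kernel of `(ℂˣ)^rays → N ⊗ ℂˣ = (ℂˣ)ⁿ`, `g ↦ ∏ ρ ⊗ g_ρ`. -/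
def coxGroup : Subgroup (F.rays → ℂˣ) where
  carrier := {g | ∀ i, ∏ ρ, g ρ ^ ((ρ : Fin n → ℤ) i) = 1}
  mul_mem' := by
    intro a b ha hb i
    simp only [Pi.mul_apply, mul_zpow, Finset.prod_mul_distrib, ha i, hb i, mul_one]
  one_mem' := by intro i; simp
  inv_mem' := by
    intro a ha i
    simp only [Pi.inv_apply, inv_zpow, Finset.prod_inv_distrib, ha i, inv_one]

/-- Coordinatewise multiplication by a vector of units. -/
def coxMul (l : F.rays → ℂˣ) (z : F.CoxDomain) : F.CoxDomain :=
  ⟨fun ρ => l ρ * z.1 ρ, by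
    obtain ⟨s, hs, h⟩ := z.2
    exact ⟨s, hs, fun ρ hρ => h ρ (by simpa using hρ)⟩⟩

/-- Two vectors of homogeneous coordinates give the same point if they lie in one orbit of
`coxGroup`. -/
def coxSetoid : Setoid F.CoxDomain where
  r z w := ∃ g ∈ F.coxGroup, w = F.coxMul g z
  iseqv :=
    { refl := fun z => ⟨1, F.coxGroup.one_mem, Subtype.ext (by funext ρ; simp [coxMul])⟩
      symm := by
        rintro z w ⟨g, hg, rfl⟩
        exact ⟨g⁻¹, F.coxGroup.inv_mem hg, Subtype.ext (by funext ρ; simp [coxMul])⟩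
      trans := by
        rintro z w v ⟨g, hg, rfl⟩ ⟨k, hk, rfl⟩
        exact ⟨k * g, F.coxGroup.mul_mem hk hg,
          Subtype.ext (by funext ρ; simp [coxMul, mul_assoc])⟩ }

/-- The compact complex toric manifold `X = X_Σ` of the fan. -/
def Variety : Type := Quotient F.coxSetoid

instance : TopologicalSpace F.CoxDomain := instTopologicalSpaceSubtype

instance : TopologicalSpace F.Variety :=
  inferInstanceAs (TopologicalSpace (Quotient F.coxSetoid))

instance : MeasurableSpace F.Variety := borel F.Variety

instance : BorelSpace F.Variety := ⟨rfl⟩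

/-- The point with given homogeneous coordinates. -/
def point (z : F.CoxDomain) : F.Variety := Quotient.mk F.coxSetoid z

/-- The affine chart `ℂ^s ≅ U_s ⊆ X` of a maximal cone `s` (coordinates labelled by the
generators of `s`): the homogeneous coordinates off `s` are set equal to `1`. These charts are
the standard holomorphic atlas of `X`. -/
def chart (s : F.maxCones) (z : s.1 → ℂ) : F.Variety :=
  F.point ⟨fun ρ => if h : (ρ : Fin n → ℤ) ∈ s.1 then z ⟨ρ, h⟩ else 1, s.1, s.2, by
    intro ρ hρ
    by_contra h
    simp [h] at hρ⟩

/-- The open dense orbit `U ⊆ X` of the torus. -/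
def openOrbit : Set F.Variety := {x | ∃ z : F.CoxDomain, (∀ ρ, z.1 ρ ≠ 0) ∧ F.point z = x}

/-! ## Automorphisms, the torus, its normalizer, and the compact group `G` -/

/-- `h` is the expression of `f : X → X` in the charts of `s` and `t` near `z₀`, and it is
holomorphic at `z₀`. -/
def IsLocalExpr (f : F.Variety → F.Variety) (s t : F.maxCones) (z₀ : s.1 → ℂ)
    (h : (s.1 → ℂ) → (t.1 → ℂ)) : Prop :=
  AnalyticAt ℂ h z₀ ∧ ∀ᶠ z in 𝓝 z₀, f (F.chart s z) = F.chart t (h z)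

/-- Holomorphic maps `X → X`. -/
def IsHolomorphic (f : F.Variety → F.Variety) : Prop :=
  ∀ (s : F.maxCones) (z₀ : s.1 → ℂ), ∃ (t : F.maxCones) (h : (s.1 → ℂ) → (t.1 → ℂ)),
    F.IsLocalExpr f s t z₀ h

variable {F} in
theorem IsHolomorphic.comp {f k : F.Variety → F.Variety} (hf : F.IsHolomorphic f)
    (hk : F.IsHolomorphic k) : F.IsHolomorphic (f ∘ k) := by
  intro s z₀
  obtain ⟨t, h, ha, he⟩ := hk s z₀
  obtain ⟨r, h', ha', he'⟩ := hf t (h z₀)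
  refine ⟨r, h' ∘ h, ha'.comp ha, ?_⟩
  filter_upwards [he, ha.continuousAt.eventually he'] with z h1 h2
  simp [h1, h2]

theorem isHolomorphic_id : F.IsHolomorphic id :=
  fun s z₀ => ⟨s, id, analyticAt_id, Eventually.of_forall fun _ => rfl⟩

/-- `Aut(X)`: the group of biholomorphic maps `X → X`. -/
def autGroup : Subgroup (Equiv.Perm F.Variety) where
  carrier := {f | F.IsHolomorphic f ∧ F.IsHolomorphic f.symm}
  mul_mem' := by
    rintro a b ⟨ha, ha'⟩ ⟨hb, hb'⟩
    exact ⟨ha.comp hb, hb'.comp ha'⟩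
  one_mem' := ⟨F.isHolomorphic_id, F.isHolomorphic_id⟩
  inv_mem' := fun ⟨ha, ha'⟩ => ⟨ha', ha⟩

/-- The action of `(ℂˣ)^rays` on `X`. -/
def torusMap (l : F.rays → ℂˣ) : F.Variety → F.Variety :=
  Quotient.map (sa := F.coxSetoid) (sb := F.coxSetoid) (F.coxMul l) (by
    rintro z w ⟨g, hg, rfl⟩
    exact ⟨g, hg, Subtype.ext (by funext ρ; simp [coxMul, mul_left_comm])⟩)

theorem torusMap_mul (l k : F.rays → ℂˣ) (x : F.Variety) :
    F.torusMap (l * k) x = F.torusMap l (F.torusMap k x) := by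
  induction x using Quotient.inductionOn with
  | h z =>
    exact congrArg (Quotient.mk F.coxSetoid)
      (Subtype.ext (by funext ρ; simp [coxMul, mul_assoc]))

theorem torusMap_one (x : F.Variety) : F.torusMap 1 x = x := by
  induction x using Quotient.inductionOn with
  | h z =>
    exact congrArg (Quotient.mk F.coxSetoid) (Subtype.ext (by funext ρ; simp [coxMul]))

/-- The homomorphism `(ℂˣ)^rays → Aut(X)`. It induces an isomorphism of
`(ℂˣ)^rays ⧸ coxGroup = N ⊗ ℂˣ` with the torus `T`. -/
def torusHom : (F.rays → ℂˣ) →* Equiv.Perm F.Variety where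
  toFun l :=
    { toFun := F.torusMap l
      invFun := F.torusMap l⁻¹
      left_inv := fun x => by rw [← torusMap_mul, inv_mul_cancel, torusMap_one]
      right_inv := fun x => by rw [← torusMap_mul, mul_inv_cancel, torusMap_one] }
  map_one' := Equiv.ext fun x => F.torusMap_one x
  map_mul' l k := Equiv.ext fun x => F.torusMap_mul l k x

/-- The maximal torus `T` acting on `X`. -/
def torus : Subgroup (Equiv.Perm F.Variety) := F.torusHom.range

/-- The maximal compact subgroup `K(T) ≅ (S¹)ⁿ` of `T`. -/
def compactTorus : Subgroup (Equiv.Perm F.Variety) :=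
  Subgroup.map F.torusHom
    { carrier := {l | ∀ ρ, ‖(l ρ : ℂ)‖ = 1}
      mul_mem' := by
        intro a b ha hb ρ
        simp [ha ρ, hb ρ]
      one_mem' := by intro ρ; simp
      inv_mem' := by
        intro a ha ρ
        simp [ha ρ] }

/-- The normalizer `N(T)` of `T` in `Aut(X)`. The group `W(X)` is `N(T)/T`. -/
def torusNormalizer : Subgroup (Equiv.Perm F.Variety) :=
  F.autGroup ⊓ Subgroup.normalizer (F.torus : Set (Equiv.Perm F.Variety))

/-- `W(X, x₀)`: for `x₀ ∈ U` the identification `T ≅ U`, `t ↦ t x₀`, splits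
`1 → T → N(T) → W(X) → 1`, and the image of the splitting is the stabilizer of `x₀`. -/
def pointedWeyl (x₀ : F.Variety) : Subgroup (Equiv.Perm F.Variety) :=
  F.torusNormalizer ⊓ MulAction.stabilizer (Equiv.Perm F.Variety) x₀

/-- The compact group `G` generated by `K(T)` and `W(X, x₀)`. -/
def compactGroup (x₀ : F.Variety) : Subgroup (Equiv.Perm F.Variety) :=
  F.compactTorus ⊔ F.pointedWeyl x₀

/-- The projection `T → T/K(T) = N_ℝ` on the level of `(ℂˣ)^rays`:
`l ↦ ∑ log|l_ρ| ρ`. -/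
def logMap (l : F.rays → ℂˣ) : Fin n → ℝ :=
  fun i => ∑ ρ : F.rays, Real.log ‖(l ρ : ℂ)‖ * ((ρ : Fin n → ℤ) i : ℝ)

/-- Invariance of a function on `N_ℝ` under `W(X) = N(T)/T`, which acts on `T` by conjugation
and hence on `N_ℝ = T/K(T)`. -/
def IsWeylInvariant (φ : (Fin n → ℝ) → ℝ) : Prop :=
  ∀ f ∈ F.torusNormalizer, ∀ l l' : F.rays → ℂˣ,
    f * F.torusHom l * f⁻¹ = F.torusHom l' → φ (F.logMap l') = φ (F.logMap l)

end RegularFan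

/-! ## Complex calculus in a chart -/

/-- The Wirtinger derivative `∂f/∂z_i`. -/
def wirtinger {ι : Type*} [Fintype ι] [DecidableEq ι] (i : ι) (f : (ι → ℂ) → ℂ)
    (z : ι → ℂ) : ℂ :=
  (fderiv ℝ f z (Pi.single i 1) - Complex.I * fderiv ℝ f z (Pi.single i Complex.I)) / 2

/-- The Wirtinger derivative `∂f/∂z̄_i`. -/
def wirtingerBar {ι : Type*} [Fintype ι] [DecidableEq ι] (i : ι) (f : (ι → ℂ) → ℂ)
    (z : ι → ℂ) : ℂ :=
  (fderiv ℝ f z (Pi.single i 1) + Complex.I * fderiv ℝ f z (Pi.single i Complex.I)) / 2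

/-- The complex Hessian `∂²φ/∂z_i∂z̄_j` of a real function. -/
def complexHessian {ι : Type*} [Fintype ι] [DecidableEq ι] (φ : (ι → ℂ) → ℝ)
    (z : ι → ℂ) : Matrix ι ι ℂ :=
  Matrix.of fun i j => wirtinger i (wirtingerBar j fun w => (φ w : ℂ)) z

/-- The Jacobian matrix `∂h_k/∂z_i` (row `i`, column `k`) of a holomorphic map. -/
def holJacobian {ι κ : Type*} [Fintype ι] [DecidableEq ι] [Fintype κ]
    (h : (ι → ℂ) → (κ → ℂ)) (z : ι → ℂ) : Matrix ι κ ℂ :=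
  Matrix.of fun i k => fderiv ℂ h z (Pi.single i 1) k

namespace RegularFan

variable {n : ℕ} (F : RegularFan n)

/-! ## Kähler metrics -/

/-- The coefficient matrices `g_{i j̄}` of a Hermitian tensor in the charts are mapped to
themselves under pull-back by `f : X → X`. -/
def IsPullbackInvariant (g : ∀ s : F.maxCones, (s.1 → ℂ) → Matrix s.1 s.1 ℂ)
    (f : F.Variety → F.Variety) : Prop :=
  ∀ (s t : F.maxCones) (z : s.1 → ℂ) (h : (s.1 → ℂ) → (t.1 → ℂ)), F.IsLocalExpr f s t z h →
    g s z = holJacobian h z * g t (h z) * (holJacobian h z).conjTranspose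

/-- A smooth Kähler metric on `X`, by its coefficients `g_{i j̄}` in the charts.
The associated form is `ω_g = (√-1/2π) ∑ g_{i j̄} dz_i ∧ dz̄_j`. -/
structure KahlerMetric where
  coeff : ∀ s : F.maxCones, (s.1 → ℂ) → Matrix s.1 s.1 ℂ
  smooth : ∀ s i j, ContDiff ℝ ∞ fun z => coeff s z i j
  posDef : ∀ s z, (coeff s z).PosDef
  /-- The coefficients transform as a tensor under change of charts. -/
  compatible : F.IsPullbackInvariant coeff id
  /-- `d ω_g = 0`. -/
  closed : ∀ s z i j k,
    wirtinger k (fun w => coeff s w i j) z = wirtinger i (fun w => coeff s w k j) z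

variable {F}

/-- `C^k` functions on `X`. -/
def IsCk (k : ℕ∞) (φ : F.Variety → ℝ) : Prop :=
  ∀ s : F.maxCones, ContDiff ℝ k fun z => φ (F.chart s z)

namespace KahlerMetric

variable (g : F.KahlerMetric)

/-- The Ricci tensor `R_{i j̄} = -∂²/∂z_i∂z̄_j log det g`. -/
def ricci (s : F.maxCones) (z : s.1 → ℂ) : Matrix s.1 s.1 ℂ :=
  -complexHessian (fun w => Real.log (g.coeff s w).det.re) z

/-- `ω_g` represents `c₁(X)`: the form `ω_g` is cohomologous to the Ricci form (which represents
`c₁(X)`), which by the `∂∂̄`-lemma on compact Kähler manifolds means that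
`R_{i j̄} - g_{i j̄} = ∂²Φ/∂z_i∂z̄_j` for a smooth real function `Φ` on `X`. Equivalently, `ω_g` is the curvature form of the Hermitian metric on the anticanonical bundle
given by the volume form `e^Φ dV_g`. -/
def RepresentsC1 : Prop :=
  ∃ Φ : F.Variety → ℝ, IsCk ⊤ Φ ∧
    ∀ s z, g.ricci s z - g.coeff s z = complexHessian (fun w => Φ (F.chart s w)) z

/-- Invariance of the metric under a group of transformations of `X`. -/
def IsInvariant (G : Subgroup (Equiv.Perm F.Variety)) : Prop :=
  ∀ f ∈ G, F.IsPullbackInvariant g.coeff f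

/-- The volume `dV_g = ω_gⁿ/n!`, as a measure on `X`. In a chart it is
`π⁻ⁿ det(g_{i j̄})` times Lebesgue measure; the supremum glues these measures, each of which is
the restriction of `dV_g` to the domain of its chart. -/
def volume : Measure F.Variety :=
  ⨆ s : F.maxCones, Measure.map (F.chart s)
    ((MeasureTheory.volume : Measure (s.1 → ℂ)).withDensity fun z =>
      ENNReal.ofReal ((Real.pi ^ n)⁻¹ * (g.coeff s z).det.re))

/-- The set `P_G(X, g)`. -/
def potentials (G : Subgroup (Equiv.Perm F.Variety)) : Set (F.Variety → ℝ) :=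
  {φ | IsCk 2 φ ∧ (∀ f ∈ G, ∀ x, φ (f x) = φ x) ∧ IsLUB (Set.range φ) 0 ∧
    ∀ s z, (g.coeff s z + complexHessian (fun w => φ (F.chart s w)) z).PosSemidef}

/-- Tian's invariant `α_G(X)`, computed with the metric `g`; a value in `[0, ∞]`. -/
def tianAlpha (G : Subgroup (Equiv.Perm F.Variety)) : ℝ≥0∞ :=
  ⨆ (a : ℝ) (_ : 0 < a ∧ ∃ C : ℝ≥0, ∀ φ ∈ g.potentials G,
    ∫⁻ x, ENNReal.ofReal (Real.exp (-a * φ x)) ∂g.volume ≤ C), ENNReal.ofReal a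

end KahlerMetric

variable (F)

/-- `X` is Fano: its first Chern class is positive, i.e. represented by a Kähler form. -/
def IsFano : Prop := ∃ g : F.KahlerMetric, g.RepresentsC1

/-! ## The real invariant -/

/-- `L(Δ) = M ∩ Δ`, where `Δ = {v : ⟨v, e⟩ ≤ 1 for all primitive ray generators e}`. -/
def latticePoints : Set (Fin n → ℤ) := {v | ∀ e ∈ F.rays, v ⬝ᵥ e ≤ 1}

theorem latticePoints_finite : F.latticePoints.Finite := by
  -- every linear functional on `M_ℝ` is bounded above on `Δ`, because the fan is complete
  have key : ∀ y : Fin n → ℝ, ∃ C : ℝ, ∀ v ∈ F.latticePoints, ∑ i, (v i : ℝ) * y i ≤ C := by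
    intro y
    obtain ⟨s, hs, c, hc, hy⟩ := F.complete y
    refine ⟨∑ e ∈ s, c e, fun v hv => ?_⟩
    have h1 : ∑ i, (v i : ℝ) * y i = ∑ e ∈ s, c e * ((v ⬝ᵥ e : ℤ) : ℝ) := by
      simp only [hy, dotProduct, Int.cast_sum, Int.cast_mul, Finset.mul_sum]
      rw [Finset.sum_comm]
      exact Finset.sum_congr rfl fun e _ => Finset.sum_congr rfl fun i _ => by ring
    rw [h1]
    refine Finset.sum_le_sum fun e he => ?_
    have h2 : ((v ⬝ᵥ e : ℤ) : ℝ) ≤ 1 := by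
      exact_mod_cast hv e (Finset.mem_biUnion.2 ⟨s, hs, he⟩)
    nlinarith [hc e]
  choose C hC using key
  refine (Set.finite_Icc (fun i => -⌈C (Pi.single i (-1))⌉)
    (fun i => ⌈C (Pi.single i 1)⌉)).subset fun v hv => ⟨fun i => ?_, fun i => ?_⟩
  · have h := hC (Pi.single i (-1)) v hv
    simp only [Pi.single_apply, mul_ite, mul_zero, Finset.sum_ite_eq', Finset.mem_univ,
      if_true] at h
    have h' := h.trans (Int.le_ceil _)
    have : -(v i) ≤ ⌈C (Pi.single i (-1))⌉ := by
      have : ((-(v i) : ℤ) : ℝ) ≤ (⌈C (Pi.single i (-1))⌉ : ℝ) := by push_cast; linarith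
      exact_mod_cast this
    simp only
    linarith
  · have h := hC (Pi.single i 1) v hv
    simp only [Pi.single_apply, mul_ite, mul_zero, mul_one, Finset.sum_ite_eq', Finset.mem_univ,
      if_true] at h
    exact_mod_cast h.trans (Int.le_ceil _)

/-- The function `ũ(y) = log ∑_{v ∈ L(Δ)} e^{⟨v, y⟩}` on `N_ℝ`. -/
def realPotential (y : Fin n → ℝ) : ℝ :=
  Real.log (∑ v ∈ F.latticePoints_finite.toFinset, Real.exp (∑ i, (v i : ℝ) * y i))

/-- The set `P_G(N_ℝ, ũ)`. -/
def realPotentials : Set ((Fin n → ℝ) → ℝ) :=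
  {φ | ContDiff ℝ 2 φ ∧ F.IsWeylInvariant φ ∧
    ConvexOn ℝ Set.univ (fun y => F.realPotential y + φ y) ∧ IsLUB (Set.range φ) 0 ∧
    ∃ B : ℝ, ∀ y, |φ y| ≤ B}

/-- The real invariant `α̃_G(X)`; a value in `[0, ∞]`. The Haar measure on `N_ℝ = ℝⁿ` normalized
by `N = ℤⁿ` is Lebesgue measure. -/
def realAlpha : ℝ≥0∞ :=
  ⨆ (a : ℝ) (_ : 0 < a ∧ ∃ C : ℝ≥0, ∀ φ ∈ F.realPotentials,
    ∫⁻ y : Fin n → ℝ, ENNReal.ofReal (Real.exp (-a * φ y - F.realPotential y)) ≤ C),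
    ENNReal.ofReal a

end RegularFan

end

/-! ## Wirtinger calculus -/

section Wirtinger

set_option linter.unusedSectionVars false

variable {ι κ μ : Type*} [Fintype ι] [DecidableEq ι] [Fintype κ] [DecidableEq κ]
  [Fintype μ] [DecidableEq μ]

/-! The idea is to turn each `φ` in `P_G(X, g)` into an element of `P_G(N_ℝ, ũ)` at a uniformly
bounded distance, and then to compare the integrals. On the open orbit take logarithmic coordinates
`Y`, with `expPoint Y` the corresponding point. There the metric has the global potential `u = -log
det g - Φ` (`logPotential`), whose complex Hessian is `g` (`complexHessian_logPotential`).

Liouville's theorem makes `u` invariant under every isometry that is affine in `Y`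
(`logPotential_affine`), in particular under the compact torus. So `u + φ` is plurisubharmonic and
depends only on `Re Y`, hence it is convex on `N_ℝ` (`convexOn_logPotential_add`). In the chart of a
cone `s`, `u` behaves like `-2 ∑ log |z_e|`. With `y = 2 Re Y₀ - 2 Re Y`, where `expPoint Y₀ = x₀`,
it therefore stays at bounded distance from the piecewise linear function that is `1` on every ray
generator. Convexity of `u` forces this function to be convex, so it is the support function of `Δ`
and is also at bounded distance from `ũ` (`exists_abs_realPotential_sub_le`).

Consequently `u - ũ + φ`, normalized to have supremum `0`, lies in `P_G(N_ℝ, ũ)`, and the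
normalizing constant is bounded below independently of `φ` because `sup φ = 0`
(`exists_realPotential_sub_mem`). Its Weyl invariance uses that each class of `N(T)/T` has a
representative fixing `x₀` (`exists_mem_pointedWeyl`) and that the linear part of such a map
permutes the lattice points of `Δ`, which leaves `ũ` unchanged (`realPotential_mulVec`).

Finally `dV_g` is `e^{-u-Φ}` times a constant multiple of Lebesgue measure in `Y`. Integrating out
the angles bounds the integral over each chart by a constant times the real integral
(`exists_lintegral_chart_le`), and there are finitely many charts. Hence every exponent admissible
for the real invariant is admissible for Tian's. -/

theorem pi_eq_sum_re_add_im (v : κ → ℂ) :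
    v = ∑ k, ((v k).re • (Pi.single k 1 : κ → ℂ) + (v k).im • (Pi.single k Complex.I : κ → ℂ)) := by
  ext j
  simp only [Finset.sum_apply, Pi.add_apply, Pi.smul_apply, Pi.single_apply, smul_ite, smul_zero,
    Finset.sum_add_distrib, Finset.sum_ite_eq, Finset.mem_univ, if_true, Complex.real_smul, mul_one,
    Complex.re_add_im]

/-- Splitting of a real linear form into its complex linear and antilinear parts. Both Wirtinger
chain rules reduce to it. -/
theorem realLinear_apply_eq_sum (L : (κ → ℂ) →L[ℝ] ℂ) (v : κ → ℂ) :
    L v = ∑ k, (v k * ((L (Pi.single k 1) - Complex.I * L (Pi.single k Complex.I)) / 2) +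
      star (v k) * ((L (Pi.single k 1) + Complex.I * L (Pi.single k Complex.I)) / 2)) := by
  conv_lhs => rw [pi_eq_sum_re_add_im v]
  rw [map_sum]
  refine Finset.sum_congr rfl fun k _ => ?_
  rw [map_add, map_smul, map_smul]
  have h2 : star (v k) = ((v k).re : ℂ) - (v k).im * Complex.I := by
    apply Complex.ext <;> simp
  have h3 : v k = ((v k).re : ℂ) + (v k).im * Complex.I := (Complex.re_add_im _).symm
  rw [h2]
  conv_rhs => rw [h3]
  simp only [Complex.real_smul, Complex.add_re, Complex.ofReal_re, Complex.mul_re, Complex.I_re,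
    Complex.ofReal_im, Complex.I_im, Complex.add_im, Complex.mul_im]
  simp only [mul_zero, sub_zero, add_zero, mul_one, zero_add]
  linear_combination (((v k).im : ℂ) * L (Pi.single k Complex.I)) * Complex.I_sq

theorem fderiv_real_apply_eq {h : (ι → ℂ) → (κ → ℂ)} {z : ι → ℂ}
    (hh : DifferentiableAt ℂ h z) (v : ι → ℂ) : fderiv ℝ h z v = fderiv ℂ h z v := by
  rw [hh.fderiv_restrictScalars ℝ]; rfl

theorem single_I (i : ι) : (Pi.single i Complex.I : ι → ℂ) = Complex.I • Pi.single i 1 := by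
  ext j; simp [Pi.single_apply]

/-- The derivative of `h` commutes with `I`, so the antilinear parts of the two terms cancel and
only the derivatives `∂G/∂z_k` survive. -/
theorem wirtinger_comp {G : (κ → ℂ) → ℂ} {h : (ι → ℂ) → (κ → ℂ)} {z : ι → ℂ}
    (hG : DifferentiableAt ℝ G (h z)) (hh : DifferentiableAt ℂ h z) (i : ι) :
    wirtinger i (fun w => G (h w)) z =
      ∑ k, holJacobian h z i k * wirtinger k G (h z) := by
  have hc : fderiv ℝ (fun w => G (h w)) z = (fderiv ℝ G (h z)).comp (fderiv ℝ h z) :=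
    fderiv_comp z hG (hh.restrictScalars ℝ)
  simp only [wirtinger, hc, ContinuousLinearMap.comp_apply, fderiv_real_apply_eq hh, single_I i,
    map_smul]
  rw [realLinear_apply_eq_sum _ (fderiv ℂ h z (Pi.single i 1)),
    realLinear_apply_eq_sum _ (Complex.I • fderiv ℂ h z (Pi.single i 1)),
    Finset.mul_sum, ← Finset.sum_sub_distrib, Finset.sum_div]
  refine Finset.sum_congr rfl fun k _ => ?_
  simp only [holJacobian, Matrix.of_apply, Pi.smul_apply, smul_eq_mul, star_mul',
    RCLike.star_def, Complex.conj_I]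
  ring_nf
  simp only [Complex.I_sq, Complex.I_pow_three]
  ring

theorem wirtingerBar_comp {G : (κ → ℂ) → ℂ} {h : (ι → ℂ) → (κ → ℂ)} {z : ι → ℂ}
    (hG : DifferentiableAt ℝ G (h z)) (hh : DifferentiableAt ℂ h z) (i : ι) :
    wirtingerBar i (fun w => G (h w)) z =
      ∑ k, star (holJacobian h z i k) * wirtingerBar k G (h z) := by
  have hc : fderiv ℝ (fun w => G (h w)) z = (fderiv ℝ G (h z)).comp (fderiv ℝ h z) :=
    fderiv_comp z hG (hh.restrictScalars ℝ)
  simp only [wirtingerBar, hc, ContinuousLinearMap.comp_apply, fderiv_real_apply_eq hh, single_I i,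
    map_smul]
  rw [realLinear_apply_eq_sum _ (fderiv ℂ h z (Pi.single i 1)),
    realLinear_apply_eq_sum _ (Complex.I • fderiv ℂ h z (Pi.single i 1)),
    Finset.mul_sum, ← Finset.sum_add_distrib, Finset.sum_div]
  refine Finset.sum_congr rfl fun k _ => ?_
  simp only [holJacobian, Matrix.of_apply, Pi.smul_apply, smul_eq_mul, star_mul',
    RCLike.star_def, Complex.conj_I]
  ring_nf
  simp only [Complex.I_sq, Complex.I_pow_three]
  ring

theorem wirtinger_congr {f k : (ι → ℂ) → ℂ} {z : ι → ℂ} (h : f =ᶠ[𝓝 z] k) (i : ι) :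
    wirtinger i f z = wirtinger i k z := by
  simp only [wirtinger, h.fderiv_eq]

theorem wirtinger_sum {α : Type*} {s : Finset α} {f : α → (ι → ℂ) → ℂ} {z : ι → ℂ}
    (h : ∀ a ∈ s, DifferentiableAt ℝ (f a) z) (i : ι) :
    wirtinger i (fun w => ∑ a ∈ s, f a w) z = ∑ a ∈ s, wirtinger i (f a) z := by
  simp only [wirtinger]
  rw [fderiv_fun_sum h]
  simp only [sum_apply, Finset.mul_sum, ← Finset.sum_sub_distrib,
    Finset.sum_div]

theorem wirtinger_mul {f k : (ι → ℂ) → ℂ} {z : ι → ℂ}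
    (hf : DifferentiableAt ℝ f z) (hk : DifferentiableAt ℝ k z) (i : ι) :
    wirtinger i (fun w => f w * k w) z = f z * wirtinger i k z + wirtinger i f z * k z := by
  simp only [wirtinger]
  rw [fderiv_fun_mul hf hk]
  simp only [add_apply, smul_apply, smul_eq_mul]
  ring

theorem wirtinger_star {f : (ι → ℂ) → ℂ} {z : ι → ℂ} (hf : DifferentiableAt ℂ f z) (i : ι) :
    wirtinger i (fun w => star (f w)) z = 0 := by
  have h1 : HasFDerivAt (fun w => star (f w))
      ((Complex.conjCLE : ℂ →L[ℝ] ℂ).comp (fderiv ℝ f z)) z :=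
    (Complex.conjCLE : ℂ →L[ℝ] ℂ).hasFDerivAt.comp z (hf.restrictScalars ℝ).hasFDerivAt
  simp only [wirtinger, h1.fderiv, ContinuousLinearMap.comp_apply]
  rw [hf.fderiv_restrictScalars ℝ]
  simp only [ContinuousLinearMap.coe_restrictScalars', single_I i, map_smul, smul_eq_mul]
  simp only [ContinuousLinearEquiv.coe_coe, Complex.conjCLE_apply, map_mul, Complex.conj_I]
  ring_nf
  simp [Complex.I_sq]

theorem AnalyticAt.holJacobian {h : (ι → ℂ) → (κ → ℂ)} {z : ι → ℂ} (hh : AnalyticAt ℂ h z)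
    (i : ι) (k : κ) : AnalyticAt ℂ (fun w => holJacobian h w i k) z := by
  have h1 : AnalyticAt ℂ (fun w => fderiv ℂ h w (Pi.single i 1)) z :=
    ((ContinuousLinearMap.apply ℂ (κ → ℂ) (Pi.single i 1 : ι → ℂ)).analyticAt _).comp hh.fderiv
  exact ((ContinuousLinearMap.proj (R := ℂ) (φ := fun _ : κ => ℂ) k).analyticAt _).comp h1

theorem holJacobian_comp {h : (ι → ℂ) → (κ → ℂ)} {k : (κ → ℂ) → (μ → ℂ)} {z : ι → ℂ}
    (hh : DifferentiableAt ℂ h z) (hk : DifferentiableAt ℂ k (h z)) :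
    holJacobian (fun w => k (h w)) z = holJacobian h z * holJacobian k (h z) := by
  ext i m
  have hc : fderiv ℂ (fun w => k (h w)) z = (fderiv ℂ k (h z)).comp (fderiv ℂ h z) :=
    fderiv_comp z hk hh
  simp only [holJacobian, Matrix.of_apply, hc, ContinuousLinearMap.comp_apply, Matrix.mul_apply]
  have h1 : fderiv ℂ h z (Pi.single i 1) =
      ∑ j, fderiv ℂ h z (Pi.single i 1) j • (Pi.single j 1 : κ → ℂ) := by
    ext j
    simp [Finset.sum_apply, Pi.single_apply]
  conv_lhs => rw [h1]
  simp only [map_sum, map_smul, Finset.sum_apply, Pi.smul_apply, smul_eq_mul]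

theorem ContDiffAt.differentiableAt_wirtingerBar {G : (κ → ℂ) → ℂ} {z : κ → ℂ}
    (hG : ContDiffAt ℝ 2 G z) (k : κ) : DifferentiableAt ℝ (wirtingerBar k G) z := by
  have h1 : DifferentiableAt ℝ (fderiv ℝ G) z :=
    (hG.fderiv_right (m := 1) (by norm_num)).differentiableAt (by norm_num)
  have h2 : ∀ v : κ → ℂ, DifferentiableAt ℝ (fun w => fderiv ℝ G w v) z := fun v =>
    h1.clm_apply (differentiableAt_const v)
  unfold wirtingerBar
  simp only [div_eq_mul_inv]
  exact DifferentiableAt.mul_const (DifferentiableAt.fun_add (h2 _) ((h2 _).const_mul _)) _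

/-- Chain rule for the complex Hessian under a holomorphic map. -/
theorem complexHessian_comp {φ : (κ → ℂ) → ℝ} {h : (ι → ℂ) → (κ → ℂ)} {z : ι → ℂ}
    (hφ : ContDiffAt ℝ 2 φ (h z)) (hh : AnalyticAt ℂ h z) :
    complexHessian (fun w => φ (h w)) z =
      holJacobian h z * complexHessian φ (h z) * (holJacobian h z).conjTranspose := by
  set G : (κ → ℂ) → ℂ := fun w => (φ w : ℂ)
  have hG : ContDiffAt ℝ 2 G (h z) := Complex.ofRealCLM.contDiff.contDiffAt.comp _ hφ
  have hJd : ∀ i k, DifferentiableAt ℂ (fun w => holJacobian h w i k) z := fun i k =>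
    (hh.holJacobian i k).differentiableAt
  have hev : ∀ j, wirtingerBar j (fun w => G (h w)) =ᶠ[𝓝 z]
      fun w => ∑ k, star (holJacobian h w j k) * wirtingerBar k G (h w) := by
    intro j
    have e1 : ∀ᶠ w in 𝓝 z, DifferentiableAt ℂ h w :=
      hh.eventually_analyticAt.mono fun w hw => hw.differentiableAt
    have e2 : ∀ᶠ w in 𝓝 z, DifferentiableAt ℝ G (h w) :=
      hh.continuousAt.eventually ((hG.eventually (by simp)).mono fun w hw =>
        hw.differentiableAt (by norm_num))
    filter_upwards [e1, e2] with w h1 h2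
    exact wirtingerBar_comp h2 h1 j
  ext i j
  have hstar : ∀ k, DifferentiableAt ℝ (fun w => star (holJacobian h w j k)) z := fun k =>
    (Complex.conjCLE : ℂ →L[ℝ] ℂ).differentiableAt.comp z ((hJd j k).restrictScalars ℝ)
  have hW : ∀ k, DifferentiableAt ℝ (wirtingerBar k G) (h z) := fun k =>
    hG.differentiableAt_wirtingerBar k
  have hWc : ∀ k, DifferentiableAt ℝ (fun w => wirtingerBar k G (h w)) z := fun k =>
    (hW k).comp z (hh.differentiableAt.restrictScalars ℝ)
  change wirtinger i (wirtingerBar j fun w => G (h w)) z = _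
  rw [wirtinger_congr (hev j),
    wirtinger_sum (fun k _ => DifferentiableAt.fun_mul (hstar k) (hWc k))]
  simp only [Matrix.mul_apply, Matrix.conjTranspose_apply, Finset.sum_mul]
  refine Finset.sum_congr rfl fun k _ => ?_
  -- The conjugated Jacobian is antiholomorphic, so the product rule contributes no derivative of
  -- the Jacobian: this is why the complex Hessian transforms as a tensor.
  rw [wirtinger_mul (hstar k) (hWc k), wirtinger_star (hJd j k),
    wirtinger_comp (hW k) hh.differentiableAt, zero_mul, add_zero, Finset.mul_sum]
  refine Finset.sum_congr rfl fun l _ => ?_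
  simp only [complexHessian, Matrix.of_apply]
  ring

/-! ### The complex Hessian through real second derivatives. -/

theorem fderiv_ofReal_comp {φ : (ι → ℂ) → ℝ} {z : ι → ℂ} (h : DifferentiableAt ℝ φ z)
    (v : ι → ℂ) : fderiv ℝ (fun w => (φ w : ℂ)) z v = (fderiv ℝ φ z v : ℂ) := by
  have : HasFDerivAt (fun w => (φ w : ℂ)) (Complex.ofRealCLM.comp (fderiv ℝ φ z)) z :=
    Complex.ofRealCLM.hasFDerivAt.comp z h.hasFDerivAt
  rw [this.fderiv]; rfl

theorem ContDiffAt.differentiableAt_fderiv {φ : (ι → ℂ) → ℝ} {z : ι → ℂ}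
    (hφ : ContDiffAt ℝ 2 φ z) : DifferentiableAt ℝ (fderiv ℝ φ) z :=
  (hφ.fderiv_right (m := 1) (by norm_num)).differentiableAt (by norm_num)

theorem complexHessian_apply {φ : (ι → ℂ) → ℝ} {z : ι → ℂ} (hφ : ContDiffAt ℝ 2 φ z) (i j : ι) :
    complexHessian φ z i j =
      (((fderiv ℝ (fderiv ℝ φ) z (Pi.single i 1) (Pi.single j 1) +
        fderiv ℝ (fderiv ℝ φ) z (Pi.single i Complex.I) (Pi.single j Complex.I) : ℝ) : ℂ) +
      ((fderiv ℝ (fderiv ℝ φ) z (Pi.single i 1) (Pi.single j Complex.I) -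
        fderiv ℝ (fderiv ℝ φ) z (Pi.single i Complex.I) (Pi.single j 1) : ℝ) : ℂ) * Complex.I) / 4
      := by
  have hd : DifferentiableAt ℝ (fderiv ℝ φ) z := hφ.differentiableAt_fderiv
  have hev : wirtingerBar j (fun w => (φ w : ℂ)) =ᶠ[𝓝 z] fun w =>
      ((fderiv ℝ φ w (Pi.single j 1) : ℂ) +
        Complex.I * (fderiv ℝ φ w (Pi.single j Complex.I) : ℂ)) / 2 := by
    filter_upwards [hφ.eventually (by simp)] with w hw
    simp only [wirtingerBar, fderiv_ofReal_comp (hw.differentiableAt (by norm_num))]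
  have hder : ∀ v : ι → ℂ, HasFDerivAt (fun w => (fderiv ℝ φ w v : ℂ))
      (Complex.ofRealCLM.comp ((ContinuousLinearMap.apply ℝ ℝ v).comp
        (fderiv ℝ (fderiv ℝ φ) z))) z := fun v =>
    Complex.ofRealCLM.hasFDerivAt.comp z
      ((ContinuousLinearMap.apply ℝ ℝ v).hasFDerivAt.comp z hd.hasFDerivAt)
  have h2 := ((hder (Pi.single j 1)).add
    ((hder (Pi.single j Complex.I)).const_mul Complex.I)).mul_const (1 / 2 : ℂ)
  have h3 : HasFDerivAt (fun w => ((fderiv ℝ φ w (Pi.single j 1) : ℂ) +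
        Complex.I * (fderiv ℝ φ w (Pi.single j Complex.I) : ℂ)) / 2) _ z :=
    h2.congr_of_eventuallyEq (Eventually.of_forall fun w => by simp [div_eq_mul_inv])
  change wirtinger i (wirtingerBar j fun w => (φ w : ℂ)) z = _
  rw [wirtinger_congr hev]
  simp only [wirtinger, h3.fderiv]
  simp only [smul_apply, add_apply,
    ContinuousLinearMap.comp_apply, ContinuousLinearMap.apply_apply, Complex.ofRealCLM_apply,
    smul_eq_mul]
  push_cast
  ring_nf
  simp only [Complex.I_sq]
  ring

/-- The Levi form is the mean of the second derivatives in the directions `ξ` and `iξ`. -/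
theorem re_sum_complexHessian {φ : (ι → ℂ) → ℝ} {z : ι → ℂ} (hφ : ContDiffAt ℝ 2 φ z)
    (ξ : ι → ℂ) :
    (∑ i, ∑ j, ξ i * complexHessian φ z i j * star (ξ j)).re =
      (fderiv ℝ (fderiv ℝ φ) z ξ ξ +
        fderiv ℝ (fderiv ℝ φ) z (Complex.I • ξ) (Complex.I • ξ)) / 4 := by
  set B := fderiv ℝ (fderiv ℝ φ) z
  have e2 : Complex.I • ξ = ∑ k, ((ξ k).re • (Pi.single k Complex.I : ι → ℂ) +
      (-(ξ k).im) • (Pi.single k 1 : ι → ℂ)) := by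
    conv_lhs => rw [pi_eq_sum_re_add_im (Complex.I • ξ)]
    simp [add_comm]
  have e3 : B ξ ξ = ∑ i, ∑ j,
      ((ξ i).re * (ξ j).re * B (Pi.single i 1) (Pi.single j 1) +
       (ξ i).re * (ξ j).im * B (Pi.single i 1) (Pi.single j Complex.I) +
       (ξ i).im * (ξ j).re * B (Pi.single i Complex.I) (Pi.single j 1) +
       (ξ i).im * (ξ j).im * B (Pi.single i Complex.I) (Pi.single j Complex.I)) := by
    conv_lhs => rw [pi_eq_sum_re_add_im ξ]
    simp only [map_sum, sum_apply, map_add, map_smul,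
      add_apply, smul_apply, smul_eq_mul]
    simp only [Finset.mul_sum, ← Finset.sum_add_distrib]
    rw [Finset.sum_comm]
    refine Finset.sum_congr rfl fun i _ => Finset.sum_congr rfl fun j _ => ?_
    ring
  have e4 : B (Complex.I • ξ) (Complex.I • ξ) = ∑ i, ∑ j,
      ((ξ i).re * (ξ j).re * B (Pi.single i Complex.I) (Pi.single j Complex.I) -
       (ξ i).re * (ξ j).im * B (Pi.single i Complex.I) (Pi.single j 1) -
       (ξ i).im * (ξ j).re * B (Pi.single i 1) (Pi.single j Complex.I) +
       (ξ i).im * (ξ j).im * B (Pi.single i 1) (Pi.single j 1)) := by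
    rw [e2]
    simp only [map_sum, sum_apply, map_add, map_smul,
      add_apply, smul_apply, smul_eq_mul]
    simp only [Finset.mul_sum, ← Finset.sum_add_distrib]
    rw [Finset.sum_comm]
    refine Finset.sum_congr rfl fun i _ => Finset.sum_congr rfl fun j _ => ?_
    ring
  rw [e3, e4, Complex.re_sum, ← Finset.sum_add_distrib, Finset.sum_div]
  refine Finset.sum_congr rfl fun i _ => ?_
  rw [Complex.re_sum, ← Finset.sum_add_distrib, Finset.sum_div]
  refine Finset.sum_congr rfl fun j _ => ?_
  rw [complexHessian_apply hφ]
  set P := B (Pi.single i 1) (Pi.single j 1) + B (Pi.single i Complex.I) (Pi.single j Complex.I)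
    with hP
  set Q := B (Pi.single i 1) (Pi.single j Complex.I) - B (Pi.single i Complex.I) (Pi.single j 1)
    with hQ
  have e5 : ξ i * (((P : ℂ) + (Q : ℂ) * Complex.I) / 4) * star (ξ j) =
      ξ i * ((P : ℂ) + (Q : ℂ) * Complex.I) * star (ξ j) / ((4 : ℝ) : ℂ) := by
    push_cast; ring
  rw [e5, Complex.div_ofReal_re]
  simp only [Complex.mul_re, Complex.add_re, Complex.add_im, Complex.mul_im, Complex.ofReal_re,
    Complex.ofReal_im, Complex.I_re, Complex.I_im, RCLike.star_def, Complex.conj_re,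
    Complex.conj_im, hP, hQ]
  ring

end Wirtinger

/-! ## Liouville's theorem and convexity from the complex Hessian -/

section Pluriharmonic

theorem fderiv_fderiv_comp_affine {E V : Type*} [NormedAddCommGroup E] [NormedSpace ℝ E]
    [NormedAddCommGroup V] [NormedSpace ℝ V] {K : V → ℝ} (hK : ContDiff ℝ 2 K) (L : E →L[ℝ] V)
    (p : V) (x a b : E) :
    fderiv ℝ (fderiv ℝ fun y => K (p + L y)) x a b =
      fderiv ℝ (fderiv ℝ K) (p + L x) (L a) (L b) := by
  have hA : ∀ y, HasFDerivAt (fun y => p + L y) L y := fun y => L.hasFDerivAt.const_add p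
  have h1 : (fderiv ℝ fun y => K (p + L y)) = fun y => (fderiv ℝ K (p + L y)).comp L := by
    funext y
    exact (((hK.differentiable (by norm_num)) (p + L y)).hasFDerivAt.comp y (hA y)).fderiv
  have h2 : DifferentiableAt ℝ (fderiv ℝ K) (p + L x) :=
    ((hK.fderiv_right (m := 1) (by norm_num)).differentiable (by norm_num)) _
  have h3 : HasFDerivAt (fun y => fderiv ℝ K (p + L y))
      ((fderiv ℝ (fderiv ℝ K) (p + L x)).comp L) x := h2.hasFDerivAt.comp x (hA x)
  have h4 := h3.clm_comp (hasFDerivAt_const L x)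
  rw [h1, h4.fderiv]
  simp

variable {ι : Type*} [Fintype ι] [DecidableEq ι]

/-- A bounded pluriharmonic function on `ℂ^ι` is constant. -/
theorem eq_of_complexHessian_eq_zero {K : (ι → ℂ) → ℝ} (hK : ContDiff ℝ 2 K)
    (h0 : ∀ z, complexHessian K z = 0) {B : ℝ} (hB : ∀ z, |K z| ≤ B) (z w : ι → ℂ) :
    K z = K w := by
  -- Restriction to the complex line through `z` and `w`: its Laplacian is four times the Levi form
  -- in the direction `w - z`, so the one-variable Liouville theorem applies.
  let L : ℂ →L[ℝ] (ι → ℂ) := ((ContinuousLinearMap.id ℂ ℂ).smulRight (w - z)).restrictScalars ℝ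
  have hL : ∀ t, L t = t • (w - z) := fun t => rfl
  have hk : ContDiff ℝ 2 fun t => K (z + L t) := hK.comp (contDiff_const.add L.contDiff)
  have hlap : InnerProductSpace.HarmonicOnNhd (fun t => K (z + L t)) Set.univ := by
    intro t _
    refine ⟨hk.contDiffAt, Eventually.of_forall fun t => ?_⟩
    rw [InnerProductSpace.laplacian_eq_iteratedFDeriv_complexPlane]
    simp only [iteratedFDeriv_two_apply, Matrix.cons_val_zero, Matrix.cons_val_one,
      Pi.zero_apply]
    rw [fderiv_fderiv_comp_affine hK, fderiv_fderiv_comp_affine hK]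
    have h1 := re_sum_complexHessian (hK.contDiffAt (x := z + L t)) (w - z)
    simp only [h0, Matrix.zero_apply, mul_zero, zero_mul, Finset.sum_const_zero,
      Complex.zero_re] at h1
    rw [hL 1, hL Complex.I, one_smul]
    linarith
  have hb : Bornology.IsBounded (Set.range fun t => K (z + L t)) := by
    rw [isBounded_iff_forall_norm_le]
    exact ⟨B, by rintro _ ⟨t, rfl⟩; exact hB _⟩
  have := InnerProductSpace.bounded_harmonic_on_complex_plane_is_constant _ hlap hb 0 1
  simpa [hL] using this

/-- A function with positive semidefinite complex Hessian which only depends on the real parts of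
the coordinates is convex. -/
theorem convexOn_of_complexHessian_posSemidef {φ : (ι → ℂ) → ℝ} (hφ : ContDiff ℝ 2 φ)
    (hpos : ∀ z, (complexHessian φ z).PosSemidef)
    (him : ∀ (z : ι → ℂ) (θ : ι → ℝ), φ (z + fun i => (θ i : ℂ) * Complex.I) = φ z) :
    ConvexOn ℝ Set.univ fun x : ι → ℝ => φ fun i => (x i : ℂ) := by
  have hlin : ∀ (z v : ι → ℂ), ∃ L : ℝ →L[ℝ] (ι → ℂ), ∀ t, L t = t • v := fun z v =>
    ⟨(ContinuousLinearMap.id ℝ ℝ).smulRight v, fun t => rfl⟩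
  -- `φ` is constant in imaginary directions, so only the real second derivative contributes to the
  -- Levi form of a real vector.
  have hzero : ∀ (z : ι → ℂ) (ξ : ι → ℝ),
      fderiv ℝ (fderiv ℝ φ) z (Complex.I • fun i => (ξ i : ℂ))
        (Complex.I • fun i => (ξ i : ℂ)) = 0 := by
    intro z ξ
    obtain ⟨L, hL⟩ := hlin z (Complex.I • fun i => (ξ i : ℂ))
    have h1 := fderiv_fderiv_comp_affine hφ L z 0 1 1
    have h2 : (fun t => φ (z + L t)) = fun _ => φ z := by
      funext t
      rw [← him z (fun i => t * ξ i), hL]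
      congr 2
      funext i
      simp only [Pi.smul_apply, Complex.real_smul, smul_eq_mul]
      push_cast
      ring
    rw [h2] at h1
    simp only [hL, one_smul, zero_smul, add_zero] at h1
    rw [← h1]
    simp
  have hnn : ∀ (z : ι → ℂ) (ξ : ι → ℝ),
      0 ≤ fderiv ℝ (fderiv ℝ φ) z (fun i => (ξ i : ℂ)) (fun i => (ξ i : ℂ)) := by
    intro z ξ
    have h1 := re_sum_complexHessian (hφ.contDiffAt (x := z)) (fun i => (ξ i : ℂ))
    rw [hzero, add_zero] at h1
    have h2 := (hpos z).dotProduct_mulVec_nonneg (fun i => (ξ i : ℂ))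
    have h3 : star (fun i => (ξ i : ℂ)) ⬝ᵥ (complexHessian φ z).mulVec (fun i => (ξ i : ℂ)) =
        ∑ i, ∑ j, (ξ i : ℂ) * complexHessian φ z i j * star (ξ j : ℂ) := by
      simp only [dotProduct, Matrix.mulVec, Finset.mul_sum]
      refine Finset.sum_congr rfl fun i _ => Finset.sum_congr rfl fun j _ => ?_
      simp [mul_assoc]
    rw [h3] at h2
    have h4 := (Complex.le_def.1 h2).1
    rw [h1] at h4
    simp only [Complex.zero_re] at h4
    linarith
  refine ⟨convex_univ, fun x _ y _ a b ha hb hab => ?_⟩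
  obtain ⟨L, hL⟩ := hlin 0 (fun i => ((y i - x i : ℝ) : ℂ))
  set p : ι → ℂ := fun i => (x i : ℂ) with hp
  set f : ℝ → ℝ := fun t => φ (p + L t) with hf
  have hfc : ContDiff ℝ 2 f := hφ.comp (contDiff_const.add L.contDiff)
  have hd1 : deriv f = fun t => fderiv ℝ f t 1 := by funext t; exact (fderiv_apply_one_eq_deriv).symm
  have hfd : Differentiable ℝ (fderiv ℝ f) :=
    (hfc.fderiv_right (m := 1) (by norm_num)).differentiable (by norm_num)
  have hd2 : Differentiable ℝ (deriv f) := by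
    rw [hd1]; exact fun t => (hfd t).clm_apply (differentiableAt_const _)
  have hconv : ConvexOn ℝ Set.univ f := by
    refine convexOn_univ_of_deriv2_nonneg (hfc.differentiable (by norm_num)) hd2 fun t => ?_
    have h1 : deriv^[2] f t = fderiv ℝ (fderiv ℝ f) t 1 1 := by
      change deriv (deriv f) t = _
      rw [hd1, ← fderiv_apply_one_eq_deriv]
      rw [((hfd t).hasFDerivAt.clm_apply (hasFDerivAt_const (1 : ℝ) t)).fderiv]
      simp
    rw [h1, hf, fderiv_fderiv_comp_affine hφ, hL 1, one_smul]
    exact hnn _ _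
  have h1 := hconv.2 (Set.mem_univ (0 : ℝ)) (Set.mem_univ (1 : ℝ)) ha hb hab
  have e0 : f 0 = φ fun i => (x i : ℂ) := by simp [hf, hL, hp]
  have e1 : f 1 = φ fun i => (y i : ℂ) := by
    simp only [hf, hL, hp, one_smul]
    congr 1; funext i; simp
  have eb : f (a • (0 : ℝ) + b • (1 : ℝ)) = φ fun i => (((a • x + b • y) i : ℝ) : ℂ) := by
    simp only [hf, hL, hp]
    congr 1; funext i
    have : a = 1 - b := by linarith
    simp only [Pi.add_apply, Pi.smul_apply, smul_eq_mul, Complex.real_smul, this]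
    push_cast
    ring
  rw [e0, e1, eb] at h1
  exact h1

end Pluriharmonic

/-! ## Logarithmic coordinates on the open orbit -/

noncomputable section

namespace RegularFan

variable {n : ℕ} (F : RegularFan n)

/-- The generators of a maximal cone, as a basis of `N`. -/
def coneBasis (s : F.maxCones) : Module.Basis s.1 ℤ (Fin n → ℤ) :=
  Module.Basis.mk (F.linearIndependent s.1 s.2) (by
    have := F.span_eq_top s.1 s.2
    rw [show Set.range (fun e : s.1 => (e : Fin n → ℤ)) = (s.1 : Set (Fin n → ℤ)) by
      ext; simp]
    exact this.ge)

@[simp] theorem coneBasis_apply (s : F.maxCones) (e : s.1) : F.coneBasis s e = e := by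
  simp [coneBasis]

/-- The coordinates of the standard basis vectors of `N` in the basis of a maximal cone. -/
def coneCoord (s : F.maxCones) (e : s.1) (i : Fin n) : ℤ :=
  (F.coneBasis s).repr (Pi.single i 1) e

/-- This identity and the next say that `coneCoord` and the matrix of generators are two-sided
inverses over `ℤ`, which is regularity of the cone. Casting them into a ring gives the inversion
formulas for `logCoord`. -/
theorem sum_coneCoord_mul_int (s : F.maxCones) (i j : Fin n) :
    ∑ e : s.1, F.coneCoord s e i * (e : Fin n → ℤ) j = if i = j then 1 else 0 := by
  have h := congrFun ((F.coneBasis s).sum_repr (Pi.single i 1)) j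
  simp only [coneBasis_apply, Finset.sum_apply, Pi.smul_apply, smul_eq_mul, Pi.single_apply] at h
  simp only [coneCoord, h, eq_comm]

theorem sum_mul_coneCoord_int (s : F.maxCones) (e e' : s.1) :
    ∑ i, F.coneCoord s e i * (e' : Fin n → ℤ) i = if e = e' then 1 else 0 := by
  have h1 : (e' : Fin n → ℤ) = ∑ i, (e' : Fin n → ℤ) i • (Pi.single i 1 : Fin n → ℤ) := by
    ext j; simp [Finset.sum_apply, Pi.single_apply]
  have h2 : (F.coneBasis s).repr (e' : Fin n → ℤ) e = if e = e' then 1 else 0 := by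
    rw [← F.coneBasis_apply s e', Module.Basis.repr_self, Finsupp.single_apply]
    simp only [eq_comm]
  rw [← h2]
  conv_rhs => rw [h1]
  simp only [map_sum, map_smul, Finsupp.coe_finsetSum, Finset.sum_apply, Finsupp.smul_apply,
    smul_eq_mul, coneCoord, mul_comm]

variable {K : Type*} [CommRing K]

/-- The coordinates of a vector of `N ⊗ K` in the basis of a maximal cone. -/
def logCoord (s : F.maxCones) (y : Fin n → K) : s.1 → K :=
  fun e => ∑ i, (F.coneCoord s e i : K) * y i

theorem sum_logCoord_mul (s : F.maxCones) (y : Fin n → K) (j : Fin n) :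
    ∑ e : s.1, F.logCoord s y e * ((e : Fin n → ℤ) j : K) = y j := by
  simp only [logCoord, Finset.sum_mul]
  rw [Finset.sum_comm]
  have : ∀ i, ∑ e : s.1, (F.coneCoord s e i : K) * y i * ((e : Fin n → ℤ) j : K) =
      if i = j then y i else 0 := by
    intro i
    have h := congrArg (Int.cast : ℤ → K) (F.sum_coneCoord_mul_int s i j)
    push_cast at h
    calc _ = (∑ e : s.1, (F.coneCoord s e i : K) * ((e : Fin n → ℤ) j : K)) * y i := by
          rw [Finset.sum_mul]; exact Finset.sum_congr rfl fun e _ => by ring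
      _ = _ := by rw [h]; split_ifs <;> simp
  simp only [this]
  simp

theorem logCoord_sum_mul (s : F.maxCones) (c : s.1 → K) :
    F.logCoord s (fun i => ∑ e : s.1, c e * ((e : Fin n → ℤ) i : K)) = c := by
  funext e
  simp only [logCoord, Finset.mul_sum]
  rw [Finset.sum_comm]
  have : ∀ e' : s.1, ∑ i, (F.coneCoord s e i : K) * (c e' * ((e' : Fin n → ℤ) i : K)) =
      if e = e' then c e' else 0 := by
    intro e'
    have h := congrArg (Int.cast : ℤ → K) (F.sum_mul_coneCoord_int s e e')
    push_cast at h
    calc _ = (∑ i, (F.coneCoord s e i : K) * ((e' : Fin n → ℤ) i : K)) * c e' := by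
          rw [Finset.sum_mul]; exact Finset.sum_congr rfl fun e _ => by ring
      _ = _ := by rw [h]; split_ifs <;> simp
  simp only [this]
  simp

theorem logCoord_add (s : F.maxCones) (y w : Fin n → K) :
    F.logCoord s (y + w) = F.logCoord s y + F.logCoord s w := by
  funext e; simp [logCoord, mul_add, Finset.sum_add_distrib]

theorem mem_rays {s : Finset (Fin n → ℤ)} (hs : s ∈ F.maxCones) {e : Fin n → ℤ} (he : e ∈ s) :
    e ∈ F.rays := Finset.mem_biUnion.2 ⟨s, hs, he⟩

theorem exists_maxCone_of_ray (ρ : F.rays) : ∃ s : F.maxCones, (ρ : Fin n → ℤ) ∈ s.1 := by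
  obtain ⟨s, hs, h⟩ := Finset.mem_biUnion.1 ρ.2
  exact ⟨⟨s, hs⟩, h⟩

/-- Extension by a constant of a family indexed by the generators of a maximal cone. -/
theorem sum_rays_dite {M : Type*} [AddCommMonoid M] (s : F.maxCones) (f : s.1 → M) :
    ∑ ρ : F.rays, (if h : (ρ : Fin n → ℤ) ∈ s.1 then f ⟨ρ, h⟩ else 0) = ∑ e : s.1, f e := by
  rw [← Finset.sum_filter_add_sum_filter_not Finset.univ (fun ρ : F.rays => (ρ : Fin n → ℤ) ∈ s.1)]
  rw [Finset.sum_eq_zero (s := Finset.univ.filter fun ρ : F.rays => ¬ (ρ : Fin n → ℤ) ∈ s.1)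
    (by intro ρ hρ; simp only [Finset.mem_filter] at hρ; simp [hρ.2]), add_zero]
  refine Finset.sum_bij' (fun ρ h => ⟨ρ, (Finset.mem_filter.1 h).2⟩)
    (fun e _ => ⟨e, F.mem_rays s.2 e.2⟩) ?_ ?_ ?_ ?_ ?_
  · intros; simp
  · intro e _; simp
  · intros; rfl
  · intros; rfl
  · intro ρ h; simp [(Finset.mem_filter.1 h).2]

theorem prod_rays_dite {M : Type*} [CommMonoid M] (s : F.maxCones) (f : s.1 → M) :
    ∏ ρ : F.rays, (if h : (ρ : Fin n → ℤ) ∈ s.1 then f ⟨ρ, h⟩ else 1) = ∏ e : s.1, f e :=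
  F.sum_rays_dite (M := Additive M) s f

theorem exists_maxCone : Nonempty F.maxCones := by
  obtain ⟨s, hs, -⟩ := F.complete 0
  exact ⟨⟨s, hs⟩⟩

theorem exists_logCoord_nonneg (y : Fin n → ℝ) : ∃ s : F.maxCones, ∀ e, 0 ≤ F.logCoord s y e := by
  obtain ⟨s, hs, c, hc, hy⟩ := F.complete y
  refine ⟨⟨s, hs⟩, fun e => ?_⟩
  have h1 : y = fun i => ∑ e : s, c e * ((e : Fin n → ℤ) i : ℝ) := by
    funext i; rw [hy i, ← Finset.sum_coe_sort s (fun e => c e * (e i : ℝ))]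
  rw [h1, F.logCoord_sum_mul ⟨s, hs⟩ (fun e : s => c e)]
  exact hc _

/-! ### Characters of the torus -/

/-- The coordinates `N ⊗ ℂˣ = (ℂˣ)ⁿ` of the image of a vector of homogeneous coordinates. -/
def monomial (z : F.rays → ℂ) (i : Fin n) : ℂ := ∏ ρ, z ρ ^ ((ρ : Fin n → ℤ) i)

theorem monomial_mul (z w : F.rays → ℂ) (i : Fin n) :
    F.monomial (fun ρ => z ρ * w ρ) i = F.monomial z i * F.monomial w i := by
  simp [monomial, mul_zpow, Finset.prod_mul_distrib]

theorem mem_coxGroup_iff (l : F.rays → ℂˣ) :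
    l ∈ F.coxGroup ↔ ∀ i, F.monomial (fun ρ => (l ρ : ℂ)) i = 1 := by
  refine forall_congr' fun i => ?_
  rw [← Units.val_inj]
  simp [monomial]

theorem point_eq_iff (z w : F.CoxDomain) :
    F.point z = F.point w ↔ ∃ l ∈ F.coxGroup, w = F.coxMul l z :=
  ⟨fun h => Quotient.exact h, fun h => Quotient.sound h⟩

theorem monomial_ne_zero {z : F.rays → ℂ} (hz : ∀ ρ, z ρ ≠ 0) (i : Fin n) :
    F.monomial z i ≠ 0 := Finset.prod_ne_zero_iff.2 fun ρ _ => zpow_ne_zero _ (hz ρ)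

/-- On the open orbit the quotient `w / z` is a vector of units, and `coxGroup` is the common kernel
of the monomials. -/
theorem point_eq_iff_monomial {z w : F.CoxDomain} (hz : ∀ ρ, z.1 ρ ≠ 0) (hw : ∀ ρ, w.1 ρ ≠ 0) :
    F.point z = F.point w ↔ ∀ i, F.monomial z.1 i = F.monomial w.1 i := by
  rw [F.point_eq_iff]
  constructor
  · rintro ⟨l, hl, rfl⟩ i
    rw [F.mem_coxGroup_iff] at hl
    have := F.monomial_mul (fun ρ => (l ρ : ℂ)) z.1 i
    rw [hl, one_mul] at this
    exact this.symm
  · intro h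
    refine ⟨fun ρ => Units.mk0 (w.1 ρ / z.1 ρ) (div_ne_zero (hw ρ) (hz ρ)), ?_, ?_⟩
    · rw [F.mem_coxGroup_iff]
      intro i
      have h1 := F.monomial_mul (fun ρ => w.1 ρ / z.1 ρ) z.1 i
      simp only [div_mul_cancel₀ _ (hz _)] at h1
      have h2 := h i
      rw [h1] at h2
      exact (mul_eq_right₀ (F.monomial_ne_zero hz i)).1 h2.symm
    · refine Subtype.ext (funext fun ρ => ?_)
      simp [coxMul, div_mul_cancel₀ _ (hz _)]

theorem mem_openOrbit_point {z : F.CoxDomain} :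
    F.point z ∈ F.openOrbit ↔ ∀ ρ, z.1 ρ ≠ 0 := by
  constructor
  · rintro ⟨w, hw, h⟩ ρ
    obtain ⟨l, -, rfl⟩ := (F.point_eq_iff _ _).1 h
    simp [coxMul, hw ρ]
  · exact fun h => ⟨z, h, rfl⟩

/-- The standard representative of a point in an affine chart. -/
def chartPoint (s : F.maxCones) (z : s.1 → ℂ) : F.CoxDomain :=
  ⟨fun ρ => if h : (ρ : Fin n → ℤ) ∈ s.1 then z ⟨ρ, h⟩ else 1, s.1, s.2, by
    intro ρ hρ
    by_contra h
    simp [h] at hρ⟩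

theorem chart_eq_point (s : F.maxCones) (z : s.1 → ℂ) :
    F.chart s z = F.point (F.chartPoint s z) := rfl

theorem chartPoint_apply (s : F.maxCones) (z : s.1 → ℂ) (ρ : F.rays) :
    (F.chartPoint s z).1 ρ = if h : (ρ : Fin n → ℤ) ∈ s.1 then z ⟨ρ, h⟩ else 1 := rfl

theorem chartPoint_ne_zero {s : F.maxCones} {z : s.1 → ℂ} (hz : ∀ e, z e ≠ 0) (ρ : F.rays) :
    (F.chartPoint s z).1 ρ ≠ 0 := by
  rw [chartPoint_apply]
  split_ifs with h
  · exact hz _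
  · exact one_ne_zero

theorem mem_openOrbit_chart {s : F.maxCones} {z : s.1 → ℂ} :
    F.chart s z ∈ F.openOrbit ↔ ∀ e, z e ≠ 0 := by
  rw [chart_eq_point, F.mem_openOrbit_point]
  constructor
  · intro h e
    have := h ⟨e, F.mem_rays s.2 e.2⟩
    simpa [chartPoint_apply] using this
  · intro h ρ
    rw [chartPoint_apply]
    by_cases hρ : (ρ : Fin n → ℤ) ∈ s.1
    · simpa [hρ] using h ⟨ρ, hρ⟩
    · simp [hρ]

theorem monomial_chart (s : F.maxCones) (z : s.1 → ℂ) (i : Fin n) :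
    F.monomial (F.chartPoint s z).1 i = ∏ e : s.1, z e ^ ((e : Fin n → ℤ) i) := by
  rw [← F.prod_rays_dite s, monomial]
  refine Finset.prod_congr rfl fun ρ _ => ?_
  rw [chartPoint_apply]
  split_ifs <;> simp

/-- The affine coordinates in the chart of `s` of the point with logarithmic coordinates `Y`. -/
def expCoord (s : F.maxCones) (Y : Fin n → ℂ) : s.1 → ℂ :=
  fun e => Complex.exp (F.logCoord s Y e)

theorem expCoord_ne_zero (s : F.maxCones) (Y : Fin n → ℂ) (e : s.1) : F.expCoord s Y e ≠ 0 :=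
  Complex.exp_ne_zero _

theorem prod_expCoord (s : F.maxCones) (Y : Fin n → ℂ) (i : Fin n) :
    ∏ e : s.1, F.expCoord s Y e ^ ((e : Fin n → ℤ) i) = Complex.exp (Y i) := by
  rw [← F.sum_logCoord_mul s Y i, Complex.exp_sum]
  refine Finset.prod_congr rfl fun e _ => ?_
  rw [expCoord, ← Complex.exp_int_mul, mul_comm]

/-- The exponential map `N ⊗ ℂ → N ⊗ ℂˣ ≅ U ⊆ X`. -/
def expPoint (Y : Fin n → ℂ) : F.Variety :=
  F.chart (Classical.choice F.exists_maxCone) (F.expCoord _ Y)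

theorem chart_eq_chart_iff {s t : F.maxCones} {z : s.1 → ℂ} {w : t.1 → ℂ} (hz : ∀ e, z e ≠ 0)
    (hw : ∀ e, w e ≠ 0) :
    F.chart s z = F.chart t w ↔ ∀ i : Fin n, ∏ e : s.1, z e ^ ((e : Fin n → ℤ) i) =
      ∏ e : t.1, w e ^ ((e : Fin n → ℤ) i) := by
  rw [chart_eq_point, chart_eq_point, F.point_eq_iff_monomial (F.chartPoint_ne_zero hz)
    (F.chartPoint_ne_zero hw)]
  simp only [monomial_chart]

theorem chart_expCoord (s : F.maxCones) (Y : Fin n → ℂ) :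
    F.chart s (F.expCoord s Y) = F.expPoint Y := by
  rw [expPoint, F.chart_eq_chart_iff (F.expCoord_ne_zero _ _) (F.expCoord_ne_zero _ _)]
  intro i
  simp only [prod_expCoord]

theorem expPoint_eq_iff {Y W : Fin n → ℂ} :
    F.expPoint Y = F.expPoint W ↔ ∀ i, Complex.exp (Y i) = Complex.exp (W i) := by
  rw [expPoint, expPoint, F.chart_eq_chart_iff (F.expCoord_ne_zero _ _) (F.expCoord_ne_zero _ _)]
  simp only [prod_expCoord]

theorem expPoint_mem_openOrbit (Y : Fin n → ℂ) : F.expPoint Y ∈ F.openOrbit :=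
  F.mem_openOrbit_chart.2 (F.expCoord_ne_zero _ _)

theorem exists_expCoord_eq (s : F.maxCones) {z : s.1 → ℂ} (hz : ∀ e, z e ≠ 0) :
    ∃ Y, F.expCoord s Y = z ∧ ∀ e, F.logCoord s Y e = Complex.log (z e) := by
  refine ⟨fun i => ∑ e : s.1, Complex.log (z e) * ((e : Fin n → ℤ) i : ℂ), ?_, ?_⟩
  · funext e
    rw [expCoord, F.logCoord_sum_mul s fun e => Complex.log (z e), Complex.exp_log (hz e)]
  · exact fun e => congrFun (F.logCoord_sum_mul s fun e => Complex.log (z e)) e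

/-- Every point of the open orbit has logarithmic coordinates. -/
theorem exists_expPoint_point {z : F.CoxDomain} (hz : ∀ ρ, z.1 ρ ≠ 0) :
    F.expPoint (fun i => ∑ ρ : F.rays, Complex.log (z.1 ρ) * ((ρ : Fin n → ℤ) i : ℂ)) =
      F.point z := by
  obtain ⟨s⟩ := F.exists_maxCone
  rw [← F.chart_expCoord s, chart_eq_point, F.point_eq_iff_monomial
    (F.chartPoint_ne_zero (F.expCoord_ne_zero s _)) hz]
  intro i
  rw [F.monomial_chart, prod_expCoord, Complex.exp_sum, monomial]
  refine Finset.prod_congr rfl fun ρ _ => ?_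
  rw [mul_comm, Complex.exp_int_mul, Complex.exp_log (hz ρ)]

theorem exists_expPoint_of_mem {x : F.Variety} (hx : x ∈ F.openOrbit) : ∃ Y, F.expPoint Y = x := by
  obtain ⟨z, hz, rfl⟩ := hx
  exact ⟨_, F.exists_expPoint_point hz⟩

/-- The map `(ℂˣ)^rays → N ⊗ ℂ`, `l ↦ ∑ log l_ρ ρ`. -/
def unitsLog (l : F.rays → ℂˣ) : Fin n → ℂ :=
  fun i => ∑ ρ : F.rays, Complex.log (l ρ : ℂ) * ((ρ : Fin n → ℤ) i : ℂ)

theorem re_unitsLog (l : F.rays → ℂˣ) (i : Fin n) : (F.unitsLog l i).re = F.logMap l i := by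
  simp only [unitsLog, logMap, Complex.re_sum]
  refine Finset.sum_congr rfl fun ρ _ => ?_
  rw [← Complex.ofReal_intCast, Complex.re_mul_ofReal, Complex.log_re]

theorem exp_unitsLog (l : F.rays → ℂˣ) (i : Fin n) :
    Complex.exp (F.unitsLog l i) = F.monomial (fun ρ => (l ρ : ℂ)) i := by
  rw [unitsLog, Complex.exp_sum, monomial]
  refine Finset.prod_congr rfl fun ρ _ => ?_
  rw [mul_comm, Complex.exp_int_mul, Complex.exp_log (l ρ).ne_zero]

theorem torusHom_apply_point (l : F.rays → ℂˣ) (z : F.CoxDomain) :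
    F.torusHom l (F.point z) = F.point (F.coxMul l z) := rfl

theorem torusHom_expPoint (l : F.rays → ℂˣ) (Y : Fin n → ℂ) :
    F.torusHom l (F.expPoint Y) = F.expPoint (Y + F.unitsLog l) := by
  have h := fun Y => F.chartPoint_ne_zero
    (F.expCoord_ne_zero (Classical.choice F.exists_maxCone) Y)
  rw [expPoint, expPoint, chart_eq_point, chart_eq_point, torusHom_apply_point,
    F.point_eq_iff_monomial (fun ρ => mul_ne_zero (l ρ).ne_zero (h Y ρ)) (h _)]
  intro i
  rw [F.monomial_chart, prod_expCoord, Pi.add_apply, Complex.exp_add, exp_unitsLog]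
  refine (F.monomial_mul (fun ρ => (l ρ : ℂ)) _ i).trans ?_
  rw [F.monomial_chart, prod_expCoord, mul_comm]

/-- A one-parameter lift `N ⊗ ℂ → (ℂˣ)^rays`. -/
theorem exists_units_unitsLog (Y : Fin n → ℂ) :
    ∃ l : F.rays → ℂˣ, ∀ i, Complex.exp (F.unitsLog l i) = Complex.exp (Y i) := by
  obtain ⟨s⟩ := F.exists_maxCone
  refine ⟨fun ρ => if h : (ρ : Fin n → ℤ) ∈ s.1 then
    Units.mk0 (F.expCoord s Y ⟨ρ, h⟩) (F.expCoord_ne_zero _ _ _) else 1, fun i => ?_⟩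
  rw [exp_unitsLog, ← F.prod_expCoord s Y i, ← F.monomial_chart]
  congr 1
  funext ρ
  rw [chartPoint_apply]
  split_ifs <;> simp

theorem expPoint_add_congr {Y W V : Fin n → ℂ} (h : ∀ i, Complex.exp (V i) = Complex.exp (W i)) :
    F.expPoint (Y + V) = F.expPoint (Y + W) := by
  rw [expPoint_eq_iff]; intro i; simp [Complex.exp_add, h]

/-! ### The charts -/

theorem exists_chart_eq (x : F.Variety) : ∃ (s : F.maxCones) (z : s.1 → ℂ), F.chart s z = x := by
  induction x using Quotient.inductionOn with
  | h z =>
    obtain ⟨s, hs, hz⟩ := z.2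
    let S : F.maxCones := ⟨s, hs⟩
    -- normalize the coordinates off `s`
    let a : F.rays → ℂ := fun ρ => if (ρ : Fin n → ℤ) ∈ s then 0 else -Complex.log (z.1 ρ)
    let y : Fin n → ℂ := fun i => ∑ ρ : F.rays, a ρ * ((ρ : Fin n → ℤ) i : ℂ)
    -- The exponents `a` kill the coordinates off `s` but have total weight `y`. Since the
    -- generators of `s` form a basis, `b` can cancel this weight using the rays of `s` alone, which
    -- puts `l` in `coxGroup`.
    let b : F.rays → ℂ := fun ρ => if h : (ρ : Fin n → ℤ) ∈ s then -F.logCoord S y ⟨ρ, h⟩ else 0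
    let l : F.rays → ℂˣ := fun ρ => Units.mk0 (Complex.exp (a ρ + b ρ)) (Complex.exp_ne_zero _)
    have hl : l ∈ F.coxGroup := by
      rw [mem_coxGroup_iff]
      intro i
      have h1 : F.monomial (fun ρ => (l ρ : ℂ)) i =
          Complex.exp (∑ ρ : F.rays, (a ρ + b ρ) * ((ρ : Fin n → ℤ) i : ℂ)) := by
        rw [Complex.exp_sum, monomial]
        refine Finset.prod_congr rfl fun ρ _ => ?_
        rw [mul_comm, Complex.exp_int_mul]; rfl
      have h2 : ∑ ρ : F.rays, b ρ * ((ρ : Fin n → ℤ) i : ℂ) = -y i := by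
        rw [← F.sum_logCoord_mul S y i, ← F.sum_rays_dite S, ← Finset.sum_neg_distrib]
        refine Finset.sum_congr rfl fun ρ _ => ?_
        by_cases h : (ρ : Fin n → ℤ) ∈ s <;> simp [b, S, h]
      rw [h1]
      simp only [add_mul, Finset.sum_add_distrib, h2]
      simp [y]
    refine ⟨S, fun e => Complex.exp (b ⟨e, F.mem_rays hs e.2⟩) * z.1 ⟨e, F.mem_rays hs e.2⟩, ?_⟩
    refine ((F.point_eq_iff _ _).2 ⟨l, hl, Subtype.ext (funext fun ρ => ?_)⟩).symm
    by_cases h : (ρ : Fin n → ℤ) ∈ s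
    · simp [S, coxMul, l, a, h]
    · have h0 : z.1 ρ ≠ 0 := fun h0 => h (hz ρ h0)
      simp [S, coxMul, l, a, b, h, Complex.exp_neg, Complex.exp_log h0, inv_mul_cancel₀ h0]

/-- The open orbit is dense in every chart, as the complement of the coordinate hyperplanes. -/
theorem le_of_forall_expPoint_le {φ : F.Variety → ℝ}
    (hφ : ∀ s, Continuous fun z => φ (F.chart s z)) {m : ℝ} (h : ∀ Y, φ (F.expPoint Y) ≤ m)
    (x : F.Variety) : φ x ≤ m := by
  obtain ⟨s, z, rfl⟩ := F.exists_chart_eq x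
  have hd : Dense {w : s.1 → ℂ | ∀ e, w e ≠ 0} := by
    have := dense_pi (Set.univ : Set s.1) (s := fun _ => ({0}ᶜ : Set ℂ))
      fun _ _ => dense_compl_singleton 0
    convert this using 1
    ext w; simp [Set.mem_pi]
  have hc : IsClosed {w : s.1 → ℂ | φ (F.chart s w) ≤ m} := isClosed_le (hφ s) continuous_const
  refine hc.closure_subset_iff.2 ?_ (hd z)
  intro w hw
  obtain ⟨Y, hY, -⟩ := F.exists_expCoord_eq s hw
  change φ (F.chart s w) ≤ m
  rw [← hY, chart_expCoord]
  exact h Y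

end RegularFan

end

/-! ## The normalizer of the torus -/

/-- The functional equation transports differentiability from `0` to every point and gives `q' =
q'(0) q`, so `q · exp(-q'(0) t)` is constant. -/
theorem eq_exp_of_map_add {q : ℂ → ℂ} (hadd : ∀ a b, q (a + b) = q a * q b) (h0 : q 0 = 1)
    (hq : DifferentiableAt ℂ q 0) (t : ℂ) : q t = Complex.exp (deriv q 0 * t) := by
  have hd : ∀ t, HasDerivAt q (q t * deriv q 0) t := by
    intro t
    have h1 : HasDerivAt (fun x => q t * q (x - t)) (q t * deriv q 0) t := by
      have h2 : HasDerivAt q (deriv q 0) (t - t) := by rw [sub_self]; exact hq.hasDerivAt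
      exact (h2.comp_sub_const t t).const_mul (q t)
    refine h1.congr_of_eventuallyEq (Eventually.of_forall fun x => ?_)
    simp only [← hadd, add_sub_cancel]
  have hc : ∀ t, HasDerivAt (fun t => q t * Complex.exp (-(deriv q 0 * t))) 0 t := by
    intro t
    have h2 : HasDerivAt (fun t => Complex.exp (-(deriv q 0 * t)))
        (Complex.exp (-(deriv q 0 * t)) * -(deriv q 0)) t := by
      simpa using (((hasDerivAt_id t).const_mul (deriv q 0)).neg).cexp
    have h3 := (hd t).mul h2
    refine h3.congr_deriv ?_
    ring
  have h1 := is_const_of_deriv_eq_zero (fun t => (hc t).differentiableAt)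
    (fun t => (hc t).deriv) t 0
  simp only [h0, mul_zero, neg_zero, Complex.exp_zero, mul_one] at h1
  rw [Complex.exp_neg] at h1
  field_simp at h1
  exact h1

namespace RegularFan

variable {n : ℕ} (F : RegularFan n)

theorem torusHom_eq_one_of_mem {l : F.rays → ℂˣ} (hl : l ∈ F.coxGroup) : F.torusHom l = 1 := by
  refine Equiv.ext fun x => ?_
  induction x using Quotient.inductionOn with
  | h z => exact ((F.point_eq_iff _ _).2 ⟨l, hl, rfl⟩).symm

theorem torusHom_eq_one_of_exp {l : F.rays → ℂˣ}
    (h : ∀ i, Complex.exp (F.unitsLog l i) = 1) : F.torusHom l = 1 := by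
  refine F.torusHom_eq_one_of_mem ((F.mem_coxGroup_iff l).2 fun i => ?_)
  rw [← exp_unitsLog, h i]

/-- The open orbit consists of the points with trivial stabilizer in the torus. -/
theorem mem_openOrbit_iff {x : F.Variety} :
    x ∈ F.openOrbit ↔ ∀ t ∈ F.torus, t x = x → t = 1 := by
  constructor
  · rintro hx _ ⟨l, rfl⟩ h
    obtain ⟨Y, rfl⟩ := F.exists_expPoint_of_mem hx
    rw [torusHom_expPoint, expPoint_eq_iff] at h
    refine F.torusHom_eq_one_of_exp fun i => ?_
    have := h i
    rw [Pi.add_apply, Complex.exp_add] at this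
    exact (mul_eq_left₀ (Complex.exp_ne_zero _)).1 this
  · intro h
    induction x using Quotient.inductionOn with
    | h z =>
      refine F.mem_openOrbit_point.2 fun ρ hρ => ?_
      -- Rescaling a vanishing coordinate fixes the point. If the resulting torus element were
      -- trivial, then `2 ^ ρ_i = 1` for all `i`, so the generator `ρ` would be zero.
      let l : F.rays → ℂˣ := fun σ => if σ = ρ then Units.mk0 2 two_ne_zero else 1
      have h1 : F.torusHom l (F.point z) = F.point z := by
        rw [torusHom_apply_point]
        congr 1
        refine Subtype.ext (funext fun σ => ?_)
        by_cases hσ : σ = ρ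
        · subst hσ; simp [coxMul, hρ]
        · simp [coxMul, l, hσ]
      have h2 := h _ ⟨l, rfl⟩ h1
      have h3 : ∀ i, F.monomial (fun σ => (l σ : ℂ)) i = 1 := by
        intro i
        have h4 : F.torusHom l (F.expPoint 0) = F.expPoint 0 := by rw [h2]; rfl
        rw [torusHom_expPoint, expPoint_eq_iff] at h4
        simpa [exp_unitsLog] using h4 i
      obtain ⟨s, hs⟩ := F.exists_maxCone_of_ray ρ
      have h5 : (ρ : Fin n → ℤ) = 0 := by
        funext i
        have h6 := h3 i
        rw [monomial, Finset.prod_eq_single ρ (fun σ _ hσ => by simp [l, hσ]) (by simp)] at h6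
        have h7 := congrArg (fun z => ‖z‖) h6
        simp only [l, if_true, Units.val_mk0, norm_zpow, Complex.norm_ofNat, norm_one] at h7
        exact zpow_right_injective₀ (a := (2 : ℝ)) (by norm_num) (by norm_num)
          (by simpa using h7)
      exact (F.linearIndependent s.1 s.2).ne_zero ⟨ρ, hs⟩ h5

variable {F}

theorem conj_mem_torus {f : Equiv.Perm F.Variety} (hf : f ∈ F.torusNormalizer)
    (l : F.rays → ℂˣ) : ∃ l', f * F.torusHom l * f⁻¹ = F.torusHom l' := by
  obtain ⟨l', h⟩ := (Subgroup.mem_normalizer_iff.1 hf.2 (F.torusHom l)).1 ⟨l, rfl⟩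
  exact ⟨l', h.symm⟩

/-- Normalizing elements conjugate stabilizers in the torus, so they preserve the set of points with
trivial stabilizer. -/
theorem apply_mem_openOrbit {f : Equiv.Perm F.Variety} (hf : f ∈ F.torusNormalizer)
    {x : F.Variety} (hx : x ∈ F.openOrbit) : f x ∈ F.openOrbit := by
  rw [mem_openOrbit_iff] at hx ⊢
  rintro _ ⟨l, rfl⟩ h
  obtain ⟨l', h'⟩ := conj_mem_torus (F.torusNormalizer.inv_mem hf) l
  rw [inv_inv] at h'
  have h1 : (F.torusHom l') x = x := by
    rw [← h', Equiv.Perm.mul_apply, Equiv.Perm.mul_apply, h]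
    exact f.symm_apply_apply x
  have h2 := hx _ ⟨l', rfl⟩ h1
  rw [← h'] at h2
  have : F.torusHom l = f * (f⁻¹ * F.torusHom l * f) * f⁻¹ := by group
  rw [this, h2]; group

/-- The normalizer of the torus acts on the open orbit by affine maps with integral linear part in
logarithmic coordinates. -/
theorem exists_affine_of_mem_torusNormalizer {f : Equiv.Perm F.Variety}
    (hf : f ∈ F.torusNormalizer) :
    ∃ (A : Matrix (Fin n) (Fin n) ℤ) (b : Fin n → ℂ), ∀ Y,
      f (F.expPoint Y) = F.expPoint (b + (A.map (Int.cast : ℤ → ℂ)).mulVec Y) := by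
  obtain ⟨b, hb⟩ := F.exists_expPoint_of_mem (apply_mem_openOrbit hf (F.expPoint_mem_openOrbit 0))
  have hlam : ∀ Y, ∃ W, F.expPoint (b + W) = f (F.expPoint Y) := by
    intro Y
    obtain ⟨W, hW⟩ := F.exists_expPoint_of_mem
      (apply_mem_openOrbit hf (F.expPoint_mem_openOrbit Y))
    exact ⟨W - b, by rw [add_sub_cancel, hW]⟩
  choose lam hlam using hlam
  -- The chosen logarithm `lam` is arbitrary modulo `2πi ℤⁿ`. Its exponential `q` has no such
  -- ambiguity and will be shown to be a character of `ℂⁿ`.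
  let q : Fin n → (Fin n → ℂ) → ℂ := fun i Y => Complex.exp (lam Y i)
  have hqeq : ∀ {Y W}, F.expPoint Y = F.expPoint W → ∀ i, q i Y = q i W := by
    intro Y W h i
    have h1 := hlam Y
    rw [h, ← hlam W, expPoint_eq_iff] at h1
    have h2 := h1 i
    simp only [Pi.add_apply, Complex.exp_add] at h2
    exact mul_left_cancel₀ (Complex.exp_ne_zero _) h2
  have hq0 : ∀ i, q i 0 = 1 := by
    intro i
    have h1 := hlam 0
    rw [← hb, expPoint_eq_iff] at h1
    have h2 := h1 i
    simp only [Pi.add_apply, Complex.exp_add] at h2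
    exact (mul_eq_left₀ (Complex.exp_ne_zero _)).1 h2
  have hmul : ∀ i Y W, q i (Y + W) = q i Y * q i W := by
    intro i Y W
    obtain ⟨l, hl⟩ := F.exists_units_unitsLog W
    obtain ⟨l', hl'⟩ := conj_mem_torus hf l
    -- Translation by `W` is a torus element, whose conjugate by `f` is again one. The factor it
    -- contributes does not depend on `V`, and `V = 0` identifies it as `q i W`.
    have hstep : ∀ V, q i (V + W) = q i V * Complex.exp (F.unitsLog l' i) := by
      intro V
      have h1 : F.expPoint (b + lam (V + W)) = F.expPoint (b + lam V + F.unitsLog l') := by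
        rw [hlam, ← torusHom_expPoint, hlam, ← hl']
        rw [Equiv.Perm.mul_apply, Equiv.Perm.mul_apply,
          show f⁻¹ (f (F.expPoint V)) = F.expPoint V from f.symm_apply_apply _, torusHom_expPoint, F.expPoint_add_congr hl]
      rw [expPoint_eq_iff] at h1
      have h2 := h1 i
      simp only [Pi.add_apply, Complex.exp_add, mul_assoc] at h2
      exact mul_left_cancel₀ (Complex.exp_ne_zero _) h2
    have h3 := hstep 0
    rw [zero_add, hq0, one_mul] at h3
    rw [hstep Y, h3]
  have hdiff : ∀ i, DifferentiableAt ℂ (q i) 0 := by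
    intro i
    obtain ⟨s⟩ := F.exists_maxCone
    obtain ⟨t, h, han, hev⟩ := hf.1.1 s (F.expCoord s 0)
    have hexp : Differentiable ℂ (F.expCoord s) := by
      refine differentiable_pi.2 fun e => ?_
      simp only [expCoord, logCoord]
      fun_prop
    have hev' : ∀ᶠ Y in 𝓝 (0 : Fin n → ℂ), f (F.expPoint Y) = F.chart t (h (F.expCoord s Y)) := by
      filter_upwards [(hexp 0).continuousAt.eventually hev] with Y hY
      rw [← hY, chart_expCoord]
    have hne : ∀ e, h (F.expCoord s 0) e ≠ 0 := by
      rw [← mem_openOrbit_chart, ← hev'.self_of_nhds]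
      exact apply_mem_openOrbit hf (F.expPoint_mem_openOrbit 0)
    -- Near `0` the character is a Laurent monomial in the holomorphic chart coordinates of `f`,
    -- none of which vanishes because `f` preserves the open orbit.
    have hq : q i =ᶠ[𝓝 0] fun Y => Complex.exp (-b i) *
        ∏ e : t.1, h (F.expCoord s Y) e ^ ((e : Fin n → ℤ) i) := by
      filter_upwards [hev'] with Y hY
      have h1 : ∀ e, h (F.expCoord s Y) e ≠ 0 := by
        rw [← mem_openOrbit_chart, ← hY]
        exact apply_mem_openOrbit hf (F.expPoint_mem_openOrbit Y)
      rw [← hlam, ← F.chart_expCoord t, chart_eq_chart_iff _ (F.expCoord_ne_zero _ _) h1] at hY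
      rw [← hY i, prod_expCoord, ← Complex.exp_add]
      simp [q]
    refine DifferentiableAt.congr_of_eventuallyEq ?_ hq
    refine DifferentiableAt.const_mul ?_ _
    refine (HasFDerivAt.finsetProd fun e _ => DifferentiableAt.hasFDerivAt ?_).differentiableAt
    have h2 : DifferentiableAt ℂ (fun Y => h (F.expCoord s Y)) 0 :=
      DifferentiableAt.comp (0 : Fin n → ℂ) han.differentiableAt (hexp 0)
    exact (differentiableAt_pi.1 h2 e).zpow (Or.inl (hne e))
  have hcol : ∀ i j, ∃ a : ℤ, ∀ t : ℂ, q i (Pi.single j t) = Complex.exp (a * t) := by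
    intro i j
    have hd : DifferentiableAt ℂ (fun t : ℂ => q i (Pi.single j t)) 0 := by
      have h1 : DifferentiableAt ℂ (fun t : ℂ => (Pi.single j t : Fin n → ℂ)) 0 := by
        refine differentiableAt_pi.2 fun k => ?_
        by_cases hk : k = j
        · subst hk; simp
        · simp [hk]
      have h2 : DifferentiableAt ℂ (q i) ((fun t : ℂ => (Pi.single j t : Fin n → ℂ)) 0) := by
        simpa using hdiff i
      exact h2.comp (0 : ℂ) h1
    have hE := eq_exp_of_map_add (q := fun t : ℂ => q i (Pi.single j t))
      (fun a b => by rw [Pi.single_add, hmul]) (by simp [hq0]) hd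
    -- Periodicity of `expPoint` forces the exponent of the character to be an integer.
    have h1 : q i (Pi.single j (2 * Real.pi * Complex.I)) = 1 := by
      rw [← hq0 i]
      refine hqeq (F.expPoint_eq_iff.2 fun k => ?_) i
      by_cases hk : k = j
      · subst hk; simp [Complex.exp_two_pi_mul_I]
      · simp [hk]
    have h2 := hE (2 * Real.pi * Complex.I)
    simp only [h1] at h2
    obtain ⟨a, ha⟩ := Complex.exp_eq_one_iff.1 h2.symm
    refine ⟨a, fun t => ?_⟩
    rw [← mul_right_cancel₀ Complex.two_pi_I_ne_zero ha]
    exact hE t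
  choose a ha using hcol
  refine ⟨Matrix.of a, b, fun Y => ?_⟩
  rw [← hlam, expPoint_eq_iff]
  intro i
  simp only [Pi.add_apply, Complex.exp_add]
  congr 1
  have hsum : ∀ S : Finset (Fin n), q i (∑ j ∈ S, Pi.single j (Y j)) =
      Complex.exp (∑ j ∈ S, (a i j : ℂ) * Y j) := by
    intro S
    induction S using Finset.induction_on with
    | empty => simp [hq0]
    | insert j S hj ih => rw [Finset.sum_insert hj, Finset.sum_insert hj, hmul, ih, ha,
        Complex.exp_add]
  have h1 := hsum Finset.univ
  rw [Finset.univ_sum_single] at h1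
  exact h1

/-- Evaluating the conjugation at `f (expPoint 0)` and comparing absolute values identifies the Weyl
action on `N_ℝ` with the linear part of `f`; the translation `b` cancels. -/
theorem logMap_eq_of_conj {f : Equiv.Perm F.Variety} {A : Matrix (Fin n) (Fin n) ℤ}
    {b : Fin n → ℂ}
    (hA : ∀ Y, f (F.expPoint Y) = F.expPoint (b + (A.map (Int.cast : ℤ → ℂ)).mulVec Y))
    {l l' : F.rays → ℂˣ} (h : f * F.torusHom l * f⁻¹ = F.torusHom l') :
    F.logMap l' = (A.map (Int.cast : ℤ → ℝ)).mulVec (F.logMap l) := by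
  have h1 : f (F.torusHom l (F.expPoint 0)) = F.torusHom l' (f (F.expPoint 0)) := by
    rw [← h]; simp [Equiv.Perm.mul_apply]
  rw [torusHom_expPoint, hA, hA, torusHom_expPoint, expPoint_eq_iff] at h1
  funext i
  have h2 := congrArg (fun z => ‖z‖) (h1 i)
  simp only [Matrix.mulVec_zero, zero_add, add_zero, Pi.add_apply, Complex.exp_add, norm_mul] at h2
  have h3 := mul_left_cancel₀ (norm_ne_zero_iff.2 (Complex.exp_ne_zero _)) h2
  rw [Complex.norm_exp, Complex.norm_exp, Real.exp_eq_exp, re_unitsLog] at h3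
  rw [← h3]
  simp only [Matrix.mulVec, dotProduct, Matrix.map_apply, Complex.re_sum]
  refine Finset.sum_congr rfl fun j _ => ?_
  rw [← Complex.ofReal_intCast, Complex.re_ofReal_mul, re_unitsLog]

end RegularFan

/-! ## Further rules for the complex Hessian -/

section ComplexHessian

variable {ι : Type*} [Fintype ι] [DecidableEq ι]

theorem fderiv_fderiv_add {φ ψ : (ι → ℂ) → ℝ} (hφ : ContDiff ℝ 2 φ) (hψ : ContDiff ℝ 2 ψ)
    (z : ι → ℂ) : fderiv ℝ (fderiv ℝ fun w => φ w + ψ w) z =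
      fderiv ℝ (fderiv ℝ φ) z + fderiv ℝ (fderiv ℝ ψ) z := by
  have h1 : (fderiv ℝ fun w => φ w + ψ w) = fun w => fderiv ℝ φ w + fderiv ℝ ψ w := by
    funext w
    exact fderiv_fun_add (hφ.differentiable (by norm_num) w) (hψ.differentiable (by norm_num) w)
  rw [h1]
  exact fderiv_fun_add hφ.contDiffAt.differentiableAt_fderiv hψ.contDiffAt.differentiableAt_fderiv

theorem complexHessian_add {φ ψ : (ι → ℂ) → ℝ} (hφ : ContDiff ℝ 2 φ) (hψ : ContDiff ℝ 2 ψ)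
    (z : ι → ℂ) : complexHessian (fun w => φ w + ψ w) z =
      complexHessian φ z + complexHessian ψ z := by
  ext i j
  rw [Matrix.add_apply, complexHessian_apply (hφ.add hψ).contDiffAt,
    complexHessian_apply hφ.contDiffAt, complexHessian_apply hψ.contDiffAt,
    fderiv_fderiv_add hφ hψ]
  simp only [add_apply]
  push_cast
  ring

theorem complexHessian_affine (c : ℝ) (L : (ι → ℂ) →L[ℝ] ℝ) (z : ι → ℂ) :
    complexHessian (fun w => c + L w) z = 0 := by
  have h1 : (fderiv ℝ fun w => c + L w) = fun _ => L := by
    funext w; exact (L.hasFDerivAt.const_add c).fderiv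
  ext i j
  rw [complexHessian_apply (contDiff_const.add L.contDiff).contDiffAt, h1]
  simp

theorem complexHessian_neg {φ : (ι → ℂ) → ℝ} (hφ : ContDiff ℝ 2 φ) (z : ι → ℂ) :
    complexHessian (fun w => -φ w) z = -complexHessian φ z := by
  have h := complexHessian_add hφ hφ.neg z
  have h0 : complexHessian (fun w => φ w + -φ w) z = 0 := by
    rw [← complexHessian_affine 0 0 z]
    simp
  rw [h0] at h
  exact (neg_eq_of_add_eq_zero_right h.symm).symm

theorem complexHessian_sub {φ ψ : (ι → ℂ) → ℝ} (hφ : ContDiff ℝ 2 φ) (hψ : ContDiff ℝ 2 ψ)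
    (z : ι → ℂ) : complexHessian (fun w => φ w - ψ w) z =
      complexHessian φ z - complexHessian ψ z := by
  simp only [sub_eq_add_neg]
  rw [complexHessian_add hφ hψ.neg, complexHessian_neg hψ]

end ComplexHessian

theorem holJacobian_affine {ι κ : Type*} [Fintype ι] [DecidableEq ι] [Fintype κ]
    (A : Matrix κ ι ℂ) (b : κ → ℂ) (Y : ι → ℂ) :
    holJacobian (fun Y => b + A.mulVec Y) Y = A.transpose := by
  have h : HasFDerivAt (fun Y => b + A.mulVec Y) (LinearMap.toContinuousLinearMap A.mulVecLin) Y :=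
    (LinearMap.toContinuousLinearMap A.mulVecLin).hasFDerivAt.const_add b
  ext i k
  simp [holJacobian, h.fderiv]

theorem Matrix.analyticAt_affine {ι κ : Type*} [Fintype ι] [DecidableEq ι] [Fintype κ]
    (A : Matrix κ ι ℂ) (b : κ → ℂ) (Y : ι → ℂ) :
    AnalyticAt ℂ (fun Y => b + A.mulVec Y) Y :=
  analyticAt_const.add ((LinearMap.toContinuousLinearMap A.mulVecLin).analyticAt Y)

/-- Iterating `σ` forwards adds multiples of `c`, and taking preimages subtracts them; one of the
two would violate the lower bound if `c ≠ 0`. -/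
theorem eq_zero_of_map_eq_add {α : Type*} [Nonempty α] {u : α → ℝ} {m c : ℝ} (hm : ∀ x, m ≤ u x)
    {σ : α → α} (hs : Function.Surjective σ) (h : ∀ x, u (σ x) = u x + c) : c = 0 := by
  obtain ⟨x0⟩ := ‹Nonempty α›
  have h1 : ∀ k : ℕ, ∃ x, u x = u x0 + k * c := by
    intro k
    induction k with
    | zero => exact ⟨x0, by simp⟩
    | succ k ih =>
      obtain ⟨x, hx⟩ := ih
      exact ⟨σ x, by rw [h, hx]; push_cast; ring⟩
  have h2 : ∀ k : ℕ, ∃ x, u x = u x0 - k * c := by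
    intro k
    induction k with
    | zero => exact ⟨x0, by simp⟩
    | succ k ih =>
      obtain ⟨x, hx⟩ := ih
      obtain ⟨y, rfl⟩ := hs x
      refine ⟨y, ?_⟩
      rw [h] at hx
      push_cast
      linarith
  by_contra hc
  obtain ⟨k, hk⟩ := exists_nat_gt ((u x0 - m) / |c|)
  have hc' : 0 < |c| := abs_pos.2 hc
  rw [div_lt_iff₀ hc'] at hk
  obtain ⟨x, hx⟩ := h1 k
  obtain ⟨y, hy⟩ := h2 k
  have hx' := hm x
  have hy' := hm y
  rcases abs_cases c with ⟨h3, -⟩ | ⟨h3, -⟩ <;> rw [h3] at hk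
  · linarith
  · linarith

/-! ## The metric in logarithmic coordinates -/

noncomputable section

namespace RegularFan

variable {n : ℕ} (F : RegularFan n)

theorem analyticAt_expCoord (s : F.maxCones) (Y : Fin n → ℂ) :
    AnalyticAt ℂ (F.expCoord s) Y := by
  refine AnalyticAt.pi fun e => ?_
  refine AnalyticAt.cexp ?_
  simp only [logCoord]
  refine Finset.analyticAt_fun_sum _ fun i _ => ?_
  exact analyticAt_const.mul ((ContinuousLinearMap.proj (R := ℂ) (φ := fun _ : Fin n => ℂ)
    i).analyticAt Y)

theorem contDiff_expCoord (s : F.maxCones) {k : WithTop ℕ∞} : ContDiff ℝ k (F.expCoord s) := by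
  refine contDiff_pi.2 fun e => ?_
  simp only [expCoord, logCoord]
  fun_prop

theorem holJacobian_expCoord (s : F.maxCones) (Y : Fin n → ℂ) (i : Fin n) (e : s.1) :
    holJacobian (F.expCoord s) Y i e = (F.coneCoord s e i : ℂ) * F.expCoord s Y e := by
  have h1 : HasFDerivAt (fun Y => F.logCoord s Y e)
      (∑ i, (F.coneCoord s e i : ℂ) • ContinuousLinearMap.proj (R := ℂ) (φ := fun _ : Fin n => ℂ) i)
      Y := by
    simp only [logCoord]
    exact HasFDerivAt.fun_sum fun i _ =>
      (ContinuousLinearMap.proj (R := ℂ) (φ := fun _ : Fin n => ℂ) i).hasFDerivAt.const_mul _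
  have h2 := h1.cexp
  have h3 : holJacobian (F.expCoord s) Y i e =
      fderiv ℂ (fun Y => F.expCoord s Y e) Y (Pi.single i 1) := by
    rw [holJacobian, Matrix.of_apply, fderiv_apply]
    · rfl
    · exact (F.analyticAt_expCoord s Y).differentiableAt
  rw [h3]
  change fderiv ℂ (fun Y => Complex.exp (F.logCoord s Y e)) Y (Pi.single i 1) = _
  rw [h2.fderiv]
  simp [sum_apply, Pi.single_apply, expCoord, mul_comm]

theorem expCoord_congr {Y W : Fin n → ℂ} (h : F.expPoint Y = F.expPoint W) (s : F.maxCones) :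
    F.expCoord s Y = F.expCoord s W := by
  have h' := F.expPoint_eq_iff.1 h
  funext e
  simp only [expCoord, logCoord, Complex.exp_sum, Complex.exp_int_mul, h']

theorem exists_isLocalExpr {f : F.Variety → F.Variety} {A : Matrix (Fin n) (Fin n) ℂ}
    {b : Fin n → ℂ} (hf : ∀ Y, f (F.expPoint Y) = F.expPoint (b + A.mulVec Y))
    (s t : F.maxCones) (Y₀ : Fin n → ℂ) :
    ∃ h, F.IsLocalExpr f s t (F.expCoord s Y₀) h ∧
      ∀ Y, h (F.expCoord s Y) = F.expCoord t (b + A.mulVec Y) := by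
  set z₀ := F.expCoord s Y₀
  have hz₀' : ∀ e, z₀ e ≠ 0 := F.expCoord_ne_zero s Y₀
  -- A local inverse of `expCoord`. Taking the logarithm of `z / z₀`, which is close to `1`, avoids
  -- the branch cut. The last claim holds for all `Y` because the ambiguity of the logarithm
  -- disappears in `expCoord t`.
  let k : (s.1 → ℂ) → Fin n → ℂ := fun z => Y₀ + fun i =>
    ∑ e : s.1, Complex.log (z e / z₀ e) * ((e : Fin n → ℤ) i : ℂ)
  have hk : ∀ z : s.1 → ℂ, (∀ e, z e ≠ 0) → F.expCoord s (k z) = z := by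
    intro z hz
    funext e
    rw [expCoord, logCoord_add, F.logCoord_sum_mul s fun e => Complex.log (z e / z₀ e),
      Pi.add_apply, Complex.exp_add, Complex.exp_log (div_ne_zero (hz e) (hz₀' e))]
    exact mul_div_cancel₀ _ (hz₀' e)
  have hkE : ∀ z : s.1 → ℂ, (∀ e, z e ≠ 0) → F.expPoint (k z) = F.chart s z := by
    intro z hz
    rw [← F.chart_expCoord s, hk z hz]
  have hkan : AnalyticAt ℂ k z₀ := by
    refine AnalyticAt.add analyticAt_const (AnalyticAt.pi fun i => ?_)
    refine Finset.analyticAt_fun_sum _ fun e _ => AnalyticAt.mul ?_ analyticAt_const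
    refine AnalyticAt.clog ?_ (by simp [div_self (hz₀' e)])
    exact ((ContinuousLinearMap.proj (R := ℂ) (φ := fun _ : s.1 => ℂ) e).analyticAt _).div
      analyticAt_const (hz₀' e)
  refine ⟨fun z => F.expCoord t (b + A.mulVec (k z)), ⟨?_, ?_⟩, ?_⟩
  · exact ((F.analyticAt_expCoord t _).comp (A.analyticAt_affine b _)).comp hkan
  · have hne : ∀ᶠ z in 𝓝 z₀, ∀ e, z e ≠ 0 := by
      refine eventually_all.2 fun e => ?_
      exact (continuous_apply e).continuousAt.eventually_ne (hz₀' e)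
    filter_upwards [hne] with z hz
    rw [← hkE z hz, hf, chart_expCoord]
  · intro Y
    refine F.expCoord_congr ?_ t
    rw [← hf, ← hf, hkE _ (F.expCoord_ne_zero s Y), chart_expCoord]

namespace KahlerMetric

variable {F}
variable (g : F.KahlerMetric)

/-- The coefficient matrix of the metric in logarithmic coordinates, computed in the chart
of `s`. -/
def chartLogCoeff (s : F.maxCones) (Y : Fin n → ℂ) : Matrix (Fin n) (Fin n) ℂ :=
  holJacobian (F.expCoord s) Y * g.coeff s (F.expCoord s Y) *
    (holJacobian (F.expCoord s) Y).conjTranspose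

/-- Pull-back invariance in charts becomes a constant congruence by `A` in logarithmic coordinates.
The case `f = id` gives independence of the chart. -/
theorem chartLogCoeff_affine {f : F.Variety → F.Variety} {A : Matrix (Fin n) (Fin n) ℂ}
    {b : Fin n → ℂ} (hf : ∀ Y, f (F.expPoint Y) = F.expPoint (b + A.mulVec Y))
    (hg : F.IsPullbackInvariant g.coeff f) (s t : F.maxCones) (Y : Fin n → ℂ) :
    g.chartLogCoeff s Y = A.transpose * g.chartLogCoeff t (b + A.mulVec Y) *
      A.transpose.conjTranspose := by
  obtain ⟨h, hh, hhY⟩ := F.exists_isLocalExpr hf s t Y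
  have h1 : holJacobian (F.expCoord s) Y * holJacobian h (F.expCoord s Y) =
      A.transpose * holJacobian (F.expCoord t) (b + A.mulVec Y) := by
    rw [← holJacobian_affine A b Y, ← holJacobian_comp (A.analyticAt_affine b Y).differentiableAt
      (F.analyticAt_expCoord t _).differentiableAt,
      ← holJacobian_comp (F.analyticAt_expCoord s Y).differentiableAt hh.1.differentiableAt]
    congr 1
    funext Y
    exact hhY Y
  rw [chartLogCoeff, chartLogCoeff, hg s t _ h hh, hhY]
  calc _ = (holJacobian (F.expCoord s) Y * holJacobian h (F.expCoord s Y)) *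
        g.coeff t (F.expCoord t (b + A.mulVec Y)) *
        (holJacobian (F.expCoord s) Y * holJacobian h (F.expCoord s Y)).conjTranspose := by
        simp only [Matrix.conjTranspose_mul, Matrix.mul_assoc]
    _ = _ := by
        rw [h1]
        simp only [Matrix.conjTranspose_mul, Matrix.mul_assoc]

/-- The coefficient matrix of the metric in logarithmic coordinates. -/
def logCoeff (Y : Fin n → ℂ) : Matrix (Fin n) (Fin n) ℂ :=
  g.chartLogCoeff (Classical.choice F.exists_maxCone) Y

theorem chartLogCoeff_eq (s : F.maxCones) (Y : Fin n → ℂ) :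
    g.chartLogCoeff s Y = g.logCoeff Y := by
  have := g.chartLogCoeff_affine (A := 1) (b := 0) (f := id) (by simp) g.compatible s
    (Classical.choice F.exists_maxCone) Y
  simpa [logCoeff] using this

theorem logCoeff_affine {f : F.Variety → F.Variety} {A : Matrix (Fin n) (Fin n) ℂ}
    {b : Fin n → ℂ} (hf : ∀ Y, f (F.expPoint Y) = F.expPoint (b + A.mulVec Y))
    (hg : F.IsPullbackInvariant g.coeff f) (Y : Fin n → ℂ) :
    g.logCoeff Y = A.transpose * g.logCoeff (b + A.mulVec Y) * A.transpose.conjTranspose :=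
  g.chartLogCoeff_affine hf hg _ _ Y

theorem det_coeff_pos (s : F.maxCones) (z : s.1 → ℂ) : 0 < (g.coeff s z).det.re :=
  (Complex.lt_def.1 (g.posDef s z).det_pos).1

/-- The Jacobian of `expCoord` is a constant invertible matrix `P` times the diagonal matrix of the
coordinates, so `κ = |det P|²`. -/
theorem exists_det_logCoeff (s : F.maxCones) : ∃ κ : ℝ, 0 < κ ∧ ∀ Y,
    (g.logCoeff Y).det =
      ((κ * (∏ e, ‖F.expCoord s Y e‖ ^ 2) * (g.coeff s (F.expCoord s Y)).det.re : ℝ) : ℂ) := by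
  let σ : Fin n ≃ s.1 := ((F.coneBasis s).indexEquiv (Pi.basisFun ℤ (Fin n))).symm
  let P : Matrix (Fin n) (Fin n) ℂ := Matrix.of fun i j => (F.coneCoord s (σ j) i : ℂ)
  let Q : Matrix (Fin n) (Fin n) ℂ := Matrix.of fun j i => (((σ j : s.1) : Fin n → ℤ) i : ℂ)
  have hPQ : P * Q = 1 := by
    ext i k
    rw [Matrix.mul_apply, Matrix.one_apply]
    have h := congrArg (Int.cast : ℤ → ℂ) (F.sum_coneCoord_mul_int s i k)
    push_cast at h
    rw [← h]
    exact Equiv.sum_comp σ fun e => (F.coneCoord s e i : ℂ) * ((e : Fin n → ℤ) k : ℂ)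
  have hP : P.det ≠ 0 := fun h => by
    have := congrArg Matrix.det hPQ
    rw [Matrix.det_mul, h, zero_mul, Matrix.det_one] at this
    exact zero_ne_one this
  refine ⟨‖P.det‖ ^ 2, by positivity, fun Y => ?_⟩
  set J := holJacobian (F.expCoord s) Y with hJ
  set C := g.coeff s (F.expCoord s Y)
  have h1 : g.logCoeff Y = J.submatrix id σ * C.submatrix σ σ *
      (J.submatrix id σ).conjTranspose := by
    rw [← g.chartLogCoeff_eq s, chartLogCoeff, Matrix.conjTranspose_submatrix,
      Matrix.submatrix_mul_equiv, Matrix.submatrix_mul_equiv, Matrix.submatrix_id_id]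
  have h2 : J.submatrix id σ = P * Matrix.diagonal fun j => F.expCoord s Y (σ j) := by
    ext i j
    rw [Matrix.mul_diagonal, Matrix.submatrix_apply, hJ, F.holJacobian_expCoord]
    rfl
  have h3 : (J.submatrix id σ).det = P.det * ∏ e, F.expCoord s Y e := by
    rw [h2, Matrix.det_mul, Matrix.det_diagonal, Equiv.prod_comp σ]
  have h4 : C.det = (C.det.re : ℂ) := by
    refine Complex.ext rfl ?_
    simpa using (Complex.lt_def.1 (g.posDef s (F.expCoord s Y)).det_pos).2.symm
  rw [h1, Matrix.det_mul, Matrix.det_mul, Matrix.det_submatrix_equiv_self,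
    Matrix.det_conjTranspose, h3, h4]
  have h5 : ∀ z : ℂ, z * star z = ((‖z‖ ^ 2 : ℝ) : ℂ) := fun z => by
    rw [RCLike.star_def, Complex.mul_conj, Complex.normSq_eq_norm_sq]
  calc _ = (P.det * ∏ e, F.expCoord s Y e) * star (P.det * ∏ e, F.expCoord s Y e) *
        (C.det.re : ℂ) := by ring
    _ = _ := by
        rw [h5, ← Complex.ofReal_mul, norm_mul, mul_pow, norm_prod, Finset.prod_pow,
          Complex.ofReal_re]

/-! ### The potential -/

/-- The local potential of the metric in the chart of `s`, given by the volume form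
`e^Φ dV_g`. -/
def chartPotential (Φ : F.Variety → ℝ) (s : F.maxCones) (z : s.1 → ℂ) : ℝ :=
  -Real.log (g.coeff s z).det.re - Φ (F.chart s z)

/-- The potential of the metric in logarithmic coordinates. -/
def logPotential (Φ : F.Variety → ℝ) (Y : Fin n → ℂ) : ℝ :=
  -Real.log (g.logCoeff Y).det.re - Φ (F.expPoint Y)

theorem contDiff_log_det (s : F.maxCones) :
    ContDiff ℝ 2 fun z => Real.log (g.coeff s z).det.re := by
  refine ContDiff.log ?_ fun z => (g.det_coeff_pos s z).ne'
  refine Complex.reCLM.contDiff.comp ?_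
  simp only [Matrix.det_apply]
  refine ContDiff.sum fun σ _ => ContDiff.const_smul _ (contDiff_prod fun i _ => ?_)
  exact contDiff_infty.1 (g.smooth s _ _) 2

variable {g} {Φ : F.Variety → ℝ}

theorem contDiff_chart_of_isCk_top (hΦ : IsCk ⊤ Φ) (s : F.maxCones) :
    ContDiff ℝ 2 fun z => Φ (F.chart s z) :=
  contDiff_infty.1 (hΦ s) 2

theorem contDiff_chartPotential (hΦ : IsCk ⊤ Φ) (s : F.maxCones) :
    ContDiff ℝ 2 (g.chartPotential Φ s) :=
  (g.contDiff_log_det s).neg.sub (contDiff_chart_of_isCk_top hΦ s)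

theorem complexHessian_chartPotential (hΦ : IsCk ⊤ Φ)
    (hg : ∀ s z, g.ricci s z - g.coeff s z = complexHessian (fun w => Φ (F.chart s w)) z)
    (s : F.maxCones) (z : s.1 → ℂ) :
    complexHessian (g.chartPotential Φ s) z = g.coeff s z := by
  have h1 := complexHessian_sub (g.contDiff_log_det s).neg (contDiff_chart_of_isCk_top hΦ s) z
  rw [complexHessian_neg (g.contDiff_log_det s), ← hg s z, ricci, sub_sub_cancel] at h1
  exact h1

/-- The real linear form `Y ↦ ∑ Re Y_e`, where `Y = ∑ Y_e e`. -/
def _root_.RegularFan.sumReLogCoord (F : RegularFan n) (s : F.maxCones) : (Fin n → ℂ) →L[ℝ] ℝ :=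
  ∑ e : s.1, ∑ i, (F.coneCoord s e i : ℝ) •
    (Complex.reCLM.comp (ContinuousLinearMap.proj (R := ℝ) (φ := fun _ : Fin n => ℂ) i))

theorem _root_.RegularFan.re_logCoord (F : RegularFan n) (s : F.maxCones) (Y : Fin n → ℂ)
    (e : s.1) : (F.logCoord s Y e).re = F.logCoord s (fun i => (Y i).re) e := by
  simp only [logCoord, Complex.re_sum]
  refine Finset.sum_congr rfl fun i _ => ?_
  rw [← Complex.ofReal_intCast, Complex.re_ofReal_mul]

theorem _root_.RegularFan.sumReLogCoord_apply (F : RegularFan n) (s : F.maxCones)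
    (Y : Fin n → ℂ) : F.sumReLogCoord s Y = ∑ e, (F.logCoord s Y e).re := by
  simp [sumReLogCoord, logCoord, sum_apply]

theorem _root_.RegularFan.norm_expCoord (F : RegularFan n) (s : F.maxCones) (Y : Fin n → ℂ)
    (e : s.1) : ‖F.expCoord s Y e‖ = Real.exp (F.logCoord s Y e).re := Complex.norm_exp _

/-- The determinant changes by `κ ∏ |z_e|²`, whose logarithm is real affine in `Y`. This term is
invisible to the complex Hessian, but it carries the growth of the potential at infinity. -/
theorem exists_logPotential_eq (g : F.KahlerMetric) (Φ : F.Variety → ℝ) (s : F.maxCones) :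
    ∃ c : ℝ, ∀ Y, g.logPotential Φ Y =
      g.chartPotential Φ s (F.expCoord s Y) + (c + (-2 : ℝ) • F.sumReLogCoord s Y) := by
  obtain ⟨κ, hκ, h⟩ := g.exists_det_logCoeff s
  refine ⟨-Real.log κ, fun Y => ?_⟩
  have hp : 0 < ∏ e, ‖F.expCoord s Y e‖ ^ 2 :=
    Finset.prod_pos fun e _ => by have := norm_pos_iff.2 (F.expCoord_ne_zero s Y e); positivity
  rw [logPotential, chartPotential, h Y, Complex.ofReal_re, chart_expCoord,
    Real.log_mul (mul_pos hκ hp).ne' (g.det_coeff_pos s _).ne', Real.log_mul hκ.ne' hp.ne',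
    Real.log_prod (fun e _ => by have := norm_pos_iff.2 (F.expCoord_ne_zero s Y e); positivity),
    F.sumReLogCoord_apply]
  simp only [F.norm_expCoord, Real.log_pow, Real.log_exp, ← Finset.mul_sum]
  push_cast
  rw [smul_eq_mul]
  ring

theorem contDiff_logPotential (hΦ : IsCk ⊤ Φ) : ContDiff ℝ 2 (g.logPotential Φ) := by
  obtain ⟨s⟩ := F.exists_maxCone
  obtain ⟨c, hc⟩ := g.exists_logPotential_eq Φ s
  rw [funext hc]
  exact ((contDiff_chartPotential hΦ s).comp (F.contDiff_expCoord s)).add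
    (contDiff_const.add ((F.sumReLogCoord s).contDiff.const_smul _))

theorem complexHessian_logPotential (hΦ : IsCk ⊤ Φ)
    (hg : ∀ s z, g.ricci s z - g.coeff s z = complexHessian (fun w => Φ (F.chart s w)) z)
    (Y : Fin n → ℂ) : complexHessian (g.logPotential Φ) Y = g.logCoeff Y := by
  obtain ⟨s⟩ := F.exists_maxCone
  obtain ⟨c, hc⟩ := g.exists_logPotential_eq Φ s
  have h0 : ContDiff ℝ 2 fun Y => g.chartPotential Φ s (F.expCoord s Y) :=
    (contDiff_chartPotential hΦ s).comp (F.contDiff_expCoord s)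
  rw [funext hc, complexHessian_add h0
    (contDiff_const.add ((F.sumReLogCoord s).contDiff.const_smul _))]
  have h1 := complexHessian_affine c ((-2 : ℝ) • F.sumReLogCoord s) Y
  have h2 := complexHessian_comp (contDiff_chartPotential hΦ s (g := g)).contDiffAt
    (F.analyticAt_expCoord s Y)
  simp only [smul_apply] at h1
  rw [h1, add_zero, ← g.chartLogCoeff_eq s, chartLogCoeff,
    ← complexHessian_chartPotential hΦ hg s]
  exact h2

end KahlerMetric

end RegularFan

end

/-! ## Growth and invariance of the potential -/

namespace RegularFan

variable {n : ℕ} (F : RegularFan n)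

theorem logCoord_neg {K : Type*} [CommRing K] (s : F.maxCones) (y : Fin n → K) :
    F.logCoord s (-y) = -F.logCoord s y := by
  funext e; simp [logCoord]

theorem logCoord_smul {K : Type*} [CommRing K] (s : F.maxCones) (c : K) (y : Fin n → K) :
    F.logCoord s (c • y) = c • F.logCoord s y := by
  funext e
  simp only [logCoord, Pi.smul_apply, smul_eq_mul, Finset.mul_sum]
  exact Finset.sum_congr rfl fun i _ => by ring

/-- The unit polydiscs of the charts cover the open orbit. -/
theorem exists_re_logCoord_nonpos (Y : Fin n → ℂ) :
    ∃ s : F.maxCones, ∀ e, (F.logCoord s Y e).re ≤ 0 := by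
  obtain ⟨s, hs⟩ := F.exists_logCoord_nonneg (-fun i => (Y i).re)
  refine ⟨s, fun e => ?_⟩
  have := hs e
  rw [logCoord_neg, Pi.neg_apply] at this
  rw [re_logCoord]
  linarith

/-- The condition on `Y` confines the chart coordinates to a compact polydisc of radius `exp r`, and
there are finitely many charts. -/
theorem exists_abs_expCoord_le (r : ℝ) (ψ : ∀ s : F.maxCones, (s.1 → ℂ) → ℝ)
    (hψ : ∀ s, Continuous (ψ s)) :
    ∃ B, ∀ s Y, (∀ e, (F.logCoord s Y e).re ≤ r) → |ψ s (F.expCoord s Y)| ≤ B := by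
  have h1 : ∀ s : F.maxCones, ∃ B, ∀ Y, (∀ e, (F.logCoord s Y e).re ≤ r) →
      |ψ s (F.expCoord s Y)| ≤ B := by
    intro s
    obtain ⟨B, hB⟩ := (isCompact_closedBall (0 : s.1 → ℂ)
      (Real.exp r)).exists_bound_of_continuousOn (hψ s).continuousOn
    refine ⟨B, fun Y hY => hB _ ?_⟩
    rw [mem_closedBall_zero_iff, pi_norm_le_iff_of_nonneg (Real.exp_pos r).le]
    intro e
    rw [norm_expCoord]
    exact Real.exp_le_exp.2 (hY e)
  choose B hB using h1
  obtain ⟨C, hC⟩ := (Set.finite_range B).bddAbove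
  exact ⟨C, fun s Y hY => (hB s Y hY).trans (hC ⟨s, rfl⟩)⟩

/-- A function on `X` which is continuous in the charts is bounded on the open orbit. -/
theorem exists_abs_expPoint_le {ψ : F.Variety → ℝ}
    (hψ : ∀ s, Continuous fun z => ψ (F.chart s z)) : ∃ B, ∀ Y, |ψ (F.expPoint Y)| ≤ B := by
  obtain ⟨B, hB⟩ := F.exists_abs_expCoord_le 0 (fun s z => ψ (F.chart s z)) hψ
  refine ⟨B, fun Y => ?_⟩
  obtain ⟨s, hs⟩ := F.exists_re_logCoord_nonpos Y
  have := hB s Y hs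
  rwa [chart_expCoord] at this

theorem exists_mem_compactTorus (θ : Fin n → ℝ) :
    ∃ f ∈ F.compactTorus, ∀ Y, f (F.expPoint Y) =
      F.expPoint (Y + fun i => (θ i : ℂ) * Complex.I) := by
  obtain ⟨s⟩ := F.exists_maxCone
  let l : F.rays → ℂˣ := fun ρ => if h : (ρ : Fin n → ℤ) ∈ s.1 then
    Units.mk0 (F.expCoord s (fun i => (θ i : ℂ) * Complex.I) ⟨ρ, h⟩) (F.expCoord_ne_zero _ _ _)
    else 1
  refine ⟨F.torusHom l, ⟨l, fun ρ => ?_, rfl⟩, fun Y => ?_⟩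
  · by_cases h : (ρ : Fin n → ℤ) ∈ s.1
    · simp only [l, h, dif_pos, Units.val_mk0]
      rw [norm_expCoord, re_logCoord]
      simp [logCoord]
    · simp [l, h]
  · rw [torusHom_expPoint]
    refine F.expPoint_add_congr fun i => ?_
    rw [exp_unitsLog]
    refine Eq.trans ?_ (F.prod_expCoord s (fun i => (θ i : ℂ) * Complex.I) i)
    rw [← F.monomial_chart]
    congr 1
    funext ρ
    rw [chartPoint_apply]
    by_cases h : (ρ : Fin n → ℤ) ∈ s.1 <;> simp [l, h]

namespace KahlerMetric

variable {F}
variable {g : F.KahlerMetric} {Φ : F.Variety → ℝ}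

/-- Asymptotics of the potential. -/
theorem exists_abs_logPotential_add_le (hΦ : IsCk ⊤ Φ) (r : ℝ) :
    ∃ B, ∀ s Y, (∀ e, (F.logCoord s Y e).re ≤ r) →
      |g.logPotential Φ Y + 2 * ∑ e, (F.logCoord s Y e).re| ≤ B := by
  have h1 := fun s => g.exists_logPotential_eq Φ s
  choose c hc using h1
  obtain ⟨B, hB⟩ := F.exists_abs_expCoord_le r (fun s z => g.chartPotential Φ s z + c s)
    fun s => (contDiff_chartPotential hΦ s).continuous.add continuous_const
  refine ⟨B, fun s Y hY => ?_⟩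
  have := hB s Y hY
  rw [hc s Y, ← F.sumReLogCoord_apply]
  convert this using 2
  rw [smul_eq_mul]
  ring

theorem exists_le_logPotential (hΦ : IsCk ⊤ Φ) : ∃ m, ∀ Y, m ≤ g.logPotential Φ Y := by
  obtain ⟨B, hB⟩ := exists_abs_logPotential_add_le (g := g) hΦ 0
  refine ⟨-B, fun Y => ?_⟩
  obtain ⟨s, hs⟩ := F.exists_re_logCoord_nonpos Y
  have h1 := (abs_le.1 (hB s Y hs)).1
  have h2 : ∑ e, (F.logCoord s Y e).re ≤ 0 := Finset.sum_nonpos fun e _ => hs e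
  linarith

theorem det_logCoeff_ne_zero (g : F.KahlerMetric) (Y : Fin n → ℂ) : (g.logCoeff Y).det ≠ 0 := by
  obtain ⟨s⟩ := F.exists_maxCone
  obtain ⟨κ, hκ, h⟩ := g.exists_det_logCoeff s
  rw [h, Complex.ofReal_ne_zero]
  have : 0 < ∏ e, ‖F.expCoord s Y e‖ ^ 2 :=
    Finset.prod_pos fun e _ => by have := norm_pos_iff.2 (F.expCoord_ne_zero s Y e); positivity
  exact (mul_pos (mul_pos hκ this) (g.det_coeff_pos s _)).ne'

theorem det_ne_zero_of_isPullbackInvariant {f : F.Variety → F.Variety}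
    {A : Matrix (Fin n) (Fin n) ℂ} {b : Fin n → ℂ}
    (hf : ∀ Y, f (F.expPoint Y) = F.expPoint (b + A.mulVec Y))
    (hgf : F.IsPullbackInvariant g.coeff f) : A.det ≠ 0 := by
  intro h
  have h1 := congrArg Matrix.det (g.logCoeff_affine hf hgf 0)
  rw [Matrix.det_mul, Matrix.det_mul, Matrix.det_transpose, h, zero_mul, zero_mul] at h1
  exact g.det_logCoeff_ne_zero 0 h1

/-- The potential is invariant under every isometry acting on the open orbit by an affine map in
logarithmic coordinates. -/
theorem logPotential_affine (hΦ : IsCk ⊤ Φ)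
    (hg : ∀ s z, g.ricci s z - g.coeff s z = complexHessian (fun w => Φ (F.chart s w)) z)
    {f : F.Variety → F.Variety} {A : Matrix (Fin n) (Fin n) ℂ} {b : Fin n → ℂ}
    (hf : ∀ Y, f (F.expPoint Y) = F.expPoint (b + A.mulVec Y))
    (hgf : F.IsPullbackInvariant g.coeff f) (Y : Fin n → ℂ) :
    g.logPotential Φ (b + A.mulVec Y) = g.logPotential Φ Y := by
  have hA : A.det ≠ 0 := det_ne_zero_of_isPullbackInvariant hf hgf
  have hu : ContDiff ℝ 2 (g.logPotential Φ) := contDiff_logPotential hΦ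
  have haff : ContDiff ℝ 2 fun Y => b + A.mulVec Y := by
    refine contDiff_const.add ?_
    exact ((LinearMap.toContinuousLinearMap A.mulVecLin).restrictScalars ℝ).contDiff
  have huA : ContDiff ℝ 2 fun Y => g.logPotential Φ (b + A.mulVec Y) := hu.comp haff
  set K : (Fin n → ℂ) → ℝ := fun Y => g.logPotential Φ (b + A.mulVec Y) - g.logPotential Φ Y
    with hK
  have hH : ∀ Y, complexHessian K Y = 0 := by
    intro Y
    rw [hK, complexHessian_sub huA hu, complexHessian_comp hu.contDiffAt
      (A.analyticAt_affine b Y), holJacobian_affine, complexHessian_logPotential hΦ hg,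
      complexHessian_logPotential hΦ hg, ← g.logCoeff_affine hf hgf, sub_self]
  obtain ⟨B, hB⟩ := F.exists_abs_expPoint_le (ψ := Φ)
    fun s => (contDiff_chart_of_isCk_top hΦ s).continuous
  have hdet : ∀ Y, (g.logCoeff Y).det.re = ‖A.det‖ ^ 2 * (g.logCoeff (b + A.mulVec Y)).det.re := by
    intro Y
    rw [g.logCoeff_affine hf hgf Y, Matrix.det_mul, Matrix.det_mul, Matrix.det_transpose,
      Matrix.det_conjTranspose, Matrix.det_transpose, mul_right_comm, RCLike.star_def,
      Complex.mul_conj, Complex.normSq_eq_norm_sq, Complex.re_ofReal_mul]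
  have hre : ∀ Y, (g.logCoeff Y).det.re ≠ 0 := by
    intro Y h
    obtain ⟨s⟩ := F.exists_maxCone
    obtain ⟨κ, -, h'⟩ := g.exists_det_logCoeff s
    refine g.det_logCoeff_ne_zero Y ?_
    rw [h' Y] at h ⊢
    rw [Complex.ofReal_re] at h
    rw [h, Complex.ofReal_zero]
  -- `Φ` itself is not known to be invariant, but it is bounded, and the determinants differ by the
  -- constant factor `‖A.det‖ ^ 2`. So the pluriharmonic function `K` is bounded, hence constant;
  -- the lower bound on `u` then makes it zero.
  have hKB : ∀ Y, |K Y| ≤ |Real.log (‖A.det‖ ^ 2)| + 2 * B := by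
    intro Y
    have h1 : K Y = Real.log (‖A.det‖ ^ 2) - Φ (F.expPoint (b + A.mulVec Y)) +
        Φ (F.expPoint Y) := by
      simp only [hK, logPotential]
      rw [hdet Y, Real.log_mul (by have := norm_ne_zero_iff.2 hA; positivity) (hre _)]
      ring
    rw [h1]
    have h2 := abs_le.1 (hB (b + A.mulVec Y))
    have h3 := abs_le.1 (hB Y)
    have h4 := neg_abs_le (Real.log (‖A.det‖ ^ 2))
    have h5 := le_abs_self (Real.log (‖A.det‖ ^ 2))
    exact abs_le.2 ⟨by linarith, by linarith⟩
  have hc : ∀ Y, K Y = K 0 := fun Y => eq_of_complexHessian_eq_zero (huA.sub hu) hH hKB Y 0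
  obtain ⟨m, hm⟩ := exists_le_logPotential (g := g) hΦ
  have hsurj : Function.Surjective fun Y => b + A.mulVec Y := by
    intro W
    refine ⟨(A⁻¹).mulVec (W - b), ?_⟩
    simp only
    rw [Matrix.mulVec_mulVec, Matrix.mul_nonsing_inv _ (isUnit_iff_ne_zero.2 hA),
      Matrix.one_mulVec, add_sub_cancel]
  have h0 : K 0 = 0 := eq_zero_of_map_eq_add hm hsurj fun Y => by
    rw [← hc Y]; simp only [hK]; ring
  have := hc Y
  rw [h0] at this
  exact sub_eq_zero.1 this

theorem logPotential_add_imag (hΦ : IsCk ⊤ Φ)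
    (hg : ∀ s z, g.ricci s z - g.coeff s z = complexHessian (fun w => Φ (F.chart s w)) z)
    {x₀ : F.Variety} (hG : g.IsInvariant (F.compactGroup x₀)) (Y : Fin n → ℂ) (θ : Fin n → ℝ) :
    g.logPotential Φ (Y + fun i => (θ i : ℂ) * Complex.I) = g.logPotential Φ Y := by
  obtain ⟨f, hf, h⟩ := F.exists_mem_compactTorus θ
  have := logPotential_affine hΦ hg (f := f) (A := 1) (b := fun i => (θ i : ℂ) * Complex.I)
    (fun Y => by rw [h, Matrix.one_mulVec, add_comm]) (hG f (Subgroup.mem_sup_left hf)) Y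
  rwa [Matrix.one_mulVec, add_comm] at this

end KahlerMetric

end RegularFan

/-! ## Reduction to the stabilizer of a point of the open orbit -/

namespace RegularFan

variable {n : ℕ} (F : RegularFan n)

/-- Modulo `coxGroup`, `l` can be replaced by the vector `c` equal to `1` off `s`, which acts
diagonally in the chart. -/
theorem torusHom_chart (l : F.rays → ℂˣ) (s : F.maxCones) (z : s.1 → ℂ) :
    F.torusHom l (F.chart s z) = F.chart s fun e => F.expCoord s (F.unitsLog l) e * z e := by
  let c : F.rays → ℂ := (F.chartPoint s (F.expCoord s (F.unitsLog l))).1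
  have hc : ∀ ρ, c ρ ≠ 0 := F.chartPoint_ne_zero (F.expCoord_ne_zero s _)
  have hm : (fun ρ => Units.mk0 (c ρ) (hc ρ) * (l ρ)⁻¹ : F.rays → ℂˣ) ∈ F.coxGroup := by
    rw [mem_coxGroup_iff]
    intro i
    have h1 := F.monomial_mul (fun ρ => ((Units.mk0 (c ρ) (hc ρ) * (l ρ)⁻¹ : ℂˣ) : ℂ))
      (fun ρ => (l ρ : ℂ)) i
    simp only [Units.val_mul, Units.val_mk0, Units.inv_mul_cancel_right] at h1
    rw [← exp_unitsLog, F.monomial_chart, prod_expCoord] at h1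
    have h2 := (mul_eq_right₀ (Complex.exp_ne_zero _)).1 h1.symm
    simpa only [Units.val_mul, Units.val_mk0] using h2
  rw [chart_eq_point, chart_eq_point, torusHom_apply_point, F.point_eq_iff]
  refine ⟨_, hm, Subtype.ext (funext fun ρ => ?_)⟩
  have h3 : (F.coxMul (fun ρ => Units.mk0 (c ρ) (hc ρ) * (l ρ)⁻¹)
      (F.coxMul l (F.chartPoint s z))).1 ρ = c ρ * (F.chartPoint s z).1 ρ := by
    simp [coxMul, mul_assoc]
  rw [h3]
  simp only [c, chartPoint_apply]
  split_ifs <;> simp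

theorem isHolomorphic_torusHom (l : F.rays → ℂˣ) : F.IsHolomorphic (F.torusHom l) := by
  intro s z₀
  refine ⟨s, fun z e => F.expCoord s (F.unitsLog l) e * z e, ?_,
    Eventually.of_forall fun z => F.torusHom_chart l s z⟩
  exact AnalyticAt.pi fun e => analyticAt_const.mul
    ((ContinuousLinearMap.proj (R := ℂ) (φ := fun _ : s.1 => ℂ) e).analyticAt _)

theorem torus_le_torusNormalizer : F.torus ≤ F.torusNormalizer := by
  refine le_inf ?_ Subgroup.le_normalizer
  rintro _ ⟨l, rfl⟩
  exact ⟨F.isHolomorphic_torusHom l, F.isHolomorphic_torusHom l⁻¹⟩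

/-- Every element of `N(T)` may be moved by the torus into the stabilizer of `x₀`, without changing
its action on `N`. -/
theorem exists_mem_pointedWeyl {Y₀ : Fin n → ℂ} {f : Equiv.Perm F.Variety}
    (hf : f ∈ F.torusNormalizer) :
    ∃ f' ∈ F.pointedWeyl (F.expPoint Y₀), ∃ (A : Matrix (Fin n) (Fin n) ℤ) (b : Fin n → ℂ),
      (∀ Y, f' (F.expPoint Y) = F.expPoint (b + (A.map (Int.cast : ℤ → ℂ)).mulVec Y)) ∧
      ∀ l l', f * F.torusHom l * f⁻¹ = F.torusHom l' →
        F.logMap l' = (A.map (Int.cast : ℤ → ℝ)).mulVec (F.logMap l) := by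
  obtain ⟨A, b, hA⟩ := exists_affine_of_mem_torusNormalizer hf
  obtain ⟨l, hl⟩ := F.exists_units_unitsLog
    (Y₀ - (b + (A.map (Int.cast : ℤ → ℂ)).mulVec Y₀))
  have hAl : ∀ Y, (F.torusHom l * f) (F.expPoint Y) =
      F.expPoint (b + F.unitsLog l + (A.map (Int.cast : ℤ → ℂ)).mulVec Y) := by
    intro Y
    rw [Equiv.Perm.mul_apply, hA, torusHom_expPoint, add_right_comm]
  refine ⟨F.torusHom l * f, ⟨F.torusNormalizer.mul_mem (F.torus_le_torusNormalizer ⟨l, rfl⟩) hf,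
    MulAction.mem_stabilizer_iff.2 ?_⟩, A, b + F.unitsLog l, hAl,
    fun k k' h => logMap_eq_of_conj hA h⟩
  rw [Equiv.Perm.smul_def, Equiv.Perm.mul_apply, hA,
    torusHom_expPoint, F.expPoint_add_congr hl, add_sub_cancel]

/-- The point of `N ⊗ ℂ` over `y ∈ N_ℝ`, relative to a base point; the factor `-1/2` matches the
pluripotential conventions with those of `realPotential`. -/
noncomputable def realPoint (Y₀ : Fin n → ℂ) (y : Fin n → ℝ) : Fin n → ℂ :=
  Y₀ + (-(1 / 2) : ℂ) • fun i => (y i : ℂ)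

theorem realPoint_mulVec (Y₀ b : Fin n → ℂ) (A : Matrix (Fin n) (Fin n) ℤ) (y : Fin n → ℝ)
    (h : F.expPoint (b + (A.map (Int.cast : ℤ → ℂ)).mulVec Y₀) = F.expPoint Y₀) :
    F.expPoint (realPoint Y₀ ((A.map (Int.cast : ℤ → ℝ)).mulVec y)) =
      F.expPoint (b + (A.map (Int.cast : ℤ → ℂ)).mulVec (realPoint Y₀ y)) := by
  rw [expPoint_eq_iff] at h ⊢
  intro i
  have h1 := h i
  rw [Pi.add_apply, Complex.exp_add] at h1
  rw [realPoint, realPoint, Matrix.mulVec_add, Matrix.mulVec_smul]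
  simp only [Pi.add_apply, Complex.exp_add, Pi.smul_apply, smul_eq_mul]
  rw [← h1, mul_assoc]
  congr 3
  simp [Matrix.mulVec, dotProduct]

namespace KahlerMetric

variable {F}
variable {g : F.KahlerMetric} {Φ : F.Variety → ℝ} {x₀ : F.Variety}

/-- Logarithms of the same point have equal real parts, so they differ by an imaginary translation,
under which `u` is invariant. -/
theorem logPotential_congr (hΦ : IsCk ⊤ Φ)
    (hg : ∀ s z, g.ricci s z - g.coeff s z = complexHessian (fun w => Φ (F.chart s w)) z)
    (hG : g.IsInvariant (F.compactGroup x₀)) {Y W : Fin n → ℂ} (h : F.expPoint Y = F.expPoint W) :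
    g.logPotential Φ Y = g.logPotential Φ W := by
  rw [← logPotential_add_imag hΦ hg hG W fun i => (Y i - W i).im]
  congr 1
  funext i
  have h1 := congrArg (fun z => ‖z‖) (F.expPoint_eq_iff.1 h i)
  simp only [Complex.norm_exp, Real.exp_eq_exp] at h1
  apply Complex.ext <;> simp [h1]

/-- The plurisubharmonic function `u + φ` restricts to a convex function on `N_ℝ`. -/
theorem convexOn_logPotential_add (hΦ : IsCk ⊤ Φ)
    (hg : ∀ s z, g.ricci s z - g.coeff s z = complexHessian (fun w => Φ (F.chart s w)) z)
    (hG : g.IsInvariant (F.compactGroup x₀)) {φ : F.Variety → ℝ} (hφ : IsCk 2 φ)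
    (hinv : ∀ f ∈ F.compactGroup x₀, ∀ x, φ (f x) = φ x)
    (hpos : ∀ s z, (g.coeff s z + complexHessian (fun w => φ (F.chart s w)) z).PosSemidef)
    (Y₀ : Fin n → ℂ) :
    ConvexOn ℝ Set.univ fun y =>
      g.logPotential Φ (realPoint Y₀ y) + φ (F.expPoint (realPoint Y₀ y)) := by
  have hφE : ∀ Y, φ (F.expPoint Y) =
      φ (F.chart (Classical.choice F.exists_maxCone) (F.expCoord _ Y)) := fun Y => rfl
  set s := Classical.choice F.exists_maxCone
  have hc2 : ContDiff ℝ 2 fun z => φ (F.chart s z) := hφ s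
  have hu : ContDiff ℝ 2 (g.logPotential Φ) := contDiff_logPotential hΦ
  have hv : ContDiff ℝ 2 fun Y => φ (F.expPoint Y) := hc2.comp (F.contDiff_expCoord s)
  have huv : ContDiff ℝ 2 fun Y => g.logPotential Φ Y + φ (F.expPoint Y) := hu.add hv
  have hH : ∀ Y, (complexHessian (fun Y => g.logPotential Φ Y + φ (F.expPoint Y)) Y).PosSemidef := by
    intro Y
    have h1 : complexHessian (fun Y => φ (F.expPoint Y)) Y = _ :=
      complexHessian_comp (φ := fun z => φ (F.chart s z)) hc2.contDiffAt (F.analyticAt_expCoord s Y)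
    rw [complexHessian_add hu hv, complexHessian_logPotential hΦ hg, h1, ← g.chartLogCoeff_eq s,
      chartLogCoeff, ← Matrix.add_mul, ← Matrix.mul_add]
    exact (hpos s _).mul_mul_conjTranspose_same _
  let A : Matrix (Fin n) (Fin n) ℂ := (-(1 / 2) : ℂ) • 1
  have hA : ∀ Z, A.mulVec Z = (-(1 / 2) : ℂ) • Z := fun Z => by
    rw [Matrix.smul_mulVec, Matrix.one_mulVec]
  have haff : ContDiff ℝ 2 fun Y => Y₀ + A.mulVec Y :=
    contDiff_const.add ((LinearMap.toContinuousLinearMap A.mulVecLin).restrictScalars ℝ).contDiff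
  have h2 := convexOn_of_complexHessian_posSemidef
    (φ := fun Z => g.logPotential Φ (Y₀ + A.mulVec Z) + φ (F.expPoint (Y₀ + A.mulVec Z)))
    (huv.comp haff) (fun Z => ?_) (fun Z θ => ?_)
  · simp only [hA] at h2
    exact h2
  · have h3 := complexHessian_comp (h := fun Z => Y₀ + A.mulVec Z) (z := Z) huv.contDiffAt
      (A.analyticAt_affine Y₀ Z)
    rw [h3]
    exact (hH _).mul_mul_conjTranspose_same _
  · have h4 : Y₀ + A.mulVec (Z + fun i => (θ i : ℂ) * Complex.I) =
        (Y₀ + A.mulVec Z) + fun i => ((-(1 / 2) * θ i : ℝ) : ℂ) * Complex.I := by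
      rw [hA, hA, smul_add, add_assoc]
      congr 2
      funext i
      simp [mul_assoc]
    rw [h4, logPotential_add_imag hΦ hg hG]
    obtain ⟨f, hf, h⟩ := F.exists_mem_compactTorus fun i => (-(1 / 2) * θ i : ℝ)
    rw [← h, hinv f (Subgroup.mem_sup_left hf)]

theorem exists_abs_logPotential_realPoint_sub_le (hΦ : IsCk ⊤ Φ) (Y₀ : Fin n → ℂ) :
    ∃ B, ∀ s y, (∀ e, 0 ≤ F.logCoord s y e) →
      |g.logPotential Φ (realPoint Y₀ y) - ∑ e, F.logCoord s y e| ≤ B := by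
  -- For `y` in the cone of `s`, the real chart logarithms of `realPoint Y₀ y` are those of `Y₀`
  -- minus nonnegative numbers, hence at most `r`. The shift of the asymptotics caused by `Y₀` is
  -- absorbed in `R`.
  obtain ⟨r, hr⟩ := (Set.finite_range fun p : Σ s : F.maxCones, s.1 =>
    (F.logCoord p.1 Y₀ p.2).re).bddAbove
  obtain ⟨R, hR⟩ := (Set.finite_range fun s : F.maxCones =>
    |2 * ∑ e, (F.logCoord s Y₀ e).re|).bddAbove
  obtain ⟨B, hB⟩ := exists_abs_logPotential_add_le (g := g) hΦ r
  have hre : ∀ s y e, (F.logCoord s (realPoint Y₀ y) e).re =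
      (F.logCoord s Y₀ e).re - F.logCoord s y e / 2 := by
    intro s y e
    rw [realPoint, logCoord_add, Pi.add_apply, Complex.add_re, F.re_logCoord s (_ • _), sub_eq_add_neg]
    congr 1
    rw [show (fun i => (((-(1 / 2) : ℂ) • fun i => (y i : ℂ)) i).re) = (-(1 / 2) : ℝ) • y by
      funext i
      simp only [Pi.smul_apply, smul_eq_mul]
      rw [show (-(1 / 2) : ℂ) = ((-(1 / 2) : ℝ) : ℂ) by push_cast; ring, ← Complex.ofReal_mul,
        Complex.ofReal_re], logCoord_smul, Pi.smul_apply, smul_eq_mul]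
    ring
  refine ⟨B + R, fun s y hy => ?_⟩
  have h1 := hB s (realPoint Y₀ y) fun e => by
    rw [hre]
    have := hr ⟨⟨s, e⟩, rfl⟩
    have := hy e
    simp only at *
    linarith
  have h2 := hR ⟨s, rfl⟩
  simp only at h2
  have h3 : ∑ e, (F.logCoord s (realPoint Y₀ y) e).re =
      ∑ e, (F.logCoord s Y₀ e).re - (∑ e, F.logCoord s y e) / 2 := by
    simp only [hre, Finset.sum_sub_distrib, Finset.sum_div]
  rw [h3] at h1
  have h4 := abs_le.1 h1
  have h5 := abs_le.1 h2
  exact abs_le.2 ⟨by linarith, by linarith⟩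

end KahlerMetric

end RegularFan

/-! ## Comparison with the real potential -/

namespace RegularFan

variable {n : ℕ} (F : RegularFan n)

theorem sum_mul_eq_sum_logCoord (s : F.maxCones) (v : Fin n → ℤ) (y : Fin n → ℝ) :
    ∑ i, (v i : ℝ) * y i = ∑ e : s.1, F.logCoord s y e * ((v ⬝ᵥ (e : Fin n → ℤ) : ℤ) : ℝ) := by
  conv_lhs =>
    enter [2, i]
    rw [← F.sum_logCoord_mul s y i]
  simp only [dotProduct, Int.cast_sum, Int.cast_mul, Finset.mul_sum]
  rw [Finset.sum_comm]
  exact Finset.sum_congr rfl fun e _ => Finset.sum_congr rfl fun i _ => by ring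

/-- The element of `M` which is `1` on every generator of a maximal cone. -/
noncomputable def coneVertex (s : F.maxCones) (i : Fin n) : ℤ := ∑ e : s.1, F.coneCoord s e i

theorem sum_coneVertex_mul (s : F.maxCones) (y : Fin n → ℝ) :
    ∑ i, (F.coneVertex s i : ℝ) * y i = ∑ e, F.logCoord s y e := by
  simp only [coneVertex, logCoord, Int.cast_sum, Finset.sum_mul]
  rw [Finset.sum_comm]

variable {F} {g : F.KahlerMetric} {Φ : F.Variety → ℝ} {x₀ : F.Variety}

theorem le_of_forall_mul_le {a b C : ℝ} (h : ∀ t : ℝ, 0 ≤ t → t * a ≤ t * b + C) : a ≤ b := by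
  by_contra hab
  have hab' : 0 < a - b := by linarith
  have h1 := h ((|C| + 1) / (a - b)) (by positivity)
  have h2 : (|C| + 1) / (a - b) * (a - b) = |C| + 1 := div_mul_cancel₀ _ hab'.ne'
  have h3 := le_abs_self C
  nlinarith

/-- The piecewise linear function `∑ e, logCoord s y e` takes the value `1` at every ray generator.
-/
theorem exists_logCoord_ray (ρ : F.rays) : ∃ s : F.maxCones,
    (∀ e, 0 ≤ F.logCoord s (fun i => (((ρ : Fin n → ℤ) i : ℤ) : ℝ)) e) ∧
      ∑ e, F.logCoord s (fun i => (((ρ : Fin n → ℤ) i : ℤ) : ℝ)) e = 1 := by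
  obtain ⟨s, hs⟩ := F.exists_maxCone_of_ray ρ
  have h1 : F.logCoord s (fun i => (((ρ : Fin n → ℤ) i : ℤ) : ℝ)) =
      fun e => if e = ⟨ρ, hs⟩ then 1 else 0 := by
    funext e
    have := congrArg (Int.cast : ℤ → ℝ) (F.sum_mul_coneCoord_int s e ⟨ρ, hs⟩)
    push_cast at this
    exact this
  refine ⟨s, fun e => ?_, ?_⟩
  · rw [h1]; dsimp only; split_ifs <;> norm_num
  · rw [h1]; simp

/-- The vertices given by the maximal cones lie in `Δ`: this is the convexity of the support
function of the anticanonical divisor, deduced from the positivity of `c₁(X)`. -/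
theorem coneVertex_mem_latticePoints (hΦ : IsCk ⊤ Φ)
    (hg : ∀ s z, g.ricci s z - g.coeff s z = complexHessian (fun w => Φ (F.chart s w)) z)
    (hG : g.IsInvariant (F.compactGroup x₀)) (s : F.maxCones) :
    F.coneVertex s ∈ F.latticePoints := by
  intro ρ hρ
  set p : Fin n → ℝ := fun i => ((ρ i : ℤ) : ℝ) with hp
  suffices h : ∑ e, F.logCoord s p e ≤ 1 by
    rw [← F.sum_coneVertex_mul] at h
    have h' : ((F.coneVertex s ⬝ᵥ ρ : ℤ) : ℝ) ≤ 1 := by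
      simpa [dotProduct, hp] using h
    exact_mod_cast h'
  obtain ⟨s', hs', hs1⟩ := F.exists_logCoord_ray ⟨ρ, hρ⟩
  obtain ⟨B, hB⟩ := KahlerMetric.exists_abs_logPotential_realPoint_sub_le (g := g) hΦ 0
  have hconv := KahlerMetric.convexOn_logPotential_add (φ := fun _ => 0) hΦ hg hG
    (fun s => contDiff_const) (fun _ _ _ => rfl) (fun s z => by
      have h0 : complexHessian (fun _ : s.1 → ℂ => (0 : ℝ)) z = 0 := by
        have := complexHessian_affine (ι := s.1) 0 0 z
        simpa using this
      rw [h0, add_zero]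
      exact (g.posDef s z).posSemidef) 0
  simp only [add_zero] at hconv
  set c := F.logCoord s p with hc
  set S := ∑ e, |c e|
  have hS0 : 0 ≤ S := Finset.sum_nonneg fun e _ => abs_nonneg _
  -- Small enough that moving from the sum `y₀` of the generators of `s` a fraction `ε` of the way
  -- towards `p` stays inside the cone of `s`, where the asymptotics of `u` are known.
  set ε : ℝ := 1 / (1 + S) with hε
  have hε0 : 0 < ε := by positivity
  have hε1 : ε * (1 + S) = 1 := by rw [hε]; field_simp
  let y₀ : Fin n → ℝ := fun i => ∑ e : s.1, (1 : ℝ) * ((e : Fin n → ℤ) i : ℝ)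
  have hy₀ : F.logCoord s y₀ = fun _ => 1 := F.logCoord_sum_mul s fun _ => (1 : ℝ)
  have hεS : 0 ≤ 1 - ε := by nlinarith
  -- Convexity of `u` on the segment from `t y₀` to `t p`, with `u` replaced by its asymptotics at
  -- the three points. The error `2 * B` does not depend on `t`, so it drops out as `t` grows.
  have key : ∀ t : ℝ, 0 ≤ t →
      t * (∑ e, ((1 - ε) + ε * c e)) ≤ t * ((1 - ε) * ∑ e : s.1, (1 : ℝ) + ε * 1) + 2 * B := by
    intro t ht
    have h1 := hconv.2 (Set.mem_univ (t • y₀)) (Set.mem_univ (t • p)) hεS hε0.le (by ring)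
    have e1 : F.logCoord s ((1 - ε) • (t • y₀) + ε • (t • p)) =
        fun e => t * ((1 - ε) + ε * c e) := by
      rw [logCoord_add, logCoord_smul, logCoord_smul, logCoord_smul, logCoord_smul, hy₀, ← hc]
      funext e
      simp only [Pi.add_apply, Pi.smul_apply, smul_eq_mul]
      ring
    have h2 := abs_le.1 (hB s ((1 - ε) • (t • y₀) + ε • (t • p)) fun e => by
      rw [e1]
      refine mul_nonneg ht ?_
      have h3 : |c e| ≤ S := Finset.single_le_sum (f := fun e => |c e|)
        (fun e _ => abs_nonneg _) (Finset.mem_univ e)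
      have h4 := neg_abs_le (c e)
      nlinarith)
    have h3 := abs_le.1 (hB s (t • y₀) fun e => by
      rw [logCoord_smul, hy₀]; simpa using ht)
    have h4 := abs_le.1 (hB s' (t • p) fun e => by
      rw [logCoord_smul]; exact mul_nonneg ht (hs' e))
    rw [e1, ← Finset.mul_sum] at h2
    rw [logCoord_smul, hy₀] at h3
    rw [logCoord_smul] at h4
    simp only [Pi.smul_apply, smul_eq_mul, ← Finset.mul_sum] at h1 h3 h4
    rw [hs1] at h4
    have h5 := mul_le_mul_of_nonneg_left h3.2 hεS
    have h6 := mul_le_mul_of_nonneg_left h4.2 hε0.le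
    nlinarith
  have h1 := le_of_forall_mul_le key
  rw [Finset.sum_add_distrib, ← Finset.mul_sum, ← mul_one (1 - ε), ← Finset.mul_sum] at h1
  have h2 : ε * ∑ e, c e ≤ ε * 1 := by simpa using h1
  exact le_of_mul_le_mul_left h2 hε0

theorem exists_abs_realPotential_sub_le (hΦ : IsCk ⊤ Φ)
    (hg : ∀ s z, g.ricci s z - g.coeff s z = complexHessian (fun w => Φ (F.chart s w)) z)
    (hG : g.IsInvariant (F.compactGroup x₀)) (Y₀ : Fin n → ℂ) :
    ∃ B, ∀ y, |g.logPotential Φ (realPoint Y₀ y) - F.realPotential y| ≤ B := by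
  obtain ⟨B, hB⟩ := KahlerMetric.exists_abs_logPotential_realPoint_sub_le (g := g) hΦ Y₀
  set L := F.latticePoints_finite.toFinset
  obtain ⟨s₀⟩ := F.exists_maxCone
  have hLpos : (1 : ℝ) ≤ L.card := by
    have : L.Nonempty := ⟨F.coneVertex s₀, F.latticePoints_finite.mem_toFinset.2
      (coneVertex_mem_latticePoints hΦ hg hG s₀)⟩
    exact_mod_cast this.card_pos
  refine ⟨B + Real.log L.card, fun y => ?_⟩
  obtain ⟨s, hs⟩ := F.exists_logCoord_nonneg y
  set T := ∑ e, F.logCoord s y e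
  -- On the cone of `s` the largest exponent in `ũ` is `T`, attained at `coneVertex s`. So `ũ` lies
  -- between `T` and `T + log |L|`.
  have h1 : T ≤ F.realPotential y := by
    rw [realPotential, Real.le_log_iff_exp_le]
    · have := Finset.single_le_sum (f := fun v : Fin n → ℤ => Real.exp (∑ i, (v i : ℝ) * y i))
        (fun v _ => (Real.exp_pos _).le) (F.latticePoints_finite.mem_toFinset.2
          (coneVertex_mem_latticePoints hΦ hg hG s))
      simp only [F.sum_coneVertex_mul] at this
      exact this
    · exact Finset.sum_pos (fun v _ => Real.exp_pos _) (Finset.card_pos.1 (by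
        exact_mod_cast lt_of_lt_of_le one_pos hLpos))
  have h2 : F.realPotential y ≤ T + Real.log L.card := by
    have h3 : ∑ v ∈ L, Real.exp (∑ i, (v i : ℝ) * y i) ≤ L.card * Real.exp T := by
      rw [← nsmul_eq_mul]
      refine Finset.sum_le_card_nsmul _ _ _ fun v hv => Real.exp_le_exp.2 ?_
      rw [F.sum_mul_eq_sum_logCoord s]
      refine Finset.sum_le_sum fun e _ => ?_
      have h4 : ((v ⬝ᵥ (e : Fin n → ℤ) : ℤ) : ℝ) ≤ 1 := by
        exact_mod_cast F.latticePoints_finite.mem_toFinset.1 hv e (F.mem_rays s.2 e.2)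
      have := hs e
      nlinarith
    rw [realPotential]
    calc _ ≤ Real.log (L.card * Real.exp T) := by
          refine Real.log_le_log (Finset.sum_pos (fun v _ => Real.exp_pos _) (Finset.card_pos.1 (by
            exact_mod_cast lt_of_lt_of_le one_pos hLpos))) h3
      _ = _ := by
          rw [Real.log_mul (by linarith) (Real.exp_pos _).ne', Real.log_exp, add_comm]
  have h5 := abs_le.1 (hB s y hs)
  have h6 : 0 ≤ Real.log L.card := Real.log_nonneg hLpos
  exact abs_le.2 ⟨by linarith, by linarith⟩

/-- Lattice points of `Δ` in terms of the growth of the potential. -/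
theorem mem_latticePoints_iff (hΦ : IsCk ⊤ Φ) (Y₀ : Fin n → ℂ) (v : Fin n → ℤ) :
    v ∈ F.latticePoints ↔
      ∃ C, ∀ y, ∑ i, (v i : ℝ) * y i ≤ g.logPotential Φ (realPoint Y₀ y) + C := by
  obtain ⟨B, hB⟩ := KahlerMetric.exists_abs_logPotential_realPoint_sub_le (g := g) hΦ Y₀
  constructor
  · refine fun hv => ⟨B, fun y => ?_⟩
    obtain ⟨s, hs⟩ := F.exists_logCoord_nonneg y
    have h1 := abs_le.1 (hB s y hs)
    have h2 : ∑ i, (v i : ℝ) * y i ≤ ∑ e, F.logCoord s y e := by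
      rw [F.sum_mul_eq_sum_logCoord s]
      refine Finset.sum_le_sum fun e _ => ?_
      have h4 : ((v ⬝ᵥ (e : Fin n → ℤ) : ℤ) : ℝ) ≤ 1 := by
        exact_mod_cast hv e (F.mem_rays s.2 e.2)
      have := hs e
      nlinarith
    linarith
  · rintro ⟨C, hC⟩ ρ hρ
    obtain ⟨s, hs, hs1⟩ := F.exists_logCoord_ray ⟨ρ, hρ⟩
    have h1 : ((v ⬝ᵥ ρ : ℤ) : ℝ) ≤ 1 := by
      refine le_of_forall_mul_le (C := B + C) fun t ht => ?_
      have h2 := hC (t • fun i => ((ρ i : ℤ) : ℝ))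
      have h3 := abs_le.1 (hB s (t • fun i => ((ρ i : ℤ) : ℝ)) fun e => by
        rw [logCoord_smul]; exact mul_nonneg ht (hs e))
      rw [logCoord_smul] at h3
      simp only [Pi.smul_apply, smul_eq_mul, ← Finset.mul_sum] at h3 h2
      rw [hs1] at h3
      have h4 : ∑ i, (v i : ℝ) * (t * (ρ i : ℝ)) = t * ((v ⬝ᵥ ρ : ℤ) : ℝ) := by
        simp only [dotProduct, Int.cast_sum, Int.cast_mul, Finset.mul_sum]
        exact Finset.sum_congr rfl fun i _ => by ring
      rw [h4] at h2
      linarith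
    exact_mod_cast h1

/-- Lattice points of `Δ` are those whose linear form is bounded above by `u` plus a constant. As
`u` is invariant, the transpose of `A` maps this finite set injectively into itself, hence permutes
the summands of `ũ`. -/
theorem realPotential_mulVec (hΦ : IsCk ⊤ Φ) {Y₀ : Fin n → ℂ}
    {A : Matrix (Fin n) (Fin n) ℤ} (hA : A.det ≠ 0)
    (hu : ∀ y, g.logPotential Φ (realPoint Y₀ ((A.map (Int.cast : ℤ → ℝ)).mulVec y)) =
      g.logPotential Φ (realPoint Y₀ y)) (y : Fin n → ℝ) :
    F.realPotential ((A.map (Int.cast : ℤ → ℝ)).mulVec y) = F.realPotential y := by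
  have hpair : ∀ (v : Fin n → ℤ) (y : Fin n → ℝ),
      ∑ i, (v i : ℝ) * (A.map (Int.cast : ℤ → ℝ)).mulVec y i =
        ∑ i, ((A.transpose.mulVec v i : ℤ) : ℝ) * y i := by
    intro v y
    simp only [Matrix.mulVec, dotProduct, Matrix.map_apply, Matrix.transpose_apply, Int.cast_sum,
      Int.cast_mul, Finset.mul_sum, Finset.sum_mul]
    rw [Finset.sum_comm]
    exact Finset.sum_congr rfl fun i _ => Finset.sum_congr rfl fun j _ => by ring
  have hinj : Function.Injective A.transpose.mulVec := by
    intro v w h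
    rw [← sub_eq_zero, ← Matrix.mulVec_sub] at h
    exact sub_eq_zero.1 (Matrix.eq_zero_of_mulVec_eq_zero (by rwa [Matrix.det_transpose]) h)
  set L := F.latticePoints_finite.toFinset with hL
  have hmem : ∀ v, v ∈ L ↔ v ∈ F.latticePoints := fun v => F.latticePoints_finite.mem_toFinset
  have hmaps : ∀ v ∈ L, A.transpose.mulVec v ∈ L := by
    intro v hv
    rw [hmem, mem_latticePoints_iff (g := g) hΦ Y₀] at hv ⊢
    obtain ⟨C, hC⟩ := hv
    refine ⟨C, fun y => ?_⟩
    rw [← hpair, ← hu]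
    exact hC _
  have himage : L.image A.transpose.mulVec = L :=
    Finset.eq_of_subset_of_card_le (Finset.image_subset_iff.2 hmaps)
      (Finset.card_image_of_injective L hinj).ge
  rw [realPotential, realPotential, ← hL]
  congr 1
  conv_rhs => rw [← himage]
  rw [Finset.sum_image fun v _ w _ h => hinj h]
  exact Finset.sum_congr rfl fun v _ => by rw [hpair]

theorem contDiff_realPotential (hne : F.latticePoints.Nonempty) :
    ContDiff ℝ 2 F.realPotential := by
  unfold realPotential
  refine ContDiff.log ?_ fun y => ?_
  · fun_prop
  · exact (Finset.sum_pos (fun v _ => Real.exp_pos _)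
      (F.latticePoints_finite.toFinset_nonempty.2 hne)).ne'

end RegularFan

/-! ## Integration in logarithmic coordinates -/

section LogCoordinates

theorem map_re_restrict_strip :
    (volume.restrict {w : ℂ | w.im ∈ Set.Ioc (-Real.pi) Real.pi}).map Complex.re =
      (2 * Real.pi).toNNReal • (volume : Measure ℝ) := by
  ext A hA
  have hS : MeasurableSet {w : ℂ | w.im ∈ Set.Ioc (-Real.pi) Real.pi} :=
    Complex.measurable_im measurableSet_Ioc
  rw [Measure.map_apply Complex.measurable_re hA,
    Measure.restrict_apply (Complex.measurable_re hA)]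
  have h1 : Complex.re ⁻¹' A ∩ {w : ℂ | w.im ∈ Set.Ioc (-Real.pi) Real.pi} =
      Complex.measurableEquivRealProd ⁻¹' (A ×ˢ Set.Ioc (-Real.pi) Real.pi) := by
    ext w; simp [Complex.measurableEquivRealProd_apply]
  rw [h1, Complex.volume_preserving_equiv_real_prod.measure_preimage
    (hA.prod measurableSet_Ioc).nullMeasurableSet, Measure.volume_eq_prod, Measure.prod_prod,
    Real.volume_Ioc, Measure.smul_apply, mul_comm]
  rw [show Real.pi - -Real.pi = 2 * Real.pi by ring]
  rfl

variable {ι : Type*} [Fintype ι]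

theorem pi_smul_volume (c : ℝ≥0) :
    Measure.pi (fun _ : ι => c • (volume : Measure ℝ)) = c ^ Fintype.card ι • volume := by
  refine Measure.pi_eq fun s _ => ?_
  rw [Measure.smul_apply, volume_pi_pi]
  simp only [Measure.smul_apply, ENNReal.smul_def, smul_eq_mul, Finset.prod_mul_distrib,
    Finset.prod_const, Finset.card_univ, ENNReal.coe_pow]

/-- The real determinant of multiplication by `c` is the norm of `ℂ` over `ℝ`. -/
theorem det_smul_id_complex (c : ℂ) :
    ((c • ContinuousLinearMap.id ℂ ℂ).restrictScalars ℝ : ℂ →L[ℝ] ℂ).det = ‖c‖ ^ 2 := by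
  rw [← Complex.normSq_eq_norm_sq, ← Algebra.norm_complex_apply, Algebra.norm_apply,
    ContinuousLinearMap.det]
  congr 1

/-- Integration in logarithmic coordinates of a function which only depends on absolute values. -/
theorem lintegral_prod_norm_mul_log {N : (ι → ℝ) → ℝ≥0∞} (hN : Measurable N) :
    ∫⁻ z : ι → ℂ, ENNReal.ofReal (∏ i, (‖z i‖ ^ 2)⁻¹) * N (fun i => Real.log ‖z i‖) =
      ((2 * Real.pi).toNNReal ^ Fintype.card ι : ℝ≥0) * ∫⁻ x, N x := by
  classical
  -- A fundamental strip for `exp`: coordinatewise, `exp` is injective on its power and has conull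
  -- image. The Jacobian cancels the weight, and each angle contributes a factor `2π`.
  set S₁ : Set ℂ := {w | w.im ∈ Set.Ioc (-Real.pi) Real.pi}
  have hS₁m : MeasurableSet S₁ := Complex.measurable_im measurableSet_Ioc
  set S : Set (ι → ℂ) := Set.univ.pi fun _ => S₁ with hS
  have hSm : MeasurableSet S := MeasurableSet.univ_pi fun _ => hS₁m
  let E : (ι → ℂ) → (ι → ℂ) := fun w i => Complex.exp (w i)
  let E' : (ι → ℂ) → ((ι → ℂ) →L[ℝ] (ι → ℂ)) := fun w => ContinuousLinearMap.pi fun i =>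
    ((Complex.exp (w i) • ContinuousLinearMap.id ℂ ℂ).restrictScalars ℝ : ℂ →L[ℝ] ℂ).comp
      (ContinuousLinearMap.proj i)
  have hE' : ∀ w, HasFDerivAt E (E' w) w := by
    intro w
    refine hasFDerivAt_pi.2 fun i => ?_
    have h1 : HasFDerivAt Complex.exp
        ((Complex.exp (w i) • ContinuousLinearMap.id ℂ ℂ).restrictScalars ℝ : ℂ →L[ℝ] ℂ) (w i) := by
      refine ((Complex.hasDerivAt_exp (w i)).hasFDerivAt.restrictScalars ℝ).congr_fderiv ?_
      exact ContinuousLinearMap.ext fun x => by simp [mul_comm]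
    exact h1.comp w (hasFDerivAt_apply i w)
  have hdet : ∀ w, (E' w).det = ∏ i, ‖Complex.exp (w i)‖ ^ 2 := by
    intro w
    simp only [E', ContinuousLinearMap.det_pi, det_smul_id_complex]
  have hinj : Set.InjOn E S := by
    intro w hw v hv h
    funext i
    have h1 := congrFun h i
    exact Complex.exp_inj_of_neg_pi_lt_of_le_pi (hw i trivial).1 (hw i trivial).2
      (hv i trivial).1 (hv i trivial).2 h1
  have himage : E '' S = Set.univ.pi fun _ => ({0}ᶜ : Set ℂ) := by
    ext z
    constructor
    · rintro ⟨w, -, rfl⟩ i _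
      exact Complex.exp_ne_zero _
    · intro hz
      refine ⟨fun i => Complex.log (z i), fun i _ => ⟨Complex.neg_pi_lt_log_im _,
        Complex.log_im_le_pi _⟩, funext fun i => Complex.exp_log (hz i trivial)⟩
  have hae : E '' S =ᵐ[volume] (Set.univ : Set (ι → ℂ)) := by
    rw [himage, ← Set.pi_univ Set.univ, volume_pi]
    refine Measure.ae_eq_set_pi fun i _ => ?_
    exact eventuallyEq_univ.2 (compl_mem_ae_iff.2 (measure_singleton 0))
  rw [← setLIntegral_univ, ← setLIntegral_congr hae,
    lintegral_image_eq_lintegral_abs_det_fderiv_mul volume hSm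
      (fun w _ => (hE' w).hasFDerivWithinAt) hinj]
  have h2 : ∀ w, ENNReal.ofReal |(E' w).det| * (ENNReal.ofReal (∏ i, (‖E w i‖ ^ 2)⁻¹) *
      N (fun i => Real.log ‖E w i‖)) = N fun i => (w i).re := by
    intro w
    have hpos : 0 < ∏ i, ‖Complex.exp (w i)‖ ^ 2 :=
      Finset.prod_pos fun i _ => by
        have := norm_pos_iff.2 (Complex.exp_ne_zero (w i)); positivity
    rw [hdet, abs_of_pos hpos, ← mul_assoc, ← ENNReal.ofReal_mul hpos.le, Finset.prod_inv_distrib,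
      mul_inv_cancel₀ hpos.ne', ENNReal.ofReal_one, one_mul]
    simp only [E, Complex.norm_exp, Real.log_exp]
  simp only [h2]
  have h3 : (volume : Measure (ι → ℂ)).restrict S =
      Measure.pi fun _ => (volume : Measure ℂ).restrict S₁ := by
    rw [volume_pi, hS, Measure.restrict_pi_pi]
  have hre : Measurable fun (w : ι → ℂ) (i : ι) => (w i).re :=
    measurable_pi_lambda _ fun i => Complex.measurable_re.comp (measurable_pi_apply i)
  rw [← lintegral_map hN hre, h3]
  have : ∀ _ : ι, SigmaFinite ((volume.restrict S₁).map Complex.re) := fun _ => by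
    rw [map_re_restrict_strip]; infer_instance
  rw [Measure.pi_map_pi (hμ := this) (f := fun _ => Complex.re) fun _ => Complex.measurable_re.aemeasurable,
    map_re_restrict_strip, pi_smul_volume, lintegral_smul_measure]
  rfl

/-- The image of Lebesgue measure under `L` is translation invariant, hence a multiple of Lebesgue
measure by uniqueness of Haar measure. -/
theorem exists_lintegral_comp_affine {κ : Type*} [Fintype κ] (L : (ι → ℝ) ≃L[ℝ] (κ → ℝ))
    (c : κ → ℝ) : ∃ C : ℝ≥0, ∀ N : (κ → ℝ) → ℝ≥0∞, Measurable N →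
      ∫⁻ x, N (c + L x) = C * ∫⁻ y, N y := by
  obtain ⟨C, h⟩ : ∃ C : ℝ≥0, (volume : Measure (ι → ℝ)).map L = C • (volume : Measure (κ → ℝ)) :=
    ⟨_, Measure.isAddLeftInvariant_eq_smul _ _⟩
  refine ⟨C, fun N hN => ?_⟩
  have hN' : Measurable fun y => N (c + y) := hN.comp (measurable_const_add c)
  rw [← lintegral_map hN' L.continuous.measurable, h, lintegral_smul_measure,
    lintegral_add_left_eq_self]
  rfl

end LogCoordinates

/-! ## From potentials on `X` to potentials on `N_ℝ` -/

namespace RegularFan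

variable {n : ℕ} {F : RegularFan n}

theorem contDiff_realPoint {k : WithTop ℕ∞} (Y₀ : Fin n → ℂ) : ContDiff ℝ k (realPoint Y₀) := by
  refine contDiff_pi.2 fun i => ?_
  simp only [realPoint, Pi.add_apply, Pi.smul_apply, smul_eq_mul]
  refine contDiff_const.add (contDiff_const.mul ?_)
  exact Complex.ofRealCLM.contDiff.comp (contDiff_apply ℝ ℝ i)

theorem eq_realPoint_add (Y₀ Y : Fin n → ℂ) :
    Y = realPoint Y₀ (fun i => 2 * (Y₀ i).re + -2 * (Y i).re) +
      fun i => (((Y i).im - (Y₀ i).im : ℝ) : ℂ) * Complex.I := by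
  funext i
  apply Complex.ext
  · simp only [realPoint, Pi.add_apply, Pi.smul_apply, smul_eq_mul, Complex.add_re]
    rw [show (-(1 / 2) : ℂ) = ((-(1 / 2) : ℝ) : ℂ) by push_cast; ring, ← Complex.ofReal_mul,
      Complex.ofReal_re, Complex.re_ofReal_mul, Complex.I_re]
    ring
  · simp only [realPoint, Pi.add_apply, Pi.smul_apply, smul_eq_mul, Complex.add_im]
    rw [show (-(1 / 2) : ℂ) = ((-(1 / 2) : ℝ) : ℂ) by push_cast; ring, ← Complex.ofReal_mul,
      Complex.ofReal_im, Complex.im_ofReal_mul, Complex.I_im]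
    ring

namespace KahlerMetric

variable {g : F.KahlerMetric} {Φ : F.Variety → ℝ} {Y₀ : Fin n → ℂ}

/-- The restriction of `u - ũ + φ` to `N_ℝ`. -/
noncomputable def reducedPotential (g : F.KahlerMetric) (Φ : F.Variety → ℝ) (Y₀ : Fin n → ℂ)
    (φ : F.Variety → ℝ) (y : Fin n → ℝ) : ℝ :=
  g.logPotential Φ (realPoint Y₀ y) - F.realPotential y + φ (F.expPoint (realPoint Y₀ y))

theorem reducedPotential_mulVec (hΦ : IsCk ⊤ Φ)
    (hg : ∀ s z, g.ricci s z - g.coeff s z = complexHessian (fun w => Φ (F.chart s w)) z)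
    (hG : g.IsInvariant (F.compactGroup (F.expPoint Y₀))) {φ : F.Variety → ℝ}
    (hinv : ∀ f ∈ F.compactGroup (F.expPoint Y₀), ∀ x, φ (f x) = φ x)
    {f : Equiv.Perm F.Variety} (hf : f ∈ F.pointedWeyl (F.expPoint Y₀))
    {A : Matrix (Fin n) (Fin n) ℤ} {b : Fin n → ℂ}
    (hA : ∀ Y, f (F.expPoint Y) = F.expPoint (b + (A.map (Int.cast : ℤ → ℂ)).mulVec Y))
    (y : Fin n → ℝ) :
    g.reducedPotential Φ Y₀ φ ((A.map (Int.cast : ℤ → ℝ)).mulVec y) =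
      g.reducedPotential Φ Y₀ φ y := by
  have hfG : f ∈ F.compactGroup (F.expPoint Y₀) := Subgroup.mem_sup_right hf
  have hfix : F.expPoint (b + (A.map (Int.cast : ℤ → ℂ)).mulVec Y₀) = F.expPoint Y₀ := by
    rw [← hA]; exact MulAction.mem_stabilizer_iff.1 hf.2
  have hE : ∀ y, F.expPoint (realPoint Y₀ ((A.map (Int.cast : ℤ → ℝ)).mulVec y)) =
      F.expPoint (b + (A.map (Int.cast : ℤ → ℂ)).mulVec (realPoint Y₀ y)) := fun y =>
    F.realPoint_mulVec Y₀ b A y hfix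
  have hu : ∀ y, g.logPotential Φ (realPoint Y₀ ((A.map (Int.cast : ℤ → ℝ)).mulVec y)) =
      g.logPotential Φ (realPoint Y₀ y) := fun y => by
    rw [logPotential_congr hΦ hg hG (hE y), logPotential_affine hΦ hg hA (hG f hfG)]
  have hdet : A.det ≠ 0 := by
    have h1 := det_ne_zero_of_isPullbackInvariant hA (hG f hfG)
    intro h0
    refine h1 ?_
    have h2 := (Int.castRingHom ℂ).map_det A
    rw [h0, map_zero] at h2
    exact h2.symm
  rw [reducedPotential, reducedPotential, hu, realPotential_mulVec (g := g) hΦ hdet hu, hE, ← hA,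
    hinv f hfG]

/-- The potentials on `X` yield potentials on `N_ℝ`, up to uniformly bounded errors. -/
theorem exists_realPotential_sub_mem (hΦ : IsCk ⊤ Φ)
    (hg : ∀ s z, g.ricci s z - g.coeff s z = complexHessian (fun w => Φ (F.chart s w)) z)
    (hG : g.IsInvariant (F.compactGroup (F.expPoint Y₀))) :
    ∃ B, ∀ φ ∈ g.potentials (F.compactGroup (F.expPoint Y₀)), ∃ φ' ∈ F.realPotentials,
      ∀ Y, φ' (fun i => 2 * (Y₀ i).re + -2 * (Y i).re) ≤ φ (F.expPoint Y) + B ∧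
        F.realPotential (fun i => 2 * (Y₀ i).re + -2 * (Y i).re) ≤ g.logPotential Φ Y + B := by
  obtain ⟨B, hB⟩ := exists_abs_realPotential_sub_le hΦ hg hG Y₀
  have hB0 : 0 ≤ B := (abs_nonneg _).trans (hB 0)
  refine ⟨2 * B, fun φ hφ => ?_⟩
  obtain ⟨hφ2, hinv, hsup, hpos⟩ := hφ
  obtain ⟨s₀⟩ := F.exists_maxCone
  obtain ⟨D, hD⟩ := F.exists_abs_expPoint_le (ψ := φ) fun s => (hφ2 s).continuous
  have himag : ∀ Y (θ : Fin n → ℝ),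
      φ (F.expPoint (Y + fun i => (θ i : ℂ) * Complex.I)) = φ (F.expPoint Y) := by
    intro Y θ
    obtain ⟨f, hf, h⟩ := F.exists_mem_compactTorus θ
    rw [← h, hinv f (Subgroup.mem_sup_left hf)]
  have hE : ∀ Y, φ (F.expPoint (realPoint Y₀ fun i => 2 * (Y₀ i).re + -2 * (Y i).re)) =
      φ (F.expPoint Y) := by
    intro Y
    conv_rhs => rw [eq_realPoint_add Y₀ Y]
    rw [himag _ fun i => (Y i).im - (Y₀ i).im]
  have hu : ∀ Y, g.logPotential Φ (realPoint Y₀ fun i => 2 * (Y₀ i).re + -2 * (Y i).re) =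
      g.logPotential Φ Y := by
    intro Y
    conv_rhs => rw [eq_realPoint_add Y₀ Y]
    rw [logPotential_add_imag hΦ hg hG _ fun i => (Y i).im - (Y₀ i).im]
  set ψ := g.reducedPotential Φ Y₀ φ with hψ
  have hψb : ∀ y, |ψ y| ≤ B + D := fun y => (abs_add_le _ _).trans (add_le_add (hB y) (hD _))
  have hbdd : BddAbove (Set.range ψ) := ⟨B + D, by rintro _ ⟨y, rfl⟩; exact (abs_le.1 (hψb y)).2⟩
  set m := sSup (Set.range ψ)
  have hlub : IsLUB (Set.range ψ) m := isLUB_csSup (Set.range_nonempty _) hbdd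
  -- The only use of `sup φ = 0`: if `m < -B`, then `φ ≤ m + B < 0` on the dense open orbit and so
  -- on all of `X`. Subtracting `m` thus costs at most another `B`, whence `2 * B`. The constant `D`
  -- may depend on `φ` and serves only for boundedness.
  have hmB : -B ≤ m := by
    by_contra hlt
    have h1 : ∀ Y, φ (F.expPoint Y) ≤ m + B := by
      intro Y
      rw [← hE]
      have h2 := hlub.1 ⟨fun i => 2 * (Y₀ i).re + -2 * (Y i).re, rfl⟩
      have h3 := (abs_le.1 (hB fun i => 2 * (Y₀ i).re + -2 * (Y i).re)).1
      simp only [hψ, reducedPotential] at h2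
      linarith
    have h4 : ∀ x, φ x ≤ m + B :=
      F.le_of_forall_expPoint_le (fun s => (hφ2 s).continuous) h1
    have h5 : (0 : ℝ) ≤ m + B := hsup.2 (by rintro _ ⟨x, rfl⟩; exact h4 x)
    linarith
  have hmD : |m| ≤ B + D := by
    refine abs_le.2 ⟨?_, hlub.2 (by rintro _ ⟨y, rfl⟩; exact (abs_le.1 (hψb y)).2)⟩
    exact (abs_le.1 (hψb 0)).1.trans (hlub.1 ⟨0, rfl⟩)
  have hu2 : ContDiff ℝ 2 fun y => g.logPotential Φ (realPoint Y₀ y) :=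
    (contDiff_logPotential hΦ).comp (contDiff_realPoint Y₀)
  have hφE : ContDiff ℝ 2 fun y => φ (F.expPoint (realPoint Y₀ y)) := by
    have h1 : ContDiff ℝ 2 fun z => φ (F.chart s₀ z) := hφ2 s₀
    have h2 := h1.comp ((F.contDiff_expCoord s₀).comp (contDiff_realPoint Y₀))
    simpa only [Function.comp_def, chart_expCoord] using h2
  refine ⟨fun y => ψ y - m, ⟨?_, ?_, ?_, ?_, ?_⟩, fun Y => ⟨?_, ?_⟩⟩
  · exact ((hu2.sub (contDiff_realPotential
      ⟨_, coneVertex_mem_latticePoints hΦ hg hG s₀⟩)).add hφE).sub contDiff_const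
  · intro f hf l l' h
    obtain ⟨f', hf', A, b, hA, hlog⟩ := F.exists_mem_pointedWeyl (Y₀ := Y₀) hf
    simp only [hψ]
    rw [hlog l l' h, reducedPotential_mulVec hΦ hg hG hinv hf' hA]
  -- Adding `ũ` cancels the subtracted one and leaves `u + φ - m`.
  · have h1 := (convexOn_logPotential_add hΦ hg hG hφ2 hinv hpos Y₀).add_const (-m)
    refine h1.congr fun y _ => ?_
    simp only [hψ, reducedPotential, Pi.add_apply]
    ring
  · constructor
    · rintro _ ⟨y, rfl⟩
      exact sub_nonpos.2 (hlub.1 ⟨y, rfl⟩)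
    · intro c hc
      have h1 : m ≤ c + m := hlub.2 (by
        rintro _ ⟨y, rfl⟩
        have := hc ⟨y, rfl⟩
        simp only at this
        linarith)
      linarith
  · exact ⟨(B + D) + (B + D), fun y => (abs_sub _ _).trans (add_le_add (hψb y) hmD)⟩
  · have h3 := (abs_le.1 (hB fun i => 2 * (Y₀ i).re + -2 * (Y i).re)).2
    simp only [hψ, reducedPotential, hE]
    linarith
  · have h3 := (abs_le.1 (hB fun i => 2 * (Y₀ i).re + -2 * (Y i).re)).1
    rw [hu] at h3
    linarith

end KahlerMetric

end RegularFan

/-! ## Comparison of the integrals -/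

namespace RegularFan

variable {n : ℕ} {F : RegularFan n}

/-- The linear isomorphism `ℝ^s ≅ N_ℝ` of a maximal cone, scaled by `-2`. -/
noncomputable def coneEquiv (F : RegularFan n) (s : F.maxCones) : (s.1 → ℝ) ≃L[ℝ] (Fin n → ℝ) :=
  LinearEquiv.toContinuousLinearEquiv
    { toFun := fun x i => -2 * ∑ e : s.1, x e * ((e : Fin n → ℤ) i : ℝ)
      invFun := fun y => F.logCoord s ((-(1 / 2) : ℝ) • y)
      map_add' := fun x y => by
        funext i
        simp only [Pi.add_apply, add_mul, Finset.sum_add_distrib]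
        ring
      map_smul' := fun c x => by
        funext i
        simp only [Pi.smul_apply, smul_eq_mul, RingHom.id_apply, mul_assoc, ← Finset.mul_sum]
        ring
      left_inv := fun x => by
        refine Eq.trans (congrArg (F.logCoord s) ?_) (F.logCoord_sum_mul s x)
        funext i
        simp only [Pi.smul_apply, smul_eq_mul]
        ring
      right_inv := fun y => by
        funext i
        change -2 * ∑ e : s.1, F.logCoord s ((-(1 / 2) : ℝ) • y) e * ((e : Fin n → ℤ) i : ℝ) = y i
        rw [F.sum_logCoord_mul]
        simp only [Pi.smul_apply, smul_eq_mul]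
        ring }

theorem coneEquiv_apply (s : F.maxCones) (x : s.1 → ℝ) (i : Fin n) :
    F.coneEquiv s x i = -2 * ∑ e : s.1, x e * ((e : Fin n → ℤ) i : ℝ) := rfl

namespace KahlerMetric

variable {g : F.KahlerMetric} {Φ : F.Variety → ℝ} {Y₀ : Fin n → ℂ}

/-- The volume density in a chart is `e^{-u-Φ}`, up to a constant, times the Jacobian weight that
`lintegral_prod_norm_mul_log` removes. -/
theorem exists_det_coeff_eq (g : F.KahlerMetric) (Φ : F.Variety → ℝ) (s : F.maxCones) :
    ∃ c : ℝ, ∀ Y, (g.coeff s (F.expCoord s Y)).det.re =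
      Real.exp (c - Φ (F.expPoint Y)) * (∏ e, (‖F.expCoord s Y e‖ ^ 2)⁻¹) *
        Real.exp (-g.logPotential Φ Y) := by
  obtain ⟨c, hc⟩ := g.exists_logPotential_eq Φ s
  refine ⟨c, fun Y => ?_⟩
  have h1 : ∏ e, (‖F.expCoord s Y e‖ ^ 2)⁻¹ = Real.exp (-2 * F.sumReLogCoord s Y) := by
    rw [F.sumReLogCoord_apply, Finset.mul_sum, Real.exp_sum]
    refine Finset.prod_congr rfl fun e _ => ?_
    rw [F.norm_expCoord, ← Real.exp_nat_mul, ← Real.exp_neg]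
    congr 1
    push_cast
    ring
  rw [h1, hc Y, chartPotential, chart_expCoord, ← Real.exp_add, ← Real.exp_add]
  conv_lhs => rw [← Real.exp_log (g.det_coeff_pos s (F.expCoord s Y))]
  congr 1
  rw [smul_eq_mul]
  ring

theorem exists_lintegral_chart_le (hΦ : IsCk ⊤ Φ) (Y₀ : Fin n → ℂ) (a : ℝ) (ha : 0 < a) (B : ℝ)
    (hne : F.latticePoints.Nonempty) (s : F.maxCones) :
    ∃ C : ℝ≥0, ∀ (φ : F.Variety → ℝ) (φ' : (Fin n → ℝ) → ℝ), Continuous φ' →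
      (∀ Y, φ' (fun i => 2 * (Y₀ i).re + -2 * (Y i).re) ≤ φ (F.expPoint Y) + B ∧
        F.realPotential (fun i => 2 * (Y₀ i).re + -2 * (Y i).re) ≤ g.logPotential Φ Y + B) →
      ∫⁻ z, ENNReal.ofReal ((Real.pi ^ n)⁻¹ * (g.coeff s z).det.re) *
          ENNReal.ofReal (Real.exp (-a * φ (F.chart s z))) ≤
        C * ∫⁻ y, ENNReal.ofReal (Real.exp (-a * φ' y - F.realPotential y)) := by
  obtain ⟨c, hc⟩ := g.exists_det_coeff_eq Φ s
  obtain ⟨D, hD⟩ := F.exists_abs_expPoint_le (ψ := Φ)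
    fun s => (contDiff_chart_of_isCk_top hΦ s).continuous
  obtain ⟨C, hC⟩ := exists_lintegral_comp_affine (F.coneEquiv s) fun i => 2 * (Y₀ i).re
  -- `D` bounds `-Φ`, `a * B` pays for replacing `φ` by `φ'`, and one more `B` for replacing `u` by
  -- `ũ`. None of these depends on `φ`.
  let K : ℝ := (Real.pi ^ n)⁻¹ * Real.exp (c + D + (a + 1) * B)
  have hK : 0 ≤ K := by positivity
  refine ⟨K.toNNReal * ((2 * Real.pi).toNNReal ^ Fintype.card s.1 * C), fun φ φ' hφ' h => ?_⟩
  let N : (Fin n → ℝ) → ℝ≥0∞ := fun y =>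
    ENNReal.ofReal (Real.exp (-a * φ' y - F.realPotential y))
  have hN : Measurable N := by
    have h1 : Continuous fun y => Real.exp (-a * φ' y - F.realPotential y) :=
      Real.continuous_exp.comp
        ((continuous_const.mul hφ').sub (contDiff_realPotential hne).continuous)
    exact h1.measurable.ennreal_ofReal
  have hNaff : Measurable fun x => N ((fun i => 2 * (Y₀ i).re) + F.coneEquiv s x) :=
    hN.comp ((measurable_const_add _).comp (F.coneEquiv s).continuous.measurable)
  have hpt : ∀ z : s.1 → ℂ, (∀ e, z e ≠ 0) →
      ENNReal.ofReal ((Real.pi ^ n)⁻¹ * (g.coeff s z).det.re) *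
          ENNReal.ofReal (Real.exp (-a * φ (F.chart s z))) ≤
        K.toNNReal * (ENNReal.ofReal (∏ e, (‖z e‖ ^ 2)⁻¹) *
          N ((fun i => 2 * (Y₀ i).re) + F.coneEquiv s fun e => Real.log ‖z e‖)) := by
    intro z hz
    obtain ⟨Y, rfl, hlog⟩ := F.exists_expCoord_eq s hz
    have hy : ((fun i => 2 * (Y₀ i).re) + F.coneEquiv s fun e => Real.log ‖F.expCoord s Y e‖) =
        fun i => 2 * (Y₀ i).re + -2 * (Y i).re := by
      funext i
      rw [Pi.add_apply, coneEquiv_apply]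
      congr 2
      rw [← F.sum_logCoord_mul s (fun i => (Y i).re) i]
      refine Finset.sum_congr rfl fun e _ => ?_
      rw [F.norm_expCoord, Real.log_exp, F.re_logCoord]
    rw [hy, hc Y, chart_expCoord]
    set y : Fin n → ℝ := fun i => 2 * (Y₀ i).re + -2 * (Y i).re
    set P : ℝ := ∏ e, (‖F.expCoord s Y e‖ ^ 2)⁻¹
    have hP0 : 0 ≤ P := Finset.prod_nonneg fun e _ => by positivity
    change _ ≤ ENNReal.ofReal K * (ENNReal.ofReal P *
      ENNReal.ofReal (Real.exp (-a * φ' y - F.realPotential y)))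
    rw [← ENNReal.ofReal_mul (by positivity), ← ENNReal.ofReal_mul hP0, ← ENNReal.ofReal_mul hK]
    refine ENNReal.ofReal_le_ofReal ?_
    obtain ⟨h1, h2⟩ := h Y
    have h3 := (abs_le.1 (hD Y)).1
    have h4 : Real.exp (c - Φ (F.expPoint Y)) * Real.exp (-g.logPotential Φ Y) *
        Real.exp (-a * φ (F.expPoint Y)) ≤
        Real.exp (c + D + (a + 1) * B) * Real.exp (-a * φ' y - F.realPotential y) := by
      rw [← Real.exp_add, ← Real.exp_add, ← Real.exp_add, Real.exp_le_exp]
      have h5 := mul_le_mul_of_nonneg_left h1 ha.le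
      linarith
    have h6 := mul_le_mul_of_nonneg_left h4
      (mul_nonneg (inv_nonneg.2 (pow_nonneg Real.pi_pos.le n)) hP0)
    simp only [K]
    linarith
  have hae : ∀ᵐ z : s.1 → ℂ, ∀ e, z e ≠ 0 :=
    ae_all_iff.2 fun e => Measure.ae_eval_ne (fun _ : s.1 => (MeasureTheory.volume : Measure ℂ)) e 0
  calc _ ≤ ∫⁻ z : s.1 → ℂ, K.toNNReal * (ENNReal.ofReal (∏ e, (‖z e‖ ^ 2)⁻¹) *
          N ((fun i => 2 * (Y₀ i).re) + F.coneEquiv s fun e => Real.log ‖z e‖)) :=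
        lintegral_mono_ae (hae.mono hpt)
    _ = K.toNNReal * (((2 * Real.pi).toNNReal ^ Fintype.card s.1 : ℝ≥0) * (C * ∫⁻ y, N y)) := by
        rw [lintegral_const_mul' _ _ ENNReal.coe_ne_top, lintegral_prod_norm_mul_log hNaff, hC N hN]
    _ = _ := by push_cast; ring

/-- A supremum of measures is at most their sum. Overlapping charts are counted several times, which
is harmless for an upper bound with finitely many charts. -/
theorem lintegral_volume_le (g : F.KahlerMetric) {φ : F.Variety → ℝ} :
    ∫⁻ x, ENNReal.ofReal (Real.exp (φ x)) ∂g.volume ≤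
      ∑ s : F.maxCones, ∫⁻ z, ENNReal.ofReal ((Real.pi ^ n)⁻¹ * (g.coeff s z).det.re) *
        ENNReal.ofReal (Real.exp (φ (F.chart s z))) := by
  have h1 : g.volume ≤ Measure.sum fun s : F.maxCones => Measure.map (F.chart s)
      ((MeasureTheory.volume : Measure (s.1 → ℂ)).withDensity fun z =>
        ENNReal.ofReal ((Real.pi ^ n)⁻¹ * (g.coeff s z).det.re)) :=
    iSup_le fun s => Measure.le_sum _ s
  refine (lintegral_mono' h1 le_rfl).trans ?_
  rw [lintegral_sum_measure, tsum_fintype]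
  refine Finset.sum_le_sum fun s _ => (lintegral_map_le _ _).trans ?_
  refine lintegral_withDensity_le_lintegral_mul _ ?_ _
  refine Measurable.ennreal_ofReal (Measurable.const_mul ?_ _)
  have h2 : (fun z => (g.coeff s z).det.re) = fun z => Real.exp (Real.log (g.coeff s z).det.re) := by
    funext z; rw [Real.exp_log (g.det_coeff_pos s z)]
  rw [h2]
  exact (Real.continuous_exp.comp (g.contDiff_log_det s).continuous).measurable

end KahlerMetric

end RegularFan

/-! ### Comparison of the two invariants. -/

/-- Let `X` be a toric Fano `n`-fold, `x₀` a point of the open orbit, `G` the compact group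
generated by `K(T)` and `W(X, x₀)`. Then `α̃_G(X) ≤ α_G(X)`, where `α_G(X)` may be computed with
any `G`-invariant Kähler metric `g` such that `ω_g` represents `c₁(X)`. -/
theorem proposition3p2 (n : ℕ) (F : RegularFan n) (hX : F.IsFano)
    (x₀ : F.Variety) (hx₀ : x₀ ∈ F.openOrbit)
    (g : F.KahlerMetric) (hg : g.RepresentsC1) (hG : g.IsInvariant (F.compactGroup x₀)) :
    F.realAlpha ≤ g.tianAlpha (F.compactGroup x₀) := by
  obtain ⟨Y₀, rfl⟩ := F.exists_expPoint_of_mem hx₀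
  obtain ⟨Φ, hΦ, hg⟩ := hg
  obtain ⟨B, hB⟩ := RegularFan.KahlerMetric.exists_realPotential_sub_mem hΦ hg hG
  obtain ⟨s₀⟩ := F.exists_maxCone
  refine iSup₂_le fun a ha => ?_
  obtain ⟨ha0, C, hC⟩ := ha
  have h1 := fun s => RegularFan.KahlerMetric.exists_lintegral_chart_le (g := g) hΦ Y₀ a ha0 B
    ⟨_, RegularFan.coneVertex_mem_latticePoints hΦ hg hG s₀⟩ s
  choose D hD using h1
  -- The exponent `a` itself is admissible for Tian's invariant: each chart costs its factor `D s`
  -- over the real bound `C`.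
  refine le_iSup₂_of_le a ⟨ha0, ∑ s, D s * C, fun φ hφ => ?_⟩ le_rfl
  obtain ⟨φ', hφ', hle⟩ := hB φ hφ
  refine g.lintegral_volume_le.trans ?_
  rw [ENNReal.ofNNReal_finsetSum]
  refine Finset.sum_le_sum fun s _ => (hD s φ φ' hφ'.1.continuous hle).trans ?_
  rw [ENNReal.coe_mul]
  exact mul_le_mul_right (hC φ' hφ') _
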